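/- Let $\mathbf{k}$ be a commutative ring and let $\delta\in\mathbf{k}$. \textbf{FB-modules.} Let $\mathbf{FB}$ be the category of finite sets and bijections, and let $\mathrm{Mod}_{\mathbf{FB}}$ be the category of functors $\mathbf{FB}\to\mathrm{Mod}_{\mathbf{k}}$, with the symmetric tensor product $(M\otimes N)(S)=\bigoplus_{T\subseteq S}M(T)\otimes N(S\setminus T)$. Let $\mathbf{V}$ be the $\mathbf{FB}$-module that is $\mathbf{k}$ on one-element sets and $0$ on all other sets. Then $\mathrm{Sym}(\mathbf{V})(S)$ is free of rank one with basis $t^S$ for every finite set $S$, with multiplication $m(t^A\otimes t^B)=t^{A\sqcup B}$ and comultiplication $\Delta\colon\mathrm{Sym}(\mathbf{V})\to\mathbf{V}\otimes\mathrm{Sym}(\mathbf{V})$, $\Delta(t^S)=\sum_{i\in S}t^{i}\otimes t^{S\setminus i}$. \textbf{The curried Witt algebra.} A representation of the curried Witt algebra $\underline{W}(\mathbf{V})$ is an $\mathbf{FB}$-module $M$ with a map $a\colon\mathrm{Sym}(\mathbf{V})\otimes M\to\mathbf{V}\otimes M$ of $\mathbf{FB}$-modules such that $[a_1,a_2]=a'-a''$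 as maps $\mathrm{Sym}(\mathbf{V})\otimes\mathrm{Sym}(\mathbf{V})\otimes M\to\mathbf{V}\otimes\mathbf{V}\otimes M$. Here $\tau$ denotes the switch of the first two tensor factors, $a_2$ is $a$ applied to the second and third factors, $a_1=\tau a_2\tau$, the map $a'$ is the composite $$(\mathrm{id}\otimes a)\circ(\mathrm{id}\otimes m\otimes\mathrm{id})\circ(\tau\otimes\mathrm{id}\otimes\mathrm{id})\circ(\mathrm{id}\otimes\Delta\otimes\mathrm{id}),$$ and $a''=\tau a'\tau$. A morphism $(M,a)\to(N,b)$ is a map $\varphi\colon M\to N$ of $\mathbf{FB}$-modules with $(\mathrm{id}\otimes\varphi)a=b(\mathrm{id}\otimes\varphi)$. A representation is $\delta$-standard if for every finite set $S$, every $j\in S$ and every $x\in M(S\setminus j)$ one has $$a(t^{j}\otimes x)=\delta\, t^{j}\otimes x+\sum_{i\in S\setminus j}t^{i}\otimes(\iota^S_{i,j})_*(x),$$ where $\iota^S_{i,j}\colon S\setminus j\to S\setminus i$ is the bijection that sends $i$ to $j$ and fixes all other elements. Let $\mathrm{Rep}_\delta(\underline{W}(\mathbf{V}))$ be the full subcategory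 of $\delta$-standard representations. \textbf{The restricted partition category.} The partition category $\mathfrak{G}(\delta)$ has the finite sets as objects, and $\mathrm{Hom}(S,T)$ is the free $\mathbf{k}$-module on the set-partitions of $S\amalg T$; diagrams are composed by stacking them and removing the middle vertices, with a factor $\delta$ for each part that consists of middle vertices only. The restricted partition category $\mathfrak{G}^r(\delta)$ is the subcategory with all objects, whose morphisms $S\to T$ are spanned by the partitions in which each part contains at most one element of $S$. A $\mathfrak{G}^r(\delta)$-module is a $\mathbf{k}$-linear functor $\mathfrak{G}^r(\delta)\to\mathrm{Mod}_{\mathbf{k}}$. \textbf{Theorem.} There is an isomorphism of categories $$\mathrm{Mod}_{\mathfrak{G}^r(\delta)}\cong\mathrm{Rep}_\delta(\underline{W}(\mathbf{V})).$$ It sends a $\mathfrak{G}^r(\delta)$-module $M$ to its restriction to $\mathbf{FB}$, equipped with the map $$a(t^B\otimes x)=\sum_{i\in B}t^i\otimes\omega^{S\setminus i}_{B\setminus i}(x)+\sum_{i\in S\setminus B}t^i\otimes\alpha^S_{i,B}(x)\qquad(B\subseteq S,\ x\in M(S\setminus B)),$$ and it sends a morphism to the underlying map of $\mathbf{FB}$-modules.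 Here $\alpha^S_{i,B}\colon M(S\setminus B)\to M(S\setminus i)$ is induced by the diagram in which $\{i\}\cup B$ is a part and which is the identity elsewhere, $\omega^S_A\colon M(S\setminus A)\to M(S)$ is induced, for $A\neq\emptyset$, by the diagram in which $A$ is a part and which is the identity elsewhere, and $\omega^S_\emptyset=\delta\cdot\mathrm{id}$. -/

import Mathlib

open CategoryTheory

universe u

namespace CurriedWitt

/-! ## Partition diagrams and their composition -/

theorem map_le_iff {X Y : Type*} (r : Setoid X) (f : X → Y) (s : Setoid Y) :
    r.map f ≤ s ↔ r ≤ s.comap f := by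
  constructor
  · intro h x y hxy
    exact h (Relation.EqvGen.rel _ _ ⟨x, y, hxy, rfl, rfl⟩)
  · intro h
    refine Setoid.eqvGen_le ?_
    rintro _ _ ⟨x, y, hxy, rfl, rfl⟩
    exact h hxy

theorem map_sup {X Y : Type*} (r s : Setoid X) (f : X → Y) :
    (r ⊔ s).map f = r.map f ⊔ s.map f :=
  eq_of_forall_ge_iff fun t => by
    rw [map_le_iff, sup_le_iff, sup_le_iff, map_le_iff, map_le_iff]

theorem map_map {X Y Z : Type*} (r : Setoid X) (f : X → Y) (g : Y → Z) :
    (r.map f).map g = r.map (g ∘ f) :=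
  eq_of_forall_ge_iff fun t => by
    rw [map_le_iff, map_le_iff, map_le_iff]; rfl

/-- A partition diagram from `S` to `T`: a set-partition of `S ⊔ T`, given as an equivalence
relation; the parts are the equivalence classes. -/
abbrev Diagram (S T : Type) : Type := Setoid (S ⊕ T)

/-- The number of classes of `r` that contain no element of `K`. -/
noncomputable def numAvoid {X : Type} (r : Setoid X) (K : Set X) : ℕ :=
  Nat.card {c : Quotient r // ∀ x ∈ K, Quotient.mk r x ≠ c}

namespace Diagram

variable {S T U W : Type}

/-- The diagrams `ρ` and `σ` stacked on top of each other: the equivalence relation on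
`S ⊔ T ⊔ U` generated by `ρ` on `S ⊔ T` and `σ` on `T ⊔ U`. -/
def glue (ρ : Diagram S T) (σ : Diagram T U) : Setoid (S ⊕ (T ⊕ U)) :=
  ρ.map (Sum.map id Sum.inl) ⊔ σ.map Sum.inr

/-- The inclusion of the outer vertices `S ⊔ U` in `S ⊔ T ⊔ U`. -/
def outer : S ⊕ U → S ⊕ (T ⊕ U) := Sum.map id Sum.inr

/-- The composite diagram from `S` to `U`, first `ρ : S → T` and then `σ : T → U`: stack the
diagrams and remove the middle vertices. -/
def comp (ρ : Diagram S T) (σ : Diagram T U) : Diagram S U := (glue ρ σ).comap outer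

/-- The number of parts of the stacked diagram that consist of middle vertices only. -/
noncomputable def loops (ρ : Diagram S T) (σ : Diagram T U) : ℕ :=
  numAvoid (glue ρ σ) (Set.range outer)

/-- The diagram of a bijection `e : S ≃ T`: its parts are the pairs `{s, e s}`. -/
def ofEquiv (e : S ≃ T) : Diagram S T := Setoid.ker (Sum.elim e id)

/-- A diagram from `S` to `T` is restricted if each part contains at most one element of `S`. -/
def IsRestricted (ρ : Diagram S T) : Prop := ∀ s s' : S, ρ (Sum.inl s) (Sum.inl s') → s = s'

/-! ### Elimination of middle vertices -/

section Elim

variable {X Y Z P : Type} (A : Setoid Z) (B : Setoid Y) (f : Z → X) (g : Y → X)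
  (z : P → Z) (p : P → Y)

theorem elim_exists (hf : Function.Injective f) (hg : Function.Injective g)
    (hcov : ∀ x, (∃ y, g y = x) ∨ ∃ a, f a = x) (hsq : ∀ q, f (z q) = g (p q))
    (hint : ∀ a y, f a = g y → ∃ q, z q = a ∧ p q = y) :
    ∃ E : Quotient (A.map f ⊔ B.map g) ≃
        Quotient ((A.comap z).map p ⊔ B) ⊕ {c : Quotient A // ∀ x ∈ Set.range z, Quotient.mk A x ≠ c},
      ∀ y, E (Quotient.mk _ (g y)) = Sum.inl (Quotient.mk _ y) := by
  classical
  set J := A.map f ⊔ B.map g with hJ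
  set J' := (A.comap z).map p ⊔ B with hJ'
  have hA : A ≤ J.comap f := (map_le_iff _ _ _).1 le_sup_left
  have hB : B ≤ J.comap g := (map_le_iff _ _ _).1 le_sup_right
  have hA' : A.comap z ≤ J'.comap p := (map_le_iff _ _ _).1 le_sup_left
  have hB' : B ≤ J' := le_sup_right
  have hJ'J : J' ≤ J.comap g := by
    refine sup_le ((map_le_iff _ _ _).2 ?_) hB
    intro q q' h
    change J (g (p q)) (g (p q'))
    rw [← hsq, ← hsq]
    exact hA h
  let Fl := {c : Quotient A // ∀ x ∈ Set.range z, Quotient.mk A x ≠ c}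
  have key : ∀ x : X, ∃ v : Quotient J' ⊕ Fl,
      (∀ y, g y = x → v = Sum.inl (Quotient.mk J' y)) ∧
      (∀ a q, f a = x → A a (z q) → v = Sum.inl (Quotient.mk J' (p q))) ∧
      (∀ a (c : Fl), f a = x → c.1 = Quotient.mk A a → v = Sum.inr c) := by
    intro x
    by_cases h1 : ∃ y, g y = x
    · obtain ⟨y, rfl⟩ := h1
      refine ⟨Sum.inl (Quotient.mk J' y), ?_, ?_, ?_⟩
      · intro y' hy'; rw [hg hy']
      · intro a q ha haq
        obtain ⟨q', rfl, rfl⟩ := hint a y ha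
        exact congrArg Sum.inl (Quotient.sound (hA' haq))
      · intro a c ha hc
        obtain ⟨q', rfl, rfl⟩ := hint a y ha
        exact absurd hc.symm (c.2 _ ⟨q', rfl⟩)
    · obtain ⟨a, rfl⟩ := (hcov x).resolve_left h1
      by_cases h2 : ∃ q, A a (z q)
      · obtain ⟨q, hq⟩ := h2
        refine ⟨Sum.inl (Quotient.mk J' (p q)), ?_, ?_, ?_⟩
        · intro y hy; exact absurd ⟨y, hy⟩ h1
        · intro a' q' ha' h'
          obtain rfl := hf ha'
          exact congrArg Sum.inl (Quotient.sound (hA' (A.trans (A.symm hq) h')))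
        · intro a' c ha' hc
          obtain rfl := hf ha'
          exact absurd (hc.trans (Quotient.sound hq)).symm (c.2 _ ⟨q, rfl⟩)
      · refine ⟨Sum.inr ⟨Quotient.mk A a, ?_⟩, ?_, ?_, ?_⟩
        · rintro _ ⟨q, rfl⟩ h
          exact h2 ⟨q, A.symm (Quotient.exact h)⟩
        · intro y hy; exact absurd ⟨y, hy⟩ h1
        · intro a' q' ha' h'
          obtain rfl := hf ha'
          exact absurd ⟨q', h'⟩ h2
        · intro a' c ha' hc
          obtain rfl := hf ha'
          exact congrArg Sum.inr (Subtype.ext hc.symm)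
  choose F F1 F2 F3 using key
  have hJF : J ≤ Setoid.ker F := by
    refine sup_le ((map_le_iff _ _ _).2 ?_) ((map_le_iff _ _ _).2 ?_)
    · intro a a' h
      change F (f a) = F (f a')
      by_cases h2 : ∃ q, A a (z q)
      · obtain ⟨q, hq⟩ := h2
        rw [F2 _ a q rfl hq, F2 _ a' q rfl (A.trans (A.symm h) hq)]
      · have hav : ∀ x ∈ Set.range z, Quotient.mk A x ≠ Quotient.mk A a := by
          rintro _ ⟨q, rfl⟩ h
          exact h2 ⟨q, A.symm (Quotient.exact h)⟩
        rw [F3 _ a ⟨_, hav⟩ rfl rfl, F3 _ a' ⟨_, hav⟩ rfl (Quotient.sound h)]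
    · intro y y' h
      change F (g y) = F (g y')
      rw [F1 _ y rfl, F1 _ y' rfl]
      exact congrArg Sum.inl (Quotient.sound (hB' h))
  let Φ : Quotient J → Quotient J' ⊕ Fl := Quotient.lift F fun _ _ h => hJF h
  let Ψ : Quotient J' ⊕ Fl → Quotient J :=
    Sum.elim (Quotient.lift (fun y => Quotient.mk J (g y)) fun _ _ h => Quotient.sound (hJ'J h))
      (fun c => Quotient.lift (fun a => Quotient.mk J (f a))
        (fun _ _ h => Quotient.sound (hA h)) c.1)
  refine ⟨⟨Φ, Ψ, ?_, ?_⟩, fun y => F1 _ y rfl⟩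
  · intro c
    induction c using Quotient.inductionOn with
    | h x =>
      change Ψ (F x) = _
      rcases hcov x with ⟨y, rfl⟩ | ⟨a, rfl⟩
      · rw [F1 _ y rfl]; rfl
      · by_cases h2 : ∃ q, A a (z q)
        · obtain ⟨q, hq⟩ := h2
          rw [F2 _ a q rfl hq]
          change Quotient.mk J (g (p q)) = _
          rw [← hsq]
          exact Quotient.sound (hA (A.symm hq))
        · have hav : ∀ x ∈ Set.range z, Quotient.mk A x ≠ Quotient.mk A a := by
            rintro _ ⟨q, rfl⟩ h
            exact h2 ⟨q, A.symm (Quotient.exact h)⟩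
          rw [F3 _ a ⟨_, hav⟩ rfl rfl]
          rfl
  · rintro (c | ⟨c, hc⟩)
    · induction c using Quotient.inductionOn with
      | h y => exact F1 _ y rfl
    · induction c using Quotient.inductionOn with
      | h a => exact F3 _ a ⟨_, hc⟩ rfl rfl

theorem elim_comap_and_numAvoid [Finite X] [Finite Z] [Finite Y]
    (hf : Function.Injective f) (hg : Function.Injective g)
    (hcov : ∀ x, (∃ y, g y = x) ∨ ∃ a, f a = x) (hsq : ∀ q, f (z q) = g (p q))
    (hint : ∀ a y, f a = g y → ∃ q, z q = a ∧ p q = y) :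
    (A.map f ⊔ B.map g).comap g = (A.comap z).map p ⊔ B ∧
    ∀ K : Set Y, numAvoid (A.map f ⊔ B.map g) (g '' K) =
      numAvoid ((A.comap z).map p ⊔ B) K + numAvoid A (Set.range z) := by
  obtain ⟨E, hE⟩ := elim_exists A B f g z p hf hg hcov hsq hint
  constructor
  · ext y y'
    rw [Setoid.comap_rel, ← Quotient.eq (r := A.map f ⊔ B.map g), ← E.injective.eq_iff, hE, hE,
      Sum.inl.injEq]
    exact Quotient.eq (r := (A.comap z).map p ⊔ B)
  · intro K
    unfold numAvoid
    rw [← Nat.card_sum]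
    refine Nat.card_congr ?_
    refine (E.subtypeEquiv (q := fun v => ∀ y ∈ K, Sum.inl (Quotient.mk _ y) ≠ v) ?_).trans
      (Equiv.subtypeSum.trans (Equiv.sumCongr (Equiv.subtypeEquivRight ?_)
        (Equiv.subtypeUnivEquiv ?_)))
    · intro c
      simp only [Set.forall_mem_image, ← hE, ne_eq, E.injective.eq_iff]
    · intro c
      simp
    · intro c y _
      simp

end Elim

theorem comp_assoc_and_loops [Finite S] [Finite T] [Finite U] [Finite W]
    (ρ : Diagram S T) (σ : Diagram T U) (τ : Diagram U W) :
    comp (comp ρ σ) τ = comp ρ (comp σ τ) ∧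
      loops (comp ρ σ) τ + loops ρ σ = loops ρ (comp σ τ) + loops σ τ := by
  let f : S ⊕ (T ⊕ U) → S ⊕ (T ⊕ (U ⊕ W)) := Sum.map id (Sum.map id Sum.inl)
  let g : S ⊕ (U ⊕ W) → S ⊕ (T ⊕ (U ⊕ W)) := outer
  let f' : T ⊕ (U ⊕ W) → S ⊕ (T ⊕ (U ⊕ W)) := Sum.inr
  let g' : S ⊕ (T ⊕ W) → S ⊕ (T ⊕ (U ⊕ W)) := Sum.map id (Sum.map id Sum.inr)
  obtain ⟨h1, h2⟩ := elim_comap_and_numAvoid (glue ρ σ) (τ.map Sum.inr) f g outer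
    (Sum.map id Sum.inl) (by
      rintro (s | t | u) (s' | t' | u') <;> simp [f]) (by
      rintro (s | u | w) (s' | u' | w') <;> simp [g, outer]) (by
      rintro (s | t | u | w) <;> simp [f, g, outer]) (by
      rintro (s | u) <;> simp [f, g, outer]) (by
      rintro (s | t | u) (s' | u' | w') <;> simp [f, g, outer])
  obtain ⟨h3, h4⟩ := elim_comap_and_numAvoid (glue σ τ) (ρ.map (Sum.map id Sum.inl)) f' g' outer
    Sum.inr (by
      rintro (s | t | u) (s' | t' | u') <;> simp [f']) (by
      rintro (s | u | w) (s' | u' | w') <;> simp [g']) (by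
      rintro (s | t | u | w) <;> simp [f', g']) (by
      rintro (s | u) <;> simp [f', g', outer]) (by
      rintro (s | t | u) (s' | u' | w') <;> simp [f', g', outer, eq_comm])
  have hX : (glue ρ σ).map f ⊔ (τ.map Sum.inr).map g =
      (glue σ τ).map f' ⊔ (ρ.map (Sum.map id Sum.inl)).map g' := by
    unfold glue
    rw [map_sup, map_sup]
    simp only [map_map]
    have e1 : f ∘ Sum.map id Sum.inl = g' ∘ Sum.map id Sum.inl := by
      funext x; rcases x with s | t <;> rfl
    have e2 : f ∘ Sum.inr = f' ∘ Sum.map id Sum.inl := by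
      funext x; rcases x with s | t <;> rfl
    have e3 : g ∘ Sum.inr = f' ∘ Sum.inr := by
      funext x; rcases x with s | t <;> rfl
    rw [e1, e2, e3, sup_assoc, sup_comm]
  have hL : (Setoid.comap outer (glue ρ σ)).map (Sum.map id Sum.inl) ⊔ τ.map Sum.inr =
      glue (comp ρ σ) τ := rfl
  have hR : (Setoid.comap outer (glue σ τ)).map Sum.inr ⊔ ρ.map (Sum.map id Sum.inl) =
      glue ρ (comp σ τ) := sup_comm _ _
  rw [hL] at h1 h2
  rw [hR] at h3 h4
  rw [hX] at h1 h2
  have hgg : g ∘ outer = g' ∘ (outer : S ⊕ W → _) := by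
    funext x; rcases x with s | t <;> rfl
  constructor
  · unfold comp
    change Setoid.comap outer (glue (comp ρ σ) τ) = Setoid.comap outer (glue ρ (comp σ τ))
    rw [← h1, ← h3]
    ext (x | x) (y | y) <;> rfl
  · have h5 := h2 (Set.range outer)
    have h6 := h4 (Set.range outer)
    rw [← Set.range_comp] at h5 h6
    rw [hgg, h6] at h5
    exact h5.symm

theorem glue_ofEquiv_left (e : S ≃ T) (σ : Diagram T U) :
    glue (ofEquiv e) σ = σ.comap (Sum.elim (fun s => Sum.inl (e s)) id) := by
  apply le_antisymm
  · refine sup_le ((map_le_iff _ _ _).2 ?_) ((map_le_iff _ _ _).2 ?_)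
    · rintro (s | t) (s' | t') h <;>
        simpa [Setoid.comap_rel] using (congrArg Sum.inl (β := T ⊕ U) h ▸ σ.refl _)
    · intro x y h; exact h
  · have h0 : ∀ x, glue (ofEquiv e) σ x
        (Sum.inr ((Sum.elim (fun s => Sum.inl (e s)) id : S ⊕ (T ⊕ U) → T ⊕ U) x)) := by
      rintro (s | x)
      · have : ofEquiv e ≤ (glue (ofEquiv e) σ).comap (Sum.map id Sum.inl) :=
          (map_le_iff _ _ _).1 le_sup_left
        exact this (show ofEquiv e (Sum.inl s) (Sum.inr (e s)) from rfl)
      · exact Setoid.refl' _ _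
    intro x y h
    have h1 : σ ≤ (glue (ofEquiv e) σ).comap Sum.inr := (map_le_iff _ _ _).1 le_sup_right
    exact Setoid.trans' _ (h0 x) (Setoid.trans' _ (h1 h) (Setoid.symm' _ (h0 y)))

theorem glue_ofEquiv_right (ρ : Diagram S T) (e : T ≃ U) :
    glue ρ (ofEquiv e) =
      ρ.comap (Sum.elim Sum.inl (fun x => Sum.inr (Sum.elim id e.symm x))) := by
  let F : S ⊕ (T ⊕ U) → S ⊕ T := Sum.elim Sum.inl (fun x => Sum.inr (Sum.elim id e.symm x))
  apply le_antisymm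
  · refine sup_le ((map_le_iff _ _ _).2 ?_) ((map_le_iff _ _ _).2 ?_)
    · rintro (s | t) (s' | t') h <;> exact h
    · intro x y h
      have h' : ∀ x : T ⊕ U, F (Sum.inr x) = Sum.inr (e.symm (Sum.elim e id x)) := by
        rintro (t | u) <;> simp [F]
      change ρ (F (Sum.inr x)) (F (Sum.inr y))
      rw [h', h', show Sum.elim e id x = Sum.elim e id y from h]
  · have h0 : ∀ x, glue ρ (ofEquiv e) x (Sum.map id Sum.inl (F x)) := by
      rintro (s | t | u)
      · exact Setoid.refl' _ _
      · exact Setoid.refl' _ _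
      · have : ofEquiv e ≤ (glue ρ (ofEquiv e)).comap Sum.inr :=
          (map_le_iff _ _ _).1 le_sup_right
        exact this (show ofEquiv e (Sum.inr u) (Sum.inl (e.symm u)) from
          (e.apply_symm_apply u).symm)
    intro x y h
    have h1 : ρ ≤ (glue ρ (ofEquiv e)).comap (Sum.map id Sum.inl) :=
      (map_le_iff _ _ _).1 le_sup_left
    exact Setoid.trans' _ (h0 x) (Setoid.trans' _ (h1 h) (Setoid.symm' _ (h0 y)))

theorem numAvoid_eq_zero {X : Type} (r : Setoid X) (K : Set X) (h : ∀ x, ∃ y ∈ K, r y x) :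
    numAvoid r K = 0 := by
  have : IsEmpty {c : Quotient r // ∀ x ∈ K, Quotient.mk r x ≠ c} := by
    refine ⟨?_⟩
    rintro ⟨c, hc⟩
    induction c using Quotient.inductionOn with
    | h x =>
      obtain ⟨y, hy, hyx⟩ := h x
      exact hc y hy (Quotient.sound hyx)
  exact Nat.card_of_isEmpty

theorem loops_ofEquiv_left (e : S ≃ T) (σ : Diagram T U) : loops (ofEquiv e) σ = 0 := by
  refine numAvoid_eq_zero _ _ ?_
  rw [glue_ofEquiv_left]
  rintro (s | t | u)
  · exact ⟨_, ⟨Sum.inl s, rfl⟩, Setoid.refl' _ _⟩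
  · refine ⟨_, ⟨Sum.inl (e.symm t), rfl⟩, ?_⟩
    rw [Setoid.comap_rel]
    simp only [outer, Sum.map_inl, id, Sum.elim_inl, Sum.elim_inr, Equiv.apply_symm_apply]
    exact Setoid.refl' _ _
  · exact ⟨_, ⟨Sum.inr u, rfl⟩, Setoid.refl' _ _⟩

theorem loops_ofEquiv_right (ρ : Diagram S T) (e : T ≃ U) : loops ρ (ofEquiv e) = 0 := by
  refine numAvoid_eq_zero _ _ ?_
  rw [glue_ofEquiv_right]
  rintro (s | t | u)
  · exact ⟨_, ⟨Sum.inl s, rfl⟩, Setoid.refl' _ _⟩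
  · refine ⟨_, ⟨Sum.inr (e t), rfl⟩, ?_⟩
    rw [Setoid.comap_rel]
    simp only [outer, Sum.map_inr, Sum.elim_inl, Sum.elim_inr, Equiv.symm_apply_apply, id]
    exact Setoid.refl' _ _
  · exact ⟨_, ⟨Sum.inr u, rfl⟩, Setoid.refl' _ _⟩

theorem ofEquiv_comp (e : S ≃ T) (σ : Diagram T U) :
    comp (ofEquiv e) σ = σ.comap (Sum.map e id) := by
  unfold comp
  rw [glue_ofEquiv_left]
  ext (x | x) (y | y) <;> rfl

theorem comp_ofEquiv (ρ : Diagram S T) (e : T ≃ U) :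
    comp ρ (ofEquiv e) = ρ.comap (Sum.map id e.symm) := by
  unfold comp
  rw [glue_ofEquiv_right]
  ext (x | x) (y | y) <;> rfl

theorem isRestricted_ofEquiv (e : S ≃ T) : IsRestricted (ofEquiv e) :=
  fun _ _ h => e.injective h

theorem IsRestricted.comp {ρ : Diagram S T} {σ : Diagram T U} (hρ : IsRestricted ρ)
    (hσ : IsRestricted σ) : IsRestricted (ρ.comp σ) := by
  classical
  let F : S ⊕ (T ⊕ U) → Quotient ρ ⊕ Quotient σ :=
    Sum.elim (fun s => Sum.inl (Quotient.mk ρ (Sum.inl s))) fun x =>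
      if h : ∃ t, σ x (Sum.inl t) then Sum.inl (Quotient.mk ρ (Sum.inr h.choose))
      else Sum.inr (Quotient.mk σ x)
  have hF : ∀ x t, σ x (Sum.inl t) → F (Sum.inr x) = Sum.inl (Quotient.mk ρ (Sum.inr t)) := by
    intro x t h
    have h' : ∃ t, σ x (Sum.inl t) := ⟨t, h⟩
    have : h'.choose = t := hσ _ _ (σ.trans (σ.symm h'.choose_spec) h)
    simp only [F, Sum.elim_inr, dif_pos h', this]
  have hle : glue ρ σ ≤ Setoid.ker F := by
    refine sup_le ((map_le_iff _ _ _).2 ?_) ((map_le_iff _ _ _).2 ?_)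
    · have h1 : ∀ x, F (Sum.map id Sum.inl x) = Sum.inl (Quotient.mk ρ x) := by
        rintro (s | t)
        · rfl
        · exact hF _ t (σ.refl _)
      intro x y h
      change F _ = F _
      rw [h1, h1]
      exact congrArg Sum.inl (Quotient.sound h)
    · intro x y h
      change F _ = F _
      by_cases hx : ∃ t, σ x (Sum.inl t)
      · obtain ⟨t, ht⟩ := hx
        rw [hF x t ht, hF y t (σ.trans (σ.symm h) ht)]
      · have hy : ¬ ∃ t, σ y (Sum.inl t) := fun ⟨t, ht⟩ => hx ⟨t, σ.trans h ht⟩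
        simp only [F, Sum.elim_inr, dif_neg hx, dif_neg hy]
        exact congrArg Sum.inr (Quotient.sound h)
  intro s s' h
  have h1 : F (Sum.inl s) = F (Sum.inl s') := hle h
  exact hρ _ _ (Quotient.exact (Sum.inl.inj h1))

end Diagram

/-! ## The categories of finite sets -/

/-- The category of finite sets and bijections. -/
structure FB : Type 1 where
  of ::
  carrier : Type
  [finite : Finite carrier]

attribute [instance] FB.finite

instance : Category FB where
  Hom S T := S.carrier ≃ T.carrier
  id _ := Equiv.refl _
  comp e f := e.trans f

/-- Composition of linear combinations of partition diagrams with parameter `δ`: the bilinear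
extension of `(ρ, σ) ↦ δ ^ (number of removed parts) • (ρ followed by σ)`. -/
noncomputable def compHom {k : Type u} [CommRing k] (δ : k) (S T U : Type) :
    (Diagram S T →₀ k) →ₗ[k] (Diagram T U →₀ k) →ₗ[k] (Diagram S U →₀ k) :=
  Finsupp.linearCombination k fun ρ => Finsupp.linearCombination k fun σ =>
    Finsupp.single (ρ.comp σ) (δ ^ ρ.loops σ)

section compHom

variable {k : Type u} [CommRing k] (δ : k) {S T U W : Type}

theorem compHom_single (ρ : Diagram S T) (σ : Diagram T U) (a b : k) :
    compHom δ S T U (Finsupp.single ρ a) (Finsupp.single σ b) =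
      Finsupp.single (ρ.comp σ) (a * b * δ ^ ρ.loops σ) := by
  simp only [compHom, Finsupp.linearCombination_single, LinearMap.smul_apply, Finsupp.smul_single,
    smul_eq_mul, mul_assoc]

theorem compHom_assoc [Finite S] [Finite T] [Finite U] [Finite W]
    (f : Diagram S T →₀ k) (g : Diagram T U →₀ k) (h : Diagram U W →₀ k) :
    compHom δ S U W (compHom δ S T U f g) h = compHom δ S T W f (compHom δ T U W g h) := by
  induction f using Finsupp.induction_linear with
  | zero => simp
  | add f f' hf hf' => simp only [map_add, LinearMap.add_apply, hf, hf']
  | single ρ a =>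
    induction g using Finsupp.induction_linear with
    | zero => simp
    | add g g' hg hg' => simp only [map_add, LinearMap.add_apply, hg, hg']
    | single σ b =>
      induction h using Finsupp.induction_linear with
      | zero => simp
      | add h h' hh hh' => simp only [map_add, hh, hh']
      | single τ c =>
        simp only [compHom_single]
        obtain ⟨h1, h2⟩ := Diagram.comp_assoc_and_loops ρ σ τ
        rw [h1]
        congr 1
        calc a * b * δ ^ ρ.loops σ * c * δ ^ (ρ.comp σ).loops τ
            = a * b * c * δ ^ ((ρ.comp σ).loops τ + ρ.loops σ) := by ring
          _ = a * (b * c * δ ^ σ.loops τ) * δ ^ ρ.loops (σ.comp τ) := by rw [h2]; ring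

theorem compHom_ofEquiv_left (e : S ≃ T) (f : Diagram T U →₀ k) :
    compHom δ S T U (Finsupp.single (Diagram.ofEquiv e) 1) f =
      f.mapDomain (Setoid.comap (Sum.map e id)) := by
  induction f using Finsupp.induction_linear with
  | zero => simp
  | add f f' hf hf' => simp only [map_add, hf, hf', Finsupp.mapDomain_add]
  | single σ b =>
    rw [compHom_single, Diagram.ofEquiv_comp, Diagram.loops_ofEquiv_left, Finsupp.mapDomain_single]
    simp

theorem compHom_ofEquiv_right (f : Diagram S T →₀ k) (e : T ≃ U) :
    compHom δ S T U f (Finsupp.single (Diagram.ofEquiv e) 1) =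
      f.mapDomain (Setoid.comap (Sum.map id e.symm)) := by
  induction f using Finsupp.induction_linear with
  | zero => simp
  | add f f' hf hf' => simp only [map_add, LinearMap.add_apply, hf, hf', Finsupp.mapDomain_add]
  | single σ b =>
    rw [compHom_single, Diagram.comp_ofEquiv, Diagram.loops_ofEquiv_right, Finsupp.mapDomain_single]
    simp

theorem mapDomain_comap_id (f : Diagram S T →₀ k) :
    f.mapDomain (Setoid.comap (Sum.map id id)) = f := by
  have : (Setoid.comap (Sum.map id id) : Diagram S T → Diagram S T) = id := by
    funext ρ
    rw [Sum.map_id_id]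
    rfl
  rw [this, Finsupp.mapDomain_id]

/-- The linear combinations of restricted diagrams. -/
noncomputable def restrictedHom (k : Type u) [CommRing k] (S T : Type) :
    Submodule k (Diagram S T →₀ k) :=
  Submodule.span k {f | ∃ ρ : Diagram S T, ρ.IsRestricted ∧ f = Finsupp.single ρ 1}

theorem compHom_mem_restrictedHom {f : Diagram S T →₀ k} {g : Diagram T U →₀ k}
    (hf : f ∈ restrictedHom k S T) (hg : g ∈ restrictedHom k T U) :
    compHom δ S T U f g ∈ restrictedHom k S U := by
  induction hf using Submodule.span_induction with
  | zero => simp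
  | add f f' _ _ hf hf' => simpa using add_mem hf hf'
  | smul a f _ hf => simpa using Submodule.smul_mem _ a hf
  | mem f hf =>
    obtain ⟨ρ, hρ, rfl⟩ := hf
    induction hg using Submodule.span_induction with
    | zero => simp
    | add g g' _ _ hg hg' => simpa using add_mem hg hg'
    | smul a g _ hg => simpa using Submodule.smul_mem _ a hg
    | mem g hg =>
      obtain ⟨σ, hσ, rfl⟩ := hg
      rw [compHom_single, ← mul_one (1 * 1 * δ ^ ρ.loops σ), ← smul_eq_mul, ← Finsupp.smul_single]
      exact Submodule.smul_mem _ _ (Submodule.subset_span ⟨_, hρ.comp hσ, rfl⟩)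

theorem ofEquiv_mem_restrictedHom (e : S ≃ T) :
    Finsupp.single (Diagram.ofEquiv e) 1 ∈ restrictedHom k S T :=
  Submodule.subset_span ⟨_, Diagram.isRestricted_ofEquiv e, rfl⟩

end compHom

/-- The partition category with parameter `δ`: the objects are the finite sets, and the morphisms
from `S` to `T` are the linear combinations of partition diagrams from `S` to `T`. -/
structure PartitionCat (k : Type u) [CommRing k] (δ : k) : Type 1 where
  of ::
  carrier : Type
  [finite : Finite carrier]

attribute [instance] PartitionCat.finite

noncomputable instance (k : Type u) [CommRing k] (δ : k) : Category.{u} (PartitionCat k δ) where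
  Hom S T := Diagram S.carrier T.carrier →₀ k
  id S := Finsupp.single (Diagram.ofEquiv (Equiv.refl _)) 1
  comp f g := compHom δ _ _ _ f g
  id_comp f := (compHom_ofEquiv_left δ _ f).trans (mapDomain_comap_id f)
  comp_id f := (compHom_ofEquiv_right δ f _).trans (mapDomain_comap_id f)
  assoc f g h := compHom_assoc δ f g h

/-- The restricted partition category with parameter `δ`: the subcategory of the partition category
with all objects, whose morphisms are the linear combinations of restricted diagrams. -/
structure ResPartitionCat (k : Type u) [CommRing k] (δ : k) : Type 1 where
  of ::
  carrier : Type
  [finite : Finite carrier]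

attribute [instance] ResPartitionCat.finite

section ResPartitionCat

variable (k : Type u) [CommRing k] (δ : k)

noncomputable instance : Category.{u} (ResPartitionCat k δ) where
  Hom S T := restrictedHom k S.carrier T.carrier
  id _ := ⟨_, ofEquiv_mem_restrictedHom (Equiv.refl _)⟩
  comp f g := ⟨compHom δ _ _ _ f.1 g.1, compHom_mem_restrictedHom δ f.2 g.2⟩
  id_comp f := Subtype.ext ((compHom_ofEquiv_left δ _ f.1).trans (mapDomain_comap_id f.1))
  comp_id f := Subtype.ext ((compHom_ofEquiv_right δ f.1 _).trans (mapDomain_comap_id f.1))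
  assoc f g h := Subtype.ext (compHom_assoc δ f.1 g.1 h.1)

noncomputable instance : Preadditive (ResPartitionCat k δ) where
  homGroup S T := inferInstanceAs (AddCommGroup (restrictedHom k S.carrier T.carrier))
  add_comp _ _ _ f f' g := Subtype.ext (LinearMap.map_add₂ (compHom δ _ _ _) f.1 f'.1 g.1)
  comp_add _ _ _ f g g' := Subtype.ext (map_add (compHom δ _ _ _ f.1) g.1 g'.1)

noncomputable instance : Linear k (ResPartitionCat k δ) where
  homModule S T := inferInstanceAs (Module k (restrictedHom k S.carrier T.carrier))
  smul_comp _ _ _ a f g := Subtype.ext (LinearMap.map_smul₂ (compHom δ _ _ _) a f.1 g.1)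
  comp_smul _ _ _ f a g := Subtype.ext (map_smul (compHom δ _ _ _ f.1) a g.1)

/-- The inclusion of the restricted partition category in the partition category. -/
noncomputable def ResPartitionCat.inclusion : ResPartitionCat k δ ⥤ PartitionCat k δ where
  obj S := .of S.carrier
  map f := f.1
  map_id _ := rfl
  map_comp _ _ := rfl

/-- A restricted diagram as a morphism of the restricted partition category. -/
noncomputable def ResPartitionCat.ofDiagram {S T : ResPartitionCat k δ}
    (ρ : Diagram S.carrier T.carrier) (hρ : ρ.IsRestricted) : S ⟶ T :=
  ⟨Finsupp.single ρ 1, Submodule.subset_span ⟨ρ, hρ, rfl⟩⟩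

/-- The functor from finite sets and bijections to the restricted partition category that sends a
bijection `e` to the diagram with parts `{s, e s}`. -/
noncomputable def FB.toResPartitionCat : FB ⥤ ResPartitionCat k δ where
  obj S := .of S.carrier
  map e := ResPartitionCat.ofDiagram k δ (Diagram.ofEquiv e) (Diagram.isRestricted_ofEquiv e)
  map_id _ := rfl
  map_comp {S T U} e f := by
    refine Subtype.ext ?_
    change _ = compHom δ _ _ _ (Finsupp.single _ 1) (Finsupp.single _ 1)
    rw [compHom_single, Diagram.loops_ofEquiv_left, Diagram.ofEquiv_comp]
    have h : (Diagram.ofEquiv f).comap (Sum.map (Equiv.toFun e) id) =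
        Diagram.ofEquiv (Equiv.trans e f) := by
      ext (x | x) (y | y) <;> rfl
    rw [pow_zero, mul_one, mul_one]
    exact congrArg (fun ρ => Finsupp.single ρ (1 : k)) h.symm

end ResPartitionCat

/-! ## Modules over the category of finite sets and bijections, and their tensor product -/

section Tensor

open TensorProduct
open scoped DirectSum Classical

variable {k : Type u} [CommRing k]

/-- An `FB`-module, or linear species. -/
abbrev FBModule (k : Type u) [CommRing k] := FB ⥤ ModuleCat.{u} k

/-- The linear map induced by a bijection of finite sets. -/
noncomputable def FBModule.act (M : FBModule k) {S T : Type} [Finite S] [Finite T] (e : S ≃ T) :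
    M.obj (.of S) →ₗ[k] M.obj (.of T) :=
  (M.map (X := .of S) (Y := .of T) e).hom

theorem FBModule.act_refl (M : FBModule k) {S : Type} [Finite S] (x : M.obj (.of S)) :
    M.act (Equiv.refl S) x = x :=
  congrArg (fun f => f.hom x) (M.map_id (.of S))

theorem FBModule.act_trans (M : FBModule k) {S T U : Type} [Finite S] [Finite T] [Finite U]
    (e : S ≃ T) (f : T ≃ U) (x : M.obj (.of S)) : M.act (e.trans f) x = M.act f (M.act e x) :=
  congrArg (fun f => f.hom x) (M.map_comp (X := .of S) (Y := .of T) (Z := .of U) e f)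

theorem FBModule.app_act {M N : FBModule k} (φ : M ⟶ N) {S T : Type} [Finite S] [Finite T]
    (e : S ≃ T) (x : M.obj (.of S)) :
    (φ.app (.of T)).hom (M.act e x) = N.act e ((φ.app (.of S)).hom x) :=
  congrArg (fun f => f.hom x) (φ.naturality (X := .of S) (Y := .of T) e)

/-- The value of the tensor product of `M` and `N` on a finite set `S`: the direct sum of
`M(T) ⊗ N(S \ T)` over the subsets `T` of `S`. -/
abbrev tensorAt (M N : FBModule k) (S : Type) [Finite S] : Type u :=
  ⨁ T : Set S, (M.obj (.of ↥T) ⊗[k] N.obj (.of ↥Tᶜ))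

/-- The inclusion of the summand of the subset `T`. -/
noncomputable def tensorIncl (M N : FBModule k) {S : Type} [Finite S] (T : Set S) :
    M.obj (.of ↥T) ⊗[k] N.obj (.of ↥Tᶜ) →ₗ[k] tensorAt M N S :=
  DirectSum.lof k (Set S) (fun T => M.obj (.of ↥T) ⊗[k] N.obj (.of ↥Tᶜ)) T

/-- The bijection from `A` to its image in `S` under a decomposition `S = A ⊔ B`. -/
noncomputable def leftEquiv {A B S : Type} (e : A ⊕ B ≃ S) :
    A ≃ ↥(Set.range (fun a => e (Sum.inl a))) :=
  Equiv.ofInjective _ (e.injective.comp Sum.inl_injective)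

/-- The bijection from `B` to the complement of the image of `A` under a decomposition
`S = A ⊔ B`. -/
noncomputable def rightEquiv {A B S : Type} (e : A ⊕ B ≃ S) :
    B ≃ ↥(Set.range (fun a => e (Sum.inl a)))ᶜ :=
  Equiv.ofBijective (fun b => ⟨e (Sum.inr b), by simp⟩) (by
    constructor
    · intro b b' h
      simpa using h
    · rintro ⟨s, hs⟩
      obtain ⟨a | b, rfl⟩ := e.surjective s
      · exact absurd ⟨a, rfl⟩ hs
      · exact ⟨b, rfl⟩)

/-- The inclusion `M(A) ⊗ N(B) → (M ⊗ N)(S)` for a decomposition `S = A ⊔ B`, given by a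
bijection. -/
noncomputable def tensorIn (M N : FBModule k) {A B S : Type} [Finite A] [Finite B] [Finite S]
    (e : A ⊕ B ≃ S) : M.obj (.of A) ⊗[k] N.obj (.of B) →ₗ[k] tensorAt M N S :=
  tensorIncl M N (Set.range (fun a => e (Sum.inl a))) ∘ₗ
    TensorProduct.map (M.act (leftEquiv e)) (N.act (rightEquiv e))

theorem tensorIn_eq (M N : FBModule k) {A B S : Type} [Finite A] [Finite B] [Finite S]
    (e : A ⊕ B ≃ S) (T : Set S) (f : A ≃ T) (g : B ≃ ↥Tᶜ) (hf : ∀ a, (f a : S) = e (Sum.inl a))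
    (hg : ∀ b, (g b : S) = e (Sum.inr b)) (x : M.obj (.of A)) (y : N.obj (.of B)) :
    tensorIn M N e (x ⊗ₜ y) = tensorIncl M N T (M.act f x ⊗ₜ N.act g y) := by
  have hT : T = Set.range (fun a => e (Sum.inl a)) := by
    ext s
    constructor
    · intro hs
      exact ⟨f.symm ⟨s, hs⟩, by simp [← hf]⟩
    · rintro ⟨a, rfl⟩
      simp [← hf]
  subst hT
  obtain rfl : f = leftEquiv e := by
    ext a; exact hf a
  obtain rfl : g = rightEquiv e := by
    ext b; exact hg b
  rfl

theorem tensorIn_act (M N : FBModule k) {A B A' B' S : Type} [Finite A] [Finite B] [Finite S]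
    [Finite A'] [Finite B'] (e : A' ⊕ B' ≃ S) (f : A ≃ A') (g : B ≃ B')
    (x : M.obj (.of A)) (y : N.obj (.of B)) :
    tensorIn M N e (M.act f x ⊗ₜ N.act g y) =
      tensorIn M N ((Equiv.sumCongr f g).trans e) (x ⊗ₜ y) := by
  rw [tensorIn_eq M N ((Equiv.sumCongr f g).trans e) (Set.range (fun a => e (Sum.inl a)))
    (f.trans (leftEquiv e)) (g.trans (rightEquiv e)) (fun _ => rfl) (fun _ => rfl),
    FBModule.act_trans, FBModule.act_trans]
  rfl

theorem tensorIncl_eq (M N : FBModule k) {S : Type} [Finite S] (T : Set S)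
    (x : M.obj (.of ↥T)) (y : N.obj (.of ↥Tᶜ)) :
    tensorIncl M N T (x ⊗ₜ y) = tensorIn M N (Equiv.Set.sumCompl T) (x ⊗ₜ y) := by
  rw [tensorIn_eq M N (Equiv.Set.sumCompl T) T (Equiv.refl _) (Equiv.refl _) (fun _ => rfl)
    (fun _ => rfl), FBModule.act_refl, FBModule.act_refl]

theorem tensorAt_hom_ext {M N : FBModule k} {S : Type} [Finite S] {P : Type*} [AddCommGroup P]
    [Module k P] {f g : tensorAt M N S →ₗ[k] P}
    (h : ∀ (A B : Type) [Finite A] [Finite B] (e : A ⊕ B ≃ S) (x : M.obj (.of A))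
      (y : N.obj (.of B)), f (tensorIn M N e (x ⊗ₜ y)) = g (tensorIn M N e (x ⊗ₜ y))) :
    f = g := by
  refine DirectSum.linearMap_ext k fun T => TensorProduct.ext' fun x y => ?_
  have := h _ _ (Equiv.Set.sumCompl T) x y
  rw [← tensorIncl_eq] at this
  exact this

/-- The linear map out of `(M ⊗ N)(S)` with given restrictions to the summands. -/
noncomputable def tensorDesc {M N : FBModule k} {S : Type} [Finite S] {P : Type*}
    [AddCommGroup P] [Module k P]
    (φ : ∀ T : Set S, M.obj (.of ↥T) ⊗[k] N.obj (.of ↥Tᶜ) →ₗ[k] P) : tensorAt M N S →ₗ[k] P :=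
  DirectSum.toModule k (Set S) P φ

theorem tensorDesc_tensorIn {M N : FBModule k} {S : Type} [Finite S] {P : Type*}
    [AddCommGroup P] [Module k P]
    (φ : ∀ T : Set S, M.obj (.of ↥T) ⊗[k] N.obj (.of ↥Tᶜ) →ₗ[k] P)
    {A B : Type} [Finite A] [Finite B] (e : A ⊕ B ≃ S) (x : M.obj (.of A)) (y : N.obj (.of B)) :
    tensorDesc φ (tensorIn M N e (x ⊗ₜ y)) =
      φ _ (M.act (leftEquiv e) x ⊗ₜ N.act (rightEquiv e) y) :=
  DirectSum.toModule_lof k _ _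

theorem sumCongr_trans_sumCompl {A B S : Type} (e : A ⊕ B ≃ S) :
    (Equiv.sumCongr (leftEquiv e) (rightEquiv e)).trans (Equiv.Set.sumCompl _) = e := by
  ext (a | b) <;> rfl

/-- The map `(M ⊗ N)(S) → (M ⊗ N)(S')` induced by a bijection `S ≃ S'`: on the summand of `T` it
is the map `M(T) ⊗ N(S \ T) → M(T') ⊗ N(S' \ T')` for the image `T'` of `T`. -/
noncomputable def tensorMap (M N : FBModule k) {S S' : Type} [Finite S] [Finite S'] (h : S ≃ S') :
    tensorAt M N S →ₗ[k] tensorAt M N S' :=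
  tensorDesc fun T => tensorIn M N ((Equiv.Set.sumCompl T).trans h)

theorem tensorMap_tensorIn (M N : FBModule k) {A B S S' : Type} [Finite A] [Finite B] [Finite S]
    [Finite S'] (h : S ≃ S') (e : A ⊕ B ≃ S) (x : M.obj (.of A)) (y : N.obj (.of B)) :
    tensorMap M N h (tensorIn M N e (x ⊗ₜ y)) = tensorIn M N (e.trans h) (x ⊗ₜ y) := by
  rw [tensorMap, tensorDesc_tensorIn, tensorIn_act, ← Equiv.trans_assoc, sumCongr_trans_sumCompl]

/-- The tensor product of `FB`-modules. -/
noncomputable def tensor (M N : FBModule k) : FBModule k where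
  obj S := ModuleCat.of k (tensorAt M N S.carrier)
  map {S S'} h := ModuleCat.ofHom (tensorMap M N h)
  map_id S := by
    ext1
    refine tensorAt_hom_ext fun A B _ _ e x y => ?_
    exact tensorMap_tensorIn M N (Equiv.refl _) e x y
  map_comp {S S' S''} h h' := by
    ext1
    refine tensorAt_hom_ext fun A B _ _ e x y => ?_
    refine (tensorMap_tensorIn M N (h.trans h') e x y).trans ?_
    refine Eq.trans ?_ (congrArg (tensorMap M N h') (tensorMap_tensorIn M N h e x y)).symm
    exact (tensorMap_tensorIn M N h' (e.trans h) x y).symm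

/-- For a decomposition `S = A ⊔ B` given by a bijection, the bilinear map
`M(A) × N(B) → (M ⊗ N)(S)`. -/
noncomputable def tmkL (M N : FBModule k) {A B S : Type} [Finite A] [Finite B] [Finite S]
    (e : A ⊕ B ≃ S) :
    M.obj (.of A) →ₗ[k] N.obj (.of B) →ₗ[k] (tensor M N).obj (.of S) :=
  TensorProduct.curry (tensorIn M N e)

/-- For a decomposition `S = A ⊔ B` given by a bijection, the pure tensor `x ⊗ y` in
`(M ⊗ N)(S)` of `x` in `M(A)` and `y` in `N(B)`. -/
noncomputable def tmk {M N : FBModule k} {A B S : Type} [Finite A] [Finite B] [Finite S]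
    (e : A ⊕ B ≃ S) (x : M.obj (.of A)) (y : N.obj (.of B)) : (tensor M N).obj (.of S) :=
  tmkL M N e x y

theorem tmkL_apply {M N : FBModule k} {A B S : Type} [Finite A] [Finite B] [Finite S]
    (e : A ⊕ B ≃ S) (x : M.obj (.of A)) (y : N.obj (.of B)) : tmkL M N e x y = tmk e x y := rfl

theorem tensor_act {M N : FBModule k} {A B S S' : Type} [Finite A] [Finite B] [Finite S]
    [Finite S'] (h : S ≃ S') (e : A ⊕ B ≃ S) (x : M.obj (.of A)) (y : N.obj (.of B)) :
    (tensor M N).act h (tmk e x y) = tmk (e.trans h) x y :=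
  tensorMap_tensorIn M N h e x y

theorem tmk_act {M N : FBModule k} {A B A' B' S : Type} [Finite A] [Finite B] [Finite S]
    [Finite A'] [Finite B'] (e : A' ⊕ B' ≃ S) (f : A ≃ A') (g : B ≃ B')
    (x : M.obj (.of A)) (y : N.obj (.of B)) :
    (tmk e (M.act f x) (N.act g y) : (tensor M N).obj (.of S)) =
      tmk ((Equiv.sumCongr f g).trans e) x y :=
  tensorIn_act M N e f g x y

theorem tensor_hom_ext {M N : FBModule k} {S : Type} [Finite S] {P : Type*} [AddCommGroup P]
    [Module k P] {f g : (tensor M N).obj (.of S) →ₗ[k] P}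
    (h : ∀ (A B : Type) [Finite A] [Finite B] (e : A ⊕ B ≃ S) (x : M.obj (.of A))
      (y : N.obj (.of B)), f (tmk e x y) = g (tmk e x y)) : f = g :=
  tensorAt_hom_ext h

/-- The linear map out of `(M ⊗ N)(S)` that is given by bilinear maps on the summands. -/
noncomputable def tdesc {M N : FBModule k} {S : Type} [Finite S] {P : Type*} [AddCommGroup P]
    [Module k P] (φ : ∀ T : Set S, M.obj (.of ↥T) →ₗ[k] N.obj (.of ↥Tᶜ) →ₗ[k] P) :
    (tensor M N).obj (.of S) →ₗ[k] P :=
  tensorDesc fun T => TensorProduct.lift (φ T)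

theorem tdesc_tmk {M N : FBModule k} {S : Type} [Finite S] {P : Type*} [AddCommGroup P]
    [Module k P] (φ : ∀ T : Set S, M.obj (.of ↥T) →ₗ[k] N.obj (.of ↥Tᶜ) →ₗ[k] P)
    {A B : Type} [Finite A] [Finite B] (e : A ⊕ B ≃ S) (x : M.obj (.of A)) (y : N.obj (.of B)) :
    tdesc φ (tmk e x y) = φ _ (M.act (leftEquiv e) x) (N.act (rightEquiv e) y) :=
  tensorDesc_tensorIn (fun T => TensorProduct.lift (φ T)) e x y

/-- If the bilinear maps on the summands come from maps for all decompositions that are compatible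
with bijections of the two pieces, then these maps compute the induced linear map. -/
theorem tdesc_tmk_of_compat {M N : FBModule k} {S : Type} [Finite S] {P : Type*} [AddCommGroup P]
    [Module k P] (φ : ∀ (A B : Type) [Finite A] [Finite B], A ⊕ B ≃ S →
      (M.obj (.of A) →ₗ[k] N.obj (.of B) →ₗ[k] P))
    (hφ : ∀ (A B A' B' : Type) [Finite A] [Finite B] [Finite A'] [Finite B'] (e : A' ⊕ B' ≃ S)
      (f : A ≃ A') (g : B ≃ B') (x : M.obj (.of A)) (y : N.obj (.of B)),
      φ A' B' e (M.act f x) (N.act g y) = φ A B ((Equiv.sumCongr f g).trans e) x y)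
    {A B : Type} [Finite A] [Finite B] (e : A ⊕ B ≃ S) (x : M.obj (.of A)) (y : N.obj (.of B)) :
    tdesc (fun T => φ _ _ (Equiv.Set.sumCompl T)) (tmk e x y) = φ A B e x y := by
  rw [tdesc_tmk, hφ, sumCongr_trans_sumCompl]

/-- A morphism out of a tensor product, given by its components. -/
noncomputable def tensorHomMk {M N P : FBModule k}
    (φ : ∀ (S : Type) [Finite S], (tensor M N).obj (.of S) →ₗ[k] P.obj (.of S))
    (hφ : ∀ (S S' : Type) [Finite S] [Finite S'] (h : S ≃ S') (A B : Type) [Finite A] [Finite B]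
      (e : A ⊕ B ≃ S) (x : M.obj (.of A)) (y : N.obj (.of B)),
      φ S' (tmk (e.trans h) x y) = P.act h (φ S (tmk e x y))) :
    tensor M N ⟶ P where
  app S := ModuleCat.ofHom (φ S.carrier)
  naturality S S' h := by
    ext1
    refine tensor_hom_ext fun A B _ _ e x y => ?_
    refine Eq.trans ?_ (hφ S.carrier S'.carrier h A B e x y)
    exact congrArg (φ S'.carrier) (tensor_act h e x y)

/-- The components `M(T) ⊗ N(S \ T) → M'(T) ⊗ N'(S \ T)` of `φ ⊗ ψ`. -/
noncomputable def tensorHomAt {M M' N N' : FBModule k} (φ : M ⟶ M') (ψ : N ⟶ N') (S : Type)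
    [Finite S] : (tensor M N).obj (.of S) →ₗ[k] (tensor M' N').obj (.of S) :=
  tdesc fun T => (tmkL M' N' (Equiv.Set.sumCompl T)).compl₁₂ (φ.app _).hom (ψ.app _).hom

theorem tensorHomAt_tmk {M M' N N' : FBModule k} (φ : M ⟶ M') (ψ : N ⟶ N') {A B S : Type}
    [Finite A] [Finite B] [Finite S] (e : A ⊕ B ≃ S) (x : M.obj (.of A)) (y : N.obj (.of B)) :
    tensorHomAt φ ψ S (tmk e x y) = tmk e ((φ.app (.of A)).hom x) ((ψ.app (.of B)).hom y) := by
  refine tdesc_tmk_of_compat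
    (fun A B _ _ e => (tmkL M' N' e).compl₁₂ (φ.app (.of A)).hom (ψ.app (.of B)).hom) ?_ e x y
  intro A B A' B' _ _ _ _ e f g x y
  simp only [LinearMap.compl₁₂_apply, FBModule.app_act, tmkL_apply, tmk_act]

/-- The tensor product of two morphisms of `FB`-modules. -/
noncomputable def tensorHom {M M' N N' : FBModule k} (φ : M ⟶ M') (ψ : N ⟶ N') :
    tensor M N ⟶ tensor M' N' :=
  tensorHomMk (fun S _ => tensorHomAt φ ψ S) fun _ _ _ _ h _ _ _ _ e x y => by
    simp only [tensorHomAt_tmk, tensor_act]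

/-- The components `M(T) ⊗ N(S \ T) → N(S \ T) ⊗ M(T)` of the symmetry. -/
noncomputable def braidAt (M N : FBModule k) (S : Type) [Finite S] :
    (tensor M N).obj (.of S) →ₗ[k] (tensor N M).obj (.of S) :=
  tdesc fun T => (tmkL N M ((Equiv.sumComm _ _).trans (Equiv.Set.sumCompl T))).flip

theorem braidAt_tmk {M N : FBModule k} {A B S : Type} [Finite A] [Finite B] [Finite S]
    (e : A ⊕ B ≃ S) (x : M.obj (.of A)) (y : N.obj (.of B)) :
    braidAt M N S (tmk e x y) = tmk ((Equiv.sumComm _ _).trans e) y x := by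
  refine tdesc_tmk_of_compat
    (fun A B _ _ e => (tmkL N M ((Equiv.sumComm _ _).trans e)).flip) ?_ e x y
  intro A B A' B' _ _ _ _ e f g x y
  simp only [LinearMap.flip_apply, tmkL_apply, tmk_act]
  congr 1
  ext (a | b) <;> rfl

/-- The symmetry `M ⊗ N → N ⊗ M` of the tensor product. -/
noncomputable def braid (M N : FBModule k) : tensor M N ⟶ tensor N M :=
  tensorHomMk (fun S _ => braidAt M N S) fun _ _ _ _ h _ _ _ _ e x y => by
    simp only [braidAt_tmk, tensor_act, Equiv.trans_assoc]

/-- The decomposition `S = A ⊔ (B ⊔ C)` obtained from `S = X ⊔ C` and `X = A ⊔ B`. -/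
def splitRight {A B C X S : Type} (e : X ⊕ C ≃ S) (e' : A ⊕ B ≃ X) : A ⊕ (B ⊕ C) ≃ S :=
  ((Equiv.sumAssoc A B C).symm.trans (Equiv.sumCongr e' (Equiv.refl C))).trans e

/-- The decomposition `S = (A ⊔ B) ⊔ C` obtained from `S = A ⊔ X` and `X = B ⊔ C`. -/
def splitLeft {A B C X S : Type} (e : A ⊕ X ≃ S) (e' : B ⊕ C ≃ X) : (A ⊕ B) ⊕ C ≃ S :=
  ((Equiv.sumAssoc A B C).trans (Equiv.sumCongr (Equiv.refl A) e')).trans e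

/-- The trilinear map `(x, y, z) ↦ x ⊗ (y ⊗ z)`, for `S = X ⊔ C` and `X = A ⊔ B`. -/
noncomputable def tripleRight (L M N : FBModule k) {A B C X S : Type} [Finite A] [Finite B]
    [Finite C] [Finite S] (e : X ⊕ C ≃ S) (e' : A ⊕ B ≃ X) :
    L.obj (.of A) →ₗ[k] M.obj (.of B) →ₗ[k] N.obj (.of C) →ₗ[k]
      (tensor L (tensor M N)).obj (.of S) where
  toFun x := (tmkL M N (Equiv.refl (B ⊕ C))).compr₂ (tmkL L (tensor M N) (splitRight e e') x)
  map_add' x x' := by ext y z; simp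
  map_smul' a x := by ext y z; simp

/-- The trilinear map `(y, z, x) ↦ (x ⊗ y) ⊗ z`, for `S = A ⊔ X` and `X = B ⊔ C`. -/
noncomputable def tripleLeft (L M N : FBModule k) {A B C X S : Type} [Finite A] [Finite B]
    [Finite C] [Finite S] (e : A ⊕ X ≃ S) (e' : B ⊕ C ≃ X) :
    M.obj (.of B) →ₗ[k] N.obj (.of C) →ₗ[k] L.obj (.of A) →ₗ[k]
      (tensor (tensor L M) N).obj (.of S) where
  toFun y := ((tmkL (tensor L M) N (splitLeft e e')) ∘ₗ
    (tmkL L M (Equiv.refl (A ⊕ B))).flip y).flip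
  map_add' x x' := by ext y z; simp
  map_smul' a x := by ext y z; simp

/-- The components `(L(U) ⊗ M(T \ U)) ⊗ N(S \ T) → L(U) ⊗ (M(T \ U) ⊗ N(S \ T))` of the
associator. -/
noncomputable def assocAt (L M N : FBModule k) (S : Type) [Finite S] :
    (tensor (tensor L M) N).obj (.of S) →ₗ[k] (tensor L (tensor M N)).obj (.of S) :=
  tdesc fun T => tdesc fun U =>
    tripleRight L M N (Equiv.Set.sumCompl T) (Equiv.Set.sumCompl U)

theorem assocAt_tmk {L M N : FBModule k} {A B C X S : Type} [Finite A] [Finite B] [Finite C]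
    [Finite X] [Finite S] (e : X ⊕ C ≃ S) (e' : A ⊕ B ≃ X)
    (x : L.obj (.of A)) (y : M.obj (.of B)) (z : N.obj (.of C)) :
    assocAt L M N S (tmk e (tmk e' x y) z) =
      tmk (splitRight e e') x (tmk (Equiv.refl (B ⊕ C)) y z) := by
  have key : ∀ {A B C A' B' C' X' : Type} [Finite A] [Finite B] [Finite C]
      [Finite A'] [Finite B'] [Finite C']
      (e : X' ⊕ C' ≃ S) (e' : A' ⊕ B' ≃ X') (f : A ≃ A') (g : B ≃ B') (h : C ≃ C')
      (x : L.obj (.of A)) (y : M.obj (.of B)) (z : N.obj (.of C)),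
      tripleRight L M N e e' (L.act f x) (M.act g y) (N.act h z) =
        tmk ((Equiv.sumCongr f (Equiv.sumCongr g h)).trans (splitRight e e')) x
          (tmk (Equiv.refl (B ⊕ C)) y z) := by
    intro A B C A' B' C' X' _ _ _ _ _ _ e e' f g h x y z
    rw [← tmk_act, tensor_act]
    exact congrArg (fun w => tmk (M := L) (N := tensor M N) (splitRight e e') (L.act f x) w)
      (tmk_act (Equiv.refl (B' ⊕ C')) g h y z)
  rw [assocAt, tdesc_tmk, tensor_act, tdesc_tmk, key]
  congr 1
  ext (a | b | c) <;> rfl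

/-- The components `L(T) ⊗ (M(U) ⊗ N((S \ T) \ U)) → (L(T) ⊗ M(U)) ⊗ N((S \ T) \ U)` of the
inverse associator. -/
noncomputable def assocInvAt (L M N : FBModule k) (S : Type) [Finite S] :
    (tensor L (tensor M N)).obj (.of S) →ₗ[k] (tensor (tensor L M) N).obj (.of S) :=
  tdesc fun T => LinearMap.flip (tdesc fun U =>
    tripleLeft L M N (Equiv.Set.sumCompl T) (Equiv.Set.sumCompl U))

theorem assocInvAt_tmk {L M N : FBModule k} {A B C X S : Type} [Finite A] [Finite B] [Finite C]
    [Finite X] [Finite S] (e : A ⊕ X ≃ S) (e' : B ⊕ C ≃ X)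
    (x : L.obj (.of A)) (y : M.obj (.of B)) (z : N.obj (.of C)) :
    assocInvAt L M N S (tmk e x (tmk e' y z)) =
      tmk (splitLeft e e') (tmk (Equiv.refl (A ⊕ B)) x y) z := by
  have key : ∀ {A B C A' B' C' X' : Type} [Finite A] [Finite B] [Finite C]
      [Finite A'] [Finite B'] [Finite C']
      (e : A' ⊕ X' ≃ S) (e' : B' ⊕ C' ≃ X') (f : A ≃ A') (g : B ≃ B') (h : C ≃ C')
      (x : L.obj (.of A)) (y : M.obj (.of B)) (z : N.obj (.of C)),
      tripleLeft L M N e e' (M.act g y) (N.act h z) (L.act f x) =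
        tmk ((Equiv.sumCongr (Equiv.sumCongr f g) h).trans (splitLeft e e'))
          (tmk (Equiv.refl (A ⊕ B)) x y) z := by
    intro A B C A' B' C' X' _ _ _ _ _ _ e e' f g h x y z
    rw [← tmk_act, tensor_act]
    exact congrArg (fun w => tmk (M := tensor L M) (N := N) (splitLeft e e') w (N.act h z))
      (tmk_act (Equiv.refl (A' ⊕ B')) f g x y)
  rw [assocInvAt, tdesc_tmk, tensor_act, LinearMap.flip_apply, tdesc_tmk, key]
  congr 1
  ext ((a | b) | c) <;> rfl

theorem tensor_hom_ext_left {L M N : FBModule k} {S : Type} [Finite S] {P : Type*}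
    [AddCommGroup P] [Module k P] {f g : (tensor (tensor L M) N).obj (.of S) →ₗ[k] P}
    (h : ∀ (A B C X : Type) [Finite A] [Finite B] [Finite C] [Finite X] (e : X ⊕ C ≃ S)
      (e' : A ⊕ B ≃ X) (x : L.obj (.of A)) (y : M.obj (.of B)) (z : N.obj (.of C)),
      f (tmk e (tmk e' x y) z) = g (tmk e (tmk e' x y) z)) : f = g := by
  refine tensor_hom_ext fun X C _ _ e w z => ?_
  have h2 : f ∘ₗ (tmkL (tensor L M) N e).flip z = g ∘ₗ (tmkL (tensor L M) N e).flip z :=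
    tensor_hom_ext fun A B _ _ e' x y => h A B C X e e' x y z
  exact LinearMap.congr_fun h2 w

theorem tensor_hom_ext_right {L M N : FBModule k} {S : Type} [Finite S] {P : Type*}
    [AddCommGroup P] [Module k P] {f g : (tensor L (tensor M N)).obj (.of S) →ₗ[k] P}
    (h : ∀ (A B C X : Type) [Finite A] [Finite B] [Finite C] [Finite X] (e : A ⊕ X ≃ S)
      (e' : B ⊕ C ≃ X) (x : L.obj (.of A)) (y : M.obj (.of B)) (z : N.obj (.of C)),
      f (tmk e x (tmk e' y z)) = g (tmk e x (tmk e' y z))) : f = g := by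
  refine tensor_hom_ext fun A X _ _ e x w => ?_
  have h2 : f ∘ₗ tmkL L (tensor M N) e x = g ∘ₗ tmkL L (tensor M N) e x :=
    tensor_hom_ext fun B C _ _ e' y z => h A B C X e e' x y z
  exact LinearMap.congr_fun h2 w

/-- The associator `(L ⊗ M) ⊗ N → L ⊗ (M ⊗ N)` of the tensor product. -/
noncomputable def assocHom (L M N : FBModule k) :
    tensor (tensor L M) N ⟶ tensor L (tensor M N) where
  app S := ModuleCat.ofHom (assocAt L M N S.carrier)
  naturality S S' h := by
    ext1
    refine tensor_hom_ext_left fun A B C X _ _ _ _ e e' x y z => ?_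
    have h1 := congrArg (assocAt L M N S'.carrier) (tensor_act h e (tmk e' x y) z)
    have h2 := congrArg ((tensor L (tensor M N)).act h) (assocAt_tmk e e' x y z)
    rw [assocAt_tmk] at h1
    rw [tensor_act] at h2
    exact h1.trans h2.symm

/-- The inverse associator `L ⊗ (M ⊗ N) → (L ⊗ M) ⊗ N` of the tensor product. -/
noncomputable def assocInv (L M N : FBModule k) :
    tensor L (tensor M N) ⟶ tensor (tensor L M) N where
  app S := ModuleCat.ofHom (assocInvAt L M N S.carrier)
  naturality S S' h := by
    ext1
    refine tensor_hom_ext_right fun A B C X _ _ _ _ e e' x y z => ?_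
    have h1 := congrArg (assocInvAt L M N S'.carrier) (tensor_act h e x (tmk e' y z))
    have h2 := congrArg ((tensor (tensor L M) N).act h) (assocInvAt_tmk e e' x y z)
    rw [assocInvAt_tmk] at h1
    rw [tensor_act] at h2
    exact h1.trans h2.symm

/-- The switch `A ⊗ (B ⊗ M) → B ⊗ (A ⊗ M)` of the first two factors. -/
noncomputable def switch (A B M : FBModule k) : tensor A (tensor B M) ⟶ tensor B (tensor A M) :=
  assocInv A B M ≫ tensorHom (braid A B) (𝟙 M) ≫ assocHom B A M

end Tensor

/-! ## The curried Witt algebra -/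

section Witt

open scoped Classical

variable (k : Type u) [CommRing k]

attribute [local instance] Fintype.ofFinite

/-- The standard `FB`-module `V`: it is `k` on sets of cardinality `1`, and `0` on all other
sets. Its value on `S` consists of the functions to `k` on the proofs that `S` has one element. -/
noncomputable def V : FBModule k where
  obj S := ModuleCat.of k (PLift (Nat.card S.carrier = 1) → k)
  map {S T} e := ModuleCat.ofHom
    (LinearMap.funLeft k k fun h => ⟨(Nat.card_congr (Equiv.symm e)).symm.trans h.down⟩)

/-- The symmetric algebra of `V`: it is free of rank one with basis `t ^ S = 1` on each finite set
`S` (the summand `Sym ^ n` lives on the sets of cardinality `n`), and bijections preserve the basis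
vectors. -/
noncomputable def SymV : FBModule k := (Functor.const FB).obj (ModuleCat.of k k)

/-- The basis vector `t ^ S` of `Sym(V)(S)`. -/
noncomputable def SymV.basis (S : Type) [Finite S] : (SymV k).obj (.of S) := (1 : k)

/-- The vector `t ^ S` of `V(S)`: the basis vector if `S` has one element, and `0` otherwise. -/
noncomputable def V.basis (S : Type) [Finite S] : (V k).obj (.of S) :=
  (fun _ => 1 : PLift (Nat.card S = 1) → k)

theorem V.act_basis {S T : Type} [Finite S] [Finite T] (e : S ≃ T) :
    (V k).act e (V.basis k S) = V.basis k T := rfl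

theorem SymV.act {S T : Type} [Finite S] [Finite T] (e : S ≃ T) (x : (SymV k).obj (.of S)) :
    (SymV k).act e x = x := rfl

/-- The inclusion of `V = Sym ^ 1(V)` in `Sym(V)`. -/
noncomputable def inclV : V k ⟶ SymV k where
  app S := ModuleCat.ofHom
    (if h : Nat.card S.carrier = 1 then
      (LinearMap.proj ⟨h⟩ : (PLift (Nat.card S.carrier = 1) → k) →ₗ[k] k) else 0)
  naturality S T e := by
    have hST : Nat.card S.carrier = Nat.card T.carrier := Nat.card_congr e
    ext1
    by_cases h : Nat.card S.carrier = 1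
    · have h' : Nat.card T.carrier = 1 := hST ▸ h
      simp only [dif_pos h, dif_pos h']
      rfl
    · have h' : ¬ Nat.card T.carrier = 1 := hST ▸ h
      simp only [dif_neg h, dif_neg h']
      rfl

/-- The bilinear map `t ^ A, t ^ B ↦ t ^ S`. -/
noncomputable def mulBilin (A B S : Type) [Finite A] [Finite B] [Finite S] :
    (SymV k).obj (.of A) →ₗ[k] (SymV k).obj (.of B) →ₗ[k] (SymV k).obj (.of S) :=
  LinearMap.mul k k

/-- The components `Sym(V)(T) ⊗ Sym(V)(S \ T) → Sym(V)(S)` of the multiplication. -/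
noncomputable def mulAt (S : Type) [Finite S] :
    (tensor (SymV k) (SymV k)).obj (.of S) →ₗ[k] (SymV k).obj (.of S) :=
  tdesc fun T => mulBilin k ↥T ↥Tᶜ S

theorem mulAt_tmk {A B S : Type} [Finite A] [Finite B] [Finite S] (e : A ⊕ B ≃ S)
    (x : (SymV k).obj (.of A)) (y : (SymV k).obj (.of B)) :
    mulAt k S (tmk e x y) = mulBilin k A B S x y := by
  rw [mulAt, tdesc_tmk]
  rfl

/-- The multiplication `Sym(V) ⊗ Sym(V) → Sym(V)`, `t ^ A ⊗ t ^ B ↦ t ^ (A ⊔ B)`. -/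
noncomputable def mulV : tensor (SymV k) (SymV k) ⟶ SymV k :=
  tensorHomMk (fun S _ => mulAt k S) fun _ _ _ _ h _ _ _ _ e x y => by
    rw [mulAt_tmk, mulAt_tmk]
    rfl

variable {k}

/-- The linear map `x ↦ t ^ i ⊗ x` from `M(S \ {i})` to `(V ⊗ M)(S)`. -/
noncomputable def vtens (M : FBModule k) {S : Type} [Finite S] (i : S) :
    M.obj (.of ↥({i}ᶜ : Set S)) →ₗ[k] (tensor (V k) M).obj (.of S) :=
  tmkL (V k) M (Equiv.Set.sumCompl {i}) (V.basis k _)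

/-- The bijection `S \ B → S' \ B'` induced by a bijection `S → S'` that carries `B` to `B'`. -/
def restrictCompl {S S' : Type} (h : S ≃ S') (B : Set S) (B' : Set S')
    (hB : ∀ s, s ∈ B ↔ h s ∈ B') : ↥Bᶜ ≃ ↥B'ᶜ :=
  h.subtypeEquiv fun s => not_congr (hB s)

theorem vtens_act (M : FBModule k) {S S' : Type} [Finite S] [Finite S'] (h : S ≃ S') (i : S)
    (x : M.obj (.of ↥({i}ᶜ : Set S))) :
    (tensor (V k) M).act h (vtens M i x) =
      vtens M (h i) (M.act (restrictCompl h {i} {h i} (by simp)) x) := by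
  let g : ↥({i} : Set S) ≃ ↥({h i} : Set S') := h.subtypeEquiv (by simp)
  rw [vtens, vtens, tmkL_apply, tmkL_apply, tensor_act, ← V.act_basis k g, tmk_act]
  congr 1
  ext (a | a) <;> rfl

variable (k) in
/-- The element `∑ i, t ^ i ⊗ t ^ (S \ {i})` of `(V ⊗ Sym(V))(S)`. -/
noncomputable def comulAt (S : Type) [Finite S] : (tensor (V k) (SymV k)).obj (.of S) :=
  ∑ i : S, vtens (SymV k) i (SymV.basis k _)

theorem comulAt_act {S S' : Type} [Finite S] [Finite S'] (h : S ≃ S') :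
    (tensor (V k) (SymV k)).act h (comulAt k S) = comulAt k S' := by
  rw [comulAt, comulAt, map_sum]
  refine Fintype.sum_equiv h _ _ fun i => ?_
  rw [vtens_act]
  rfl

variable (k) in
/-- The comultiplication `Sym(V) → V ⊗ Sym(V)`, `t ^ S ↦ ∑ i, t ^ i ⊗ t ^ (S \ {i})`. -/
noncomputable def comulV : SymV k ⟶ tensor (V k) (SymV k) where
  app S := ModuleCat.ofHom (LinearMap.toSpanSingleton k _ (comulAt k S.carrier))
  naturality S S' h := by
    ext1
    refine LinearMap.ext_ring ?_
    refine (one_smul k (comulAt k S'.carrier)).trans ?_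
    refine (comulAt_act h).symm.trans ?_
    exact congrArg ((tensor (V k) (SymV k)).act h) (one_smul k (comulAt k S.carrier)).symm

/-- The composite `a₁ a₂`, where `a₁` and `a₂` are the actions of `a` on the first and on the second
symmetric algebra. -/
noncomputable def firstSecond {M : FBModule k} (a : tensor (SymV k) M ⟶ tensor (V k) M) :
    tensor (SymV k) (tensor (SymV k) M) ⟶ tensor (V k) (tensor (V k) M) :=
  tensorHom (𝟙 (SymV k)) a ≫ switch (SymV k) (V k) M ≫ tensorHom (𝟙 (V k)) a ≫ switch (V k) (V k) M

/-- The composite `a₂ a₁`. -/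
noncomputable def secondFirst {M : FBModule k} (a : tensor (SymV k) M ⟶ tensor (V k) M) :
    tensor (SymV k) (tensor (SymV k) M) ⟶ tensor (V k) (tensor (V k) M) :=
  switch (SymV k) (SymV k) M ≫ tensorHom (𝟙 (SymV k)) a ≫ switch (SymV k) (V k) M ≫
    tensorHom (𝟙 (V k)) a

/-- The map `a'`: comultiply the second symmetric algebra, move the new factor `V` to the front,
multiply the two symmetric algebras, and apply `a`. -/
noncomputable def wittPrime {M : FBModule k} (a : tensor (SymV k) M ⟶ tensor (V k) M) :
    tensor (SymV k) (tensor (SymV k) M) ⟶ tensor (V k) (tensor (V k) M) :=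
  tensorHom (𝟙 (SymV k)) (tensorHom (comulV k) (𝟙 M) ≫ assocHom (V k) (SymV k) M) ≫
    switch (SymV k) (V k) (tensor (SymV k) M) ≫
    tensorHom (𝟙 (V k)) (assocInv (SymV k) (SymV k) M ≫ tensorHom (mulV k) (𝟙 M)) ≫
    tensorHom (𝟙 (V k)) a

/-- The map `a'' = τ a' τ`. -/
noncomputable def wittDoublePrime {M : FBModule k} (a : tensor (SymV k) M ⟶ tensor (V k) M) :
    tensor (SymV k) (tensor (SymV k) M) ⟶ tensor (V k) (tensor (V k) M) :=
  switch (SymV k) (SymV k) M ≫ wittPrime a ≫ switch (V k) (V k) M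

variable (k) in
/-- An `FB`-module `M` together with a map `Sym(V) ⊗ M → V ⊗ M`. -/
structure WittData where
  obj : FBModule k
  map : tensor (SymV k) obj ⟶ tensor (V k) obj

/-- The morphisms `φ : M → N` of `FB`-modules with `(id ⊗ φ) a = a (id ⊗ φ)`. -/
@[ext]
structure WittData.Hom (X Y : WittData k) where
  hom : X.obj ⟶ Y.obj
  comm : X.map ≫ tensorHom (𝟙 (V k)) hom = tensorHom (𝟙 (SymV k)) hom ≫ Y.map

theorem tensorHom_id (M N : FBModule k) : tensorHom (𝟙 M) (𝟙 N) = 𝟙 (tensor M N) := by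
  ext S : 2
  ext1
  refine tensor_hom_ext (S := S.carrier) fun A B _ _ e x y => ?_
  exact tensorHomAt_tmk (𝟙 M) (𝟙 N) e x y

theorem tensorHom_comp {M M' M'' N N' N'' : FBModule k} (φ : M ⟶ M') (φ' : M' ⟶ M'')
    (ψ : N ⟶ N') (ψ' : N' ⟶ N'') :
    tensorHom (φ ≫ φ') (ψ ≫ ψ') = tensorHom φ ψ ≫ tensorHom φ' ψ' := by
  ext S : 2
  ext1
  refine tensor_hom_ext (S := S.carrier) fun A B _ _ e x y => ?_
  have h1 := tensorHomAt_tmk (φ ≫ φ') (ψ ≫ ψ') e x y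
  have h2 := congrArg (tensorHomAt φ' ψ' S.carrier) (tensorHomAt_tmk φ ψ e x y)
  exact h1.trans (h2.trans (tensorHomAt_tmk φ' ψ' e _ _)).symm

noncomputable instance : Category (WittData k) where
  Hom := WittData.Hom
  id X := ⟨𝟙 X.obj, by rw [tensorHom_id, tensorHom_id, Category.comp_id, Category.id_comp]⟩
  comp {X Y Z} f g := ⟨f.hom ≫ g.hom, by
    rw [← Category.comp_id (𝟙 (V k)), tensorHom_comp, ← Category.assoc, f.comm, Category.assoc,
      g.comm, ← Category.assoc, ← tensorHom_comp, Category.comp_id]⟩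
  id_comp f := WittData.Hom.ext (Category.id_comp _)
  comp_id f := WittData.Hom.ext (Category.comp_id _)
  assoc f g h := WittData.Hom.ext (Category.assoc _ _ _)

variable (k) in
/-- The map `a` defines a representation of the curried Witt algebra: `[a₁, a₂] = a' - a''`. -/
def IsWittRep : ObjectProperty (WittData k) := fun X =>
  firstSecond X.map - secondFirst X.map = wittPrime X.map - wittDoublePrime X.map

variable (k) in
/-- The category of representations of the curried Witt algebra of `V`. -/
abbrev WittRep := (IsWittRep k).FullSubcategory

/-- The restriction `V ⊗ M → V ⊗ M` of `a` to `V = Sym ^ 1(V)`. -/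
noncomputable def WittData.glMap (X : WittData k) : tensor (V k) X.obj ⟶ tensor (V k) X.obj :=
  tensorHom (inclV k) (𝟙 X.obj) ≫ X.map

/-- The bijection `S \ {j} → S \ {i}` that sends `i` to `j` and fixes all other elements. -/
noncomputable def iota {S : Type} (i j : S) : ↥({j}ᶜ : Set S) ≃ ↥({i}ᶜ : Set S) :=
  restrictCompl (Equiv.swap i j) {j} {i} fun s => by
    simp only [Set.mem_singleton_iff, Equiv.swap_apply_eq_iff, Equiv.swap_apply_left]

/-- The map `b : V ⊗ M → V ⊗ M` is the `δ`-standard action of the curried general linear Lie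
algebra: `b (t ^ j ⊗ x) = δ t ^ j ⊗ x + ∑ i ≠ j, t ^ i ⊗ ι(x)` for `x` in `M(S \ {j})`. -/
def IsStandardGL (δ : k) {M : FBModule k} (b : tensor (V k) M ⟶ tensor (V k) M) : Prop :=
  ∀ (S : FB) (j : S.carrier) (x : M.obj (.of ↥({j}ᶜ : Set S.carrier))),
    (b.app S).hom (vtens M j x) = δ • vtens M j x +
      ∑ i ∈ Finset.univ.erase j, vtens M i (M.act (iota i j) x)

/-- A representation of the curried Witt algebra is `δ`-standard if its restriction to the curried
general linear Lie algebra is `δ`-standard. -/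
def IsStandard (δ : k) : ObjectProperty (WittRep k) := fun X => IsStandardGL δ X.obj.glMap

/-- The category of `δ`-standard representations of the curried Witt algebra of `V`. -/
abbrev StandardWittRep (δ : k) := (IsStandard δ).FullSubcategory

/-! ## Modules over the restricted partition category -/

variable (k) in
/-- The category of modules over the restricted partition category: `k`-linear functors to
`k`-modules and natural transformations. -/
abbrev ResPartitionModule (δ : k) :=
  ObjectProperty.FullSubcategory
    (fun F : ResPartitionCat k δ ⥤ ModuleCat.{u} k => F.Additive ∧ F.Linear k)

/-- The diagram from `S \ B` to `S \ {i}` that consists of the identity outside of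
`B ∪ {i}` and of the single part formed by the remaining vertices. If `i` is not in `B`, this part
is `{i} ∪ B` with `i` in the source and `B` in the target. If `i` is in `B`, this part is `B \ {i}`,
in the target; there is no such part if `B = {i}`. -/
noncomputable def hook {S : Type} (i : S) (B : Set S) :
    Diagram ↥Bᶜ ↥({i}ᶜ : Set S) :=
  Setoid.ker (Sum.elim (fun s => (s : S)) fun t => if (t : S) ∈ B then i else (t : S))

theorem hook_isRestricted {S : Type} (i : S) (B : Set S) : (hook i B).IsRestricted :=
  fun _ _ h => Subtype.ext h

variable {δ : k}

/-- The underlying `FB`-module. -/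
noncomputable abbrev resFB (F : ResPartitionCat k δ ⥤ ModuleCat.{u} k) : FBModule k :=
  FB.toResPartitionCat k δ ⋙ F

/-- The operation `M(S \ B) → M(S \ {i})` on a module over the restricted partition category: it is
induced by the diagram above, where an empty part counts as a factor `δ`. -/
noncomputable def hookMap (F : ResPartitionCat k δ ⥤ ModuleCat.{u} k) {S : Type} [Finite S] (i : S)
    (B : Set S) : (resFB F).obj (.of ↥Bᶜ) →ₗ[k] (resFB F).obj (.of ↥({i}ᶜ : Set S)) :=
  (if B = {i} then δ else 1) •
    (F.map (X := .of ↥Bᶜ) (Y := .of ↥({i}ᶜ : Set S))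
      (ResPartitionCat.ofDiagram k δ (hook i B) (hook_isRestricted i B))).hom

theorem hook_natural {S S' : Type} (h : S ≃ S') (i : S) (B : Set S) (B' : Set S')
    (hB : ∀ s, s ∈ B ↔ h s ∈ B') :
    (Diagram.ofEquiv (restrictCompl h B B' hB)).comp (hook (h i) B') =
      (hook i B).comp (Diagram.ofEquiv (restrictCompl h {i} {h i} (by simp))) := by
  rw [Diagram.ofEquiv_comp, Diagram.comp_ofEquiv]
  let F : ↥Bᶜ ⊕ ↥({h i}ᶜ : Set S') → S' :=
    Sum.elim (fun s => h s) fun t => if (t : S') ∈ B' then h i else (t : S')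
  let G : ↥Bᶜ ⊕ ↥({h i}ᶜ : Set S') → S :=
    Sum.elim (fun s => (s : S)) fun t => if h.symm (t : S') ∈ B then i else h.symm (t : S')
  have hFG : ∀ x, F x = h (G x) := by
    rintro (s | t)
    · rfl
    · change (if _ then _ else _) = h (if _ then _ else _)
      have := hB (h.symm t)
      rw [h.apply_symm_apply] at this
      by_cases ht : (t : S') ∈ B'
      · rw [if_pos ht, if_pos (this.2 ht)]
      · rw [if_neg ht, if_neg (fun h' => ht (this.1 h')), h.apply_symm_apply]
  have hL : (hook (h i) B').comap (Sum.map (restrictCompl h B B' hB) id) = Setoid.ker F := by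
    ext (x | x) (y | y) <;> rfl
  have hR : (hook i B).comap (Sum.map id (restrictCompl h {i} {h i} (by simp)).symm) =
      Setoid.ker G := by
    ext (x | x) (y | y) <;> rfl
  rw [hL, hR]
  ext x y
  rw [Setoid.ker_def, Setoid.ker_def, hFG, hFG, h.injective.eq_iff]

theorem hookMap_natural (F : ResPartitionCat k δ ⥤ ModuleCat.{u} k) {S S' : Type} [Finite S]
    [Finite S'] (h : S ≃ S') (i : S) (B : Set S) (B' : Set S') (hB : ∀ s, s ∈ B ↔ h s ∈ B')
    (x : (resFB F).obj (.of ↥Bᶜ)) :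
    hookMap F (h i) B' ((resFB F).act (restrictCompl h B B' hB) x) =
      (resFB F).act (restrictCompl h {i} {h i} (by simp)) (hookMap F i B x) := by
  have hc : B' = {h i} ↔ B = {i} := by
    constructor
    · rintro rfl; ext s; simp [hB]
    · rintro rfl
      ext s
      obtain ⟨s, rfl⟩ := h.surjective s
      rw [← hB]; simp
  let a : (ResPartitionCat.of ↥Bᶜ : ResPartitionCat k δ) ⟶ .of ↥B'ᶜ :=
    ResPartitionCat.ofDiagram k δ (Diagram.ofEquiv (restrictCompl h B B' hB))
      (Diagram.isRestricted_ofEquiv _)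
  let b : (ResPartitionCat.of ↥B'ᶜ : ResPartitionCat k δ) ⟶ .of ↥({h i}ᶜ : Set S') :=
    ResPartitionCat.ofDiagram k δ (hook (h i) B') (hook_isRestricted _ _)
  let c : (ResPartitionCat.of ↥Bᶜ : ResPartitionCat k δ) ⟶ .of ↥({i}ᶜ : Set S) :=
    ResPartitionCat.ofDiagram k δ (hook i B) (hook_isRestricted _ _)
  let d : (ResPartitionCat.of ↥({i}ᶜ : Set S) : ResPartitionCat k δ) ⟶ .of ↥({h i}ᶜ : Set S') :=
    ResPartitionCat.ofDiagram k δ (Diagram.ofEquiv (restrictCompl h {i} {h i} (by simp)))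
      (Diagram.isRestricted_ofEquiv _)
  have habcd : a ≫ b = c ≫ d := by
    refine Subtype.ext ?_
    refine (compHom_single δ _ _ 1 1).trans (Eq.trans ?_ (compHom_single δ _ _ 1 1).symm)
    rw [hook_natural, Diagram.loops_ofEquiv_left, Diagram.loops_ofEquiv_right]
  have h1 : (F.map b).hom ((F.map a).hom x) = (F.map d).hom ((F.map c).hom x) :=
    (congrArg (fun f => f.hom x) (F.map_comp a b)).symm.trans
      ((congrArg (fun f => (F.map f).hom x) habcd).trans
        (congrArg (fun f => f.hom x) (F.map_comp c d)))
  unfold hookMap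
  simp only [hc]
  refine (congrArg (fun y => (if B = {i} then δ else 1) • y) h1).trans ?_
  exact (map_smul (F.map d).hom _ _).symm

/-- The linear map `x ↦ ∑ i, t ^ i ⊗ φ(x)` from `M(S \ B)` to `(V ⊗ M)(S)`, for the operations
`φ : M(S \ B) → M(S \ {i})` defined above. -/
noncomputable def actionSum (F : ResPartitionCat k δ ⥤ ModuleCat.{u} k) {S : Type} [Finite S]
    (B : Set S) : (resFB F).obj (.of ↥Bᶜ) →ₗ[k] (tensor (V k) (resFB F)).obj (.of S) :=
  ∑ i : S, vtens (resFB F) i ∘ₗ hookMap F i B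

theorem actionSum_natural (F : ResPartitionCat k δ ⥤ ModuleCat.{u} k) {S S' : Type} [Finite S]
    [Finite S'] (h : S ≃ S') (B : Set S) (B' : Set S') (hB : ∀ s, s ∈ B ↔ h s ∈ B')
    (x : (resFB F).obj (.of ↥Bᶜ)) :
    actionSum F B' ((resFB F).act (restrictCompl h B B' hB) x) =
      (tensor (V k) (resFB F)).act h (actionSum F B x) := by
  simp only [actionSum, LinearMap.sum_apply, LinearMap.comp_apply, map_sum]
  refine (Fintype.sum_equiv h _ _ fun i => ?_).symm
  rw [vtens_act]
  exact congrArg (vtens (resFB F) (h i)) (hookMap_natural F h i B B' hB x).symm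

/-- The bilinear map `c t ^ B, x ↦ c • ∑ i, t ^ i ⊗ φ(x)`. -/
noncomputable def actionBilin (F : ResPartitionCat k δ ⥤ ModuleCat.{u} k) {S : Type} [Finite S]
    (B : Set S) : (SymV k).obj (.of ↥B) →ₗ[k] (resFB F).obj (.of ↥Bᶜ) →ₗ[k]
      (tensor (V k) (resFB F)).obj (.of S) :=
  LinearMap.toSpanSingleton k _ (actionSum F B)

/-- The components of the map `Sym(V) ⊗ M → V ⊗ M`, `t ^ B ⊗ x ↦ ∑ i, t ^ i ⊗ φ(x)`. -/
noncomputable def actionAt (F : ResPartitionCat k δ ⥤ ModuleCat.{u} k) (S : Type) [Finite S] :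
    (tensor (SymV k) (resFB F)).obj (.of S) →ₗ[k] (tensor (V k) (resFB F)).obj (.of S) :=
  tdesc fun B => actionBilin F B

/-- The map `Sym(V) ⊗ M → V ⊗ M` of a module `M` over the restricted partition category. -/
noncomputable def action (F : ResPartitionCat k δ ⥤ ModuleCat.{u} k) :
    tensor (SymV k) (resFB F) ⟶ tensor (V k) (resFB F) :=
  tensorHomMk (fun S _ => actionAt F S) fun S S' _ _ h A B _ _ e x y => by
    rw [actionAt, actionAt, tdesc_tmk, tdesc_tmk]
    let T : Set S := Set.range fun a => e (Sum.inl a)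
    let T' : Set S' := Set.range fun a => (e.trans h) (Sum.inl a)
    have hT : ∀ s, s ∈ T ↔ h s ∈ T' := by
      intro s
      simp [T, T']
    have h1 : rightEquiv (e.trans h) = (rightEquiv e).trans (restrictCompl h T T' hT) := by
      ext b; rfl
    have h2 := actionSum_natural F h T T' hT ((resFB F).act (rightEquiv e) y)
    rw [h1, FBModule.act_trans]
    refine (congrArg (fun w => (show k from x) • w) h2).trans ?_
    exact (map_smul ((tensor (V k) (resFB F)).act h) _ _).symm

theorem hookMap_app {F G : ResPartitionCat k δ ⥤ ModuleCat.{u} k} (φ : F ⟶ G) {S : Type} [Finite S]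
    (i : S) (B : Set S) (x : (resFB F).obj (.of ↥Bᶜ)) :
    (φ.app (.of ↥({i}ᶜ : Set S))).hom (hookMap F i B x) =
      hookMap G i B ((φ.app (.of ↥Bᶜ)).hom x) := by
  refine (map_smul (φ.app (.of ↥({i}ᶜ : Set S))).hom _ _).trans ?_
  exact congrArg (fun y => (if B = {i} then δ else 1) • y) (congrArg (fun f => f.hom x)
    (φ.naturality (X := .of ↥Bᶜ) (Y := .of ↥({i}ᶜ : Set S))
      (ResPartitionCat.ofDiagram k δ (hook i B) (hook_isRestricted i B))))

/-- The map of underlying `FB`-modules of a map of modules over the restricted partition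
category. -/
noncomputable abbrev resFBMap {F G : ResPartitionCat k δ ⥤ ModuleCat.{u} k} (φ : F ⟶ G) :
    resFB F ⟶ resFB G :=
  Functor.whiskerLeft (FB.toResPartitionCat k δ) φ

theorem tensorHomAt_actionSum {F G : ResPartitionCat k δ ⥤ ModuleCat.{u} k} (φ : F ⟶ G) {S : Type}
    [Finite S] (B : Set S) (x : (resFB F).obj (.of ↥Bᶜ)) :
    tensorHomAt (𝟙 (V k)) (resFBMap φ) S (actionSum F B x) =
      actionSum G B (((resFBMap φ).app (.of ↥Bᶜ)).hom x) := by
  simp only [actionSum, LinearMap.sum_apply, LinearMap.comp_apply, map_sum]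
  refine Finset.sum_congr rfl fun i _ => ?_
  refine (tensorHomAt_tmk (𝟙 (V k)) (resFBMap φ) _ _ _).trans ?_
  exact congrArg (vtens (resFB G) i) (hookMap_app φ i B x)

theorem action_naturality {F G : ResPartitionCat k δ ⥤ ModuleCat.{u} k} (φ : F ⟶ G) :
    action F ≫ tensorHom (𝟙 (V k)) (resFBMap φ) =
      tensorHom (𝟙 (SymV k)) (resFBMap φ) ≫ action G := by
  ext S : 2
  ext1
  refine tensor_hom_ext (S := S.carrier) fun A B _ _ e x y => ?_
  have hF : ∀ (F : ResPartitionCat k δ ⥤ ModuleCat.{u} k) (y : (resFB F).obj (.of B)),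
      actionAt F S.carrier (tmk e x y) =
        (show k from x) • actionSum F _ ((resFB F).act (rightEquiv e) y) := fun F y =>
    tdesc_tmk _ e x y
  have h1 := congrArg (tensorHomAt (𝟙 (V k)) (resFBMap φ) S.carrier) (hF F y)
  have h2 := congrArg (actionAt G S.carrier) (tensorHomAt_tmk (𝟙 (SymV k)) (resFBMap φ) e x y)
  refine h1.trans (Eq.trans ?_ h2.symm)
  refine (map_smul _ _ _).trans (Eq.trans ?_ (hF G _).symm)
  rw [tensorHomAt_actionSum, FBModule.app_act]

variable (δ) in
/-- The functor that sends a module over the restricted partition category to the underlying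
`FB`-module with the map `Sym(V) ⊗ M → V ⊗ M` defined above. -/
noncomputable def toWittData : ResPartitionModule k δ ⥤ WittData k where
  obj F := ⟨resFB F.obj, action F.obj⟩
  map φ := ⟨resFBMap φ.hom, action_naturality φ.hom⟩
  map_id _ := rfl
  map_comp _ _ := rfl

end Witt

end CurriedWitt

open CurriedWitt

namespace CurriedWitt

/-! ### Coefficients of vectors in `V ⊗ M` -/

section Coefficients

open scoped Classical

attribute [local instance] Fintype.ofFinite

variable {k : Type u} [CommRing k]

/-! A vector of `(V ⊗ M)(S)` is a family of coefficients, one in `M(S \ i)` for each `i ∈ S`, and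
`Sym(V)` has rank one on every set. Hence a map `a : Sym(V) ⊗ M → V ⊗ M` amounts to the coefficients
of `t^i` in `a(t^B ⊗ x)`, which are maps `M(S \ B) → M(S \ i)` natural in bijections. Make `i` the
base point of `S = Y ⊔ {none}` and put `X = S \ B`. The coefficient then depends only on the
injection `p : X → Option Y` (`coef_eq_coefOp`). Both sides of the theorem become `FB`-modules with
operations `M(X) → M(Y)` indexed by such injections (`HookModule`).

On the Witt side, compare the coefficients of `t^i ⊗ t^j` in `[a₁, a₂] = a' - a''` at `t^A ⊗ t^B ⊗
x`. The term `a₁ a₂` vanishes if `j ∈ A`, the term `a₂ a₁` vanishes if `i ∈ B`, the term `a'`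
vanishes unless `i ∈ B`, and `a''` vanishes unless `j ∈ A`. If `i ∉ B` and `j ∉ A`, the relation
says that two operations commute. If exactly one of `i ∈ B`, `j ∈ A` holds, it says that two
successive operations merge into one. If both hold, `a'` and `a''` cancel. So the relation is
equivalent to the commutation and merging rules of `IsWittOp` (`isWittOp_of_isWittRep`,
`isWittRep_of_isWittOp`). Being `δ`-standard prescribes the operations with `B` a single point
(`IsStandardOp`).

On the partition side, an injection `p` gives a hook: the diagram that joins the source point over
`none`, if there is one, to the points of `Y` outside the image of `p` and is the identity
elsewhere, with a factor `δ` if this part is empty (`hookHom`). To handle composition, a restricted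
diagram is written as a cospan `S → J ← T` whose first leg is injective, where `J` is the set of
parts and every empty part counts as `δ`. Then composition is a pushout, with no separate loop
factor (`cospanHom_comp`). Hooks satisfy the commutation and merging rules (`hookHom_comm`,
`hookHom_merge`), which shows that a module gives a representation.

Conversely, a cospan factors as a bijection followed by one hook for each part (`cospanHom_cons`,
`cospanHom_nil`), so bijections and hooks generate (`hom_induction`). Given operations, a cospan
acts by the corresponding composite. The order of the parts is immaterial by commutation
(`chain_perm`), empty parts give `δ` and parts that join two points give relabellings by the
standard condition, and composing with one more hook either merges it into an existing part or
creates a new one (`total_merge`, `total_new`). This gives functoriality (`homMap_comp`). The two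
constructions are inverse because a functor is determined on generators and `a` is determined by its
coefficients. Neither changes the underlying modules or the components of morphisms, so the result
is an isomorphism and not only an equivalence. -/

theorem FBModule.act_act_symm (M : FBModule k) {S T : Type} [Finite S] [Finite T] (e : S ≃ T)
    (x : M.obj (.of T)) : M.act e (M.act e.symm x) = x := by
  rw [← FBModule.act_trans, Equiv.symm_trans_self, FBModule.act_refl]

theorem tmk_smul_left {M N : FBModule k} {A B S : Type} [Finite A] [Finite B] [Finite S]
    (e : A ⊕ B ≃ S) (c : k) (x : M.obj (.of A)) (y : N.obj (.of B)) :
    tmk e (c • x) y = c • tmk e x y :=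
  LinearMap.map_smul₂ (tmkL M N e) c x y

theorem tmk_zero_right {M N : FBModule k} {A B S : Type} [Finite A] [Finite B] [Finite S]
    (e : A ⊕ B ≃ S) (x : M.obj (.of A)) : tmk e x (0 : N.obj (.of B)) = 0 :=
  map_zero (tmkL M N e x)

theorem tmk_zero_left {M N : FBModule k} {A B S : Type} [Finite A] [Finite B] [Finite S]
    (e : A ⊕ B ≃ S) (y : N.obj (.of B)) : tmk e (0 : M.obj (.of A)) y = 0 :=
  LinearMap.map_zero₂ (tmkL M N e) y

theorem V.eq_zero {S : Type} [Finite S] (h : Nat.card S ≠ 1) (v : (V k).obj (.of S)) : v = 0 := by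
  funext x
  exact absurd x.down h

theorem V.exists_smul {S : Type} [Finite S] (v : (V k).obj (.of S)) :
    ∃ c : k, v = c • V.basis k S := by
  by_cases h : Nat.card S = 1
  · refine ⟨(show PLift (Nat.card S = 1) → k from v) ⟨h⟩, ?_⟩
    funext x
    exact (mul_one _).symm
  · exact ⟨0, (V.eq_zero h v).trans (zero_smul k _).symm⟩

/-- The vector `t ⊗ x` for a decomposition of `S` into a point and `Y`. -/
noncomputable def vin (M : FBModule k) {Y S : Type} [Finite Y] [Finite S] (e : Unit ⊕ Y ≃ S)
    (x : M.obj (.of Y)) : (tensor (V k) M).obj (.of S) :=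
  tmk e (V.basis k Unit) x

/-- `V` is zero on sets that do not have exactly one element and of rank one on the others, so the
vectors `vin` span `V ⊗ M`. -/
theorem tensorV_hom_ext {M : FBModule k} {S : Type} [Finite S] {P : Type*} [AddCommGroup P]
    [Module k P] {f g : (tensor (V k) M).obj (.of S) →ₗ[k] P}
    (h : ∀ (Y : Type) [Finite Y] (e : Unit ⊕ Y ≃ S) (x : M.obj (.of Y)),
      f (vin M e x) = g (vin M e x)) : f = g := by
  refine tensor_hom_ext fun A B _ _ e v y => ?_
  by_cases hA : Nat.card A = 1
  · obtain ⟨c, rfl⟩ := V.exists_smul v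
    obtain ⟨hs, ⟨a⟩⟩ := Nat.card_eq_one_iff_unique.1 hA
    let ε : Unit ≃ A := ⟨fun _ => a, fun _ => (), fun _ => rfl, fun _ => Subsingleton.elim _ _⟩
    have h1 : tmk e (c • V.basis k A) y = c • vin M ((Equiv.sumCongr ε (Equiv.refl B)).trans e) y := by
      rw [tmk_smul_left, vin, ← tmk_act, FBModule.act_refl, V.act_basis]
    rw [h1, map_smul, map_smul, h]
  · rw [V.eq_zero hA v, tmk_zero_left, map_zero, map_zero]

/-- Passes between decompositions with the fixed type `Unit`, convenient for computations, and those
with the subset `{i}`, which occur in `comulAt` and `IsStandardGL`. -/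
theorem vin_of_vtens (M : FBModule k) {S : Type} [Finite S] (i : S) {Y : Type} [Finite Y]
    (e : Unit ⊕ Y ≃ S) (he : e (Sum.inl ()) = i) (g : Y ≃ ↥({i}ᶜ : Set S))
    (hg : ∀ y, (g y : S) = e (Sum.inr y)) (x : M.obj (.of Y)) :
    vin M e x = vtens M i (M.act g x) := by
  let ε : Unit ≃ ↥({i} : Set S) :=
    ⟨fun _ => ⟨i, rfl⟩, fun _ => (), fun _ => rfl, fun s => Subtype.ext s.2.symm⟩
  rw [vtens, tmkL_apply, ← V.act_basis k ε, tmk_act]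
  unfold vin
  congr 1
  ext (a | y)
  · exact he
  · exact (hg y).symm

/-- The coefficient of `t ^ none` of a vector in `(V ⊗ M)(Y ⊔ {none})`. -/
noncomputable def vproj (M : FBModule k) (Y : Type) [Finite Y] :
    (tensor (V k) M).obj (.of (Option Y)) →ₗ[k] M.obj (.of Y) :=
  tdesc fun T =>
    if h : T = {none} then
      LinearMap.smulRight
        (LinearMap.proj ⟨by rw [h]; simp⟩ : (PLift (Nat.card T = 1) → k) →ₗ[k] k)
        (M.act (Equiv.ofBijective (fun y : Y => (⟨some y, by simp [h]⟩ : ↥Tᶜ)) (by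
          subst h
          constructor
          · intro y y' hy
            simpa using hy
          · rintro ⟨_ | y, hy⟩
            · simp at hy
            · exact ⟨y, rfl⟩)).symm)
    else 0

/-- The base point lies in the factor `M`, so the factor `V` sits on a subset other than `{none}`,
where `vproj` is zero by definition. -/
theorem vproj_eq_zero (M : FBModule k) {A B Y : Type} [Finite A] [Finite B] [Finite Y]
    (e : A ⊕ B ≃ Option Y) (b : B) (hb : e (Sum.inr b) = none) (v : (V k).obj (.of A))
    (x : M.obj (.of B)) : vproj M Y (tmk e v x) = 0 := by
  rw [vproj, tdesc_tmk, dif_neg]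
  · rfl
  · intro h
    have h1 : (none : Option Y) ∈ Set.range fun a => e (Sum.inl a) := by rw [h]; rfl
    obtain ⟨a, ha⟩ := h1
    simpa using e.injective (ha.trans hb.symm)

theorem vproj_tmk (M : FBModule k) {A B Y : Type} [Finite A] [Finite B] [Finite Y]
    (e : A ⊕ B ≃ Option Y) (g : B ≃ Y) (hg : ∀ b, e (Sum.inr b) = some (g b))
    (x : M.obj (.of B)) : vproj M Y (tmk e (V.basis k A) x) = M.act g x := by
  have h : (Set.range fun a => e (Sum.inl a)) = {none} := by
    ext y
    constructor
    · rintro ⟨a, rfl⟩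
      by_contra hne
      obtain ⟨y, hy⟩ := Option.ne_none_iff_exists'.1 hne
      have h2 := hg (g.symm y)
      rw [g.apply_symm_apply, ← hy] at h2
      simpa using e.injective h2
    · rintro rfl
      obtain ⟨a | b, hab⟩ := e.surjective none
      · exact ⟨a, hab⟩
      · rw [hg] at hab; simp at hab
  rw [vproj, tdesc_tmk, dif_pos h]
  refine (one_smul k (M.act (T := Y) _ (M.act (rightEquiv e) x))).trans ?_
  rw [← FBModule.act_trans]
  congr 1
  congr 1
  ext b
  rw [Equiv.trans_apply, Equiv.symm_apply_eq]
  exact Subtype.ext (hg b)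

theorem vproj_vin (M : FBModule k) {B Y : Type} [Finite B] [Finite Y]
    (e : Unit ⊕ B ≃ Option Y) (g : B ≃ Y) (hg : ∀ b, e (Sum.inr b) = some (g b))
    (x : M.obj (.of B)) : vproj M Y (vin M e x) = M.act g x :=
  vproj_tmk M e g hg x

/-- A decomposition into a point and `Y` of a set with base point either has the base point as its
point, or it has the base point in `Y`. -/
theorem decomposition_cases {B Y : Type} (e : Unit ⊕ B ≃ Option Y) :
    (∃ b, e (Sum.inr b) = none) ∨
      (e (Sum.inl ()) = none ∧ ∃ g : B ≃ Y, ∀ b, e (Sum.inr b) = some (g b)) := by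
  by_cases h : ∃ b, e (Sum.inr b) = none
  · exact Or.inl h
  · right
    have h0 : e (Sum.inl ()) = none := by
      obtain ⟨a | b, hab⟩ := e.surjective none
      · exact hab
      · exact absurd ⟨b, hab⟩ h
    have h1 : ∀ b, ∃ y, e (Sum.inr b) = some y := fun b =>
      Option.ne_none_iff_exists'.1 fun hb => h ⟨b, hb⟩
    choose g hg using h1
    refine ⟨h0, Equiv.ofBijective g ⟨?_, ?_⟩, hg⟩
    · intro b b' hb
      have : e (Sum.inr b) = e (Sum.inr b') := by rw [hg, hg, hb]
      simpa using this
    · intro y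
      obtain ⟨a | b, hab⟩ := e.surjective (some y)
      · rw [h0] at hab; simp at hab
      · refine ⟨b, ?_⟩
        rw [hg] at hab
        exact Option.some.inj hab

theorem vproj_act (M : FBModule k) {Y Y' : Type} [Finite Y] [Finite Y'] (h : Y ≃ Y')
    (h' : Option Y ≃ Option Y') (hn : h' none = none) (hs : ∀ y, h' (some y) = some (h y))
    (w : (tensor (V k) M).obj (.of (Option Y))) :
    vproj M Y' ((tensor (V k) M).act h' w) = M.act h (vproj M Y w) := by
  have : vproj M Y' ∘ₗ (tensor (V k) M).act h' = M.act h ∘ₗ vproj M Y := by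
    refine tensorV_hom_ext fun B _ e x => ?_
    rw [LinearMap.comp_apply, LinearMap.comp_apply, vin, tensor_act]
    rcases decomposition_cases e with ⟨b, hb⟩ | ⟨h0, g, hg⟩
    · rw [vproj_eq_zero M e b hb, map_zero]
      exact vproj_eq_zero M _ b (by rw [Equiv.trans_apply, hb, hn]) _ _
    · rw [vproj_tmk M e g hg, ← FBModule.act_trans]
      exact vproj_tmk M _ _ (fun b => by rw [Equiv.trans_apply, hg, hs]; rfl) _
  exact LinearMap.congr_fun this w

theorem vproj_tensorHom {M N : FBModule k} (ψ : M ⟶ N) {Y : Type} [Finite Y]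
    (w : (tensor (V k) M).obj (.of (Option Y))) :
    vproj N Y (((tensorHom (𝟙 (V k)) ψ).app (.of (Option Y))).hom w) =
      (ψ.app (.of Y)).hom (vproj M Y w) := by
  have : vproj N Y ∘ₗ tensorHomAt (𝟙 (V k)) ψ (Option Y) = (ψ.app (.of Y)).hom ∘ₗ vproj M Y := by
    refine tensorV_hom_ext fun B _ e x => ?_
    rw [LinearMap.comp_apply, LinearMap.comp_apply, vin, tensorHomAt_tmk]
    rcases decomposition_cases e with ⟨b, hb⟩ | ⟨h0, g, hg⟩
    · rw [vproj_eq_zero M e b hb, map_zero]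
      exact vproj_eq_zero N _ b hb _ _
    · rw [vproj_tmk M e g hg, FBModule.app_act]
      exact vproj_tmk N _ _ hg _
  exact LinearMap.congr_fun this w

/-- A vector in `(V ⊗ M)(S)` is zero if all its coefficients are zero. -/
theorem tensorV_eq_zero (M : FBModule k) {S : Type} [Finite S]
    (w : (tensor (V k) M).obj (.of S))
    (h : ∀ (Y : Type) [Finite Y] (e : S ≃ Option Y), vproj M Y ((tensor (V k) M).act e w) = 0) :
    w = 0 := by
  let e : ∀ i : S, S ≃ Option ↥({i}ᶜ : Set S) := fun i => (Equiv.optionSubtypeNe i).symm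
  -- Reconstruction of a vector as the sum over `i` of `t^i` tensored with its coefficient at `i`,
  -- where `e i` makes `i` the base point. On a pure tensor only the point of its factor `V`
  -- contributes.
  have key : (∑ i : S, vtens M i ∘ₗ vproj M ↥({i}ᶜ : Set S) ∘ₗ (tensor (V k) M).act (e i)) =
      LinearMap.id := by
    refine tensorV_hom_ext fun B _ e' x => ?_
    rw [LinearMap.sum_apply, Finset.sum_eq_single (e' (Sum.inl ()))]
    · have hne : ∀ b, e' (Sum.inr b) ≠ e' (Sum.inl ()) := by simp
      let g : B ≃ ↥({e' (Sum.inl ())}ᶜ : Set S) := Equiv.ofBijective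
        (fun b => ⟨e' (Sum.inr b), hne b⟩) (by
          constructor
          · intro b b' hb
            simpa using congrArg Subtype.val hb
          · rintro ⟨s, hs⟩
            obtain ⟨⟨⟩ | b, rfl⟩ := e'.surjective s
            · exact absurd rfl hs
            · exact ⟨b, rfl⟩)
      rw [LinearMap.comp_apply, LinearMap.comp_apply, vin, tensor_act, vproj_tmk M _ g,
        ← vin_of_vtens M _ e' rfl g fun _ => rfl]
      · rfl
      · intro b
        exact Equiv.optionSubtypeNe_symm_of_ne (hne b)
    · intro i _ hi
      rw [LinearMap.comp_apply, LinearMap.comp_apply, vin, tensor_act]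
      obtain ⟨⟨⟩ | b, rfl⟩ := e'.surjective i
      · exact absurd rfl hi
      · rw [vproj_eq_zero M _ b, map_zero]
        exact Equiv.optionSubtypeNe_symm_self (e' (Sum.inr b))
    · intro h; exact absurd (Finset.mem_univ _) h
  have h1 := LinearMap.congr_fun key w
  rw [LinearMap.sum_apply] at h1
  refine h1.symm.trans (Finset.sum_eq_zero fun i _ => ?_)
  rw [LinearMap.comp_apply, LinearMap.comp_apply, h, map_zero]

theorem tensorV_ext (M : FBModule k) {S : Type} [Finite S]
    {w w' : (tensor (V k) M).obj (.of S)}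
    (h : ∀ (Y : Type) [Finite Y] (e : S ≃ Option Y),
      vproj M Y ((tensor (V k) M).act e w) = vproj M Y ((tensor (V k) M).act e w')) : w = w' := by
  refine sub_eq_zero.1 (tensorV_eq_zero M _ fun Y _ e => ?_)
  rw [map_sub, map_sub, h, sub_self]

theorem switch_tmk {A B M : FBModule k} {X Y C Z S : Type} [Finite X] [Finite Y] [Finite C]
    [Finite Z] [Finite S] (e : X ⊕ Z ≃ S) (e' : Y ⊕ C ≃ Z) (x : A.obj (.of X))
    (y : B.obj (.of Y)) (z : M.obj (.of C)) :
    ((switch A B M).app (.of S)).hom (tmk e x (tmk e' y z)) =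
      tmk (splitRight (splitLeft e e') (Equiv.sumComm Y X)) y (tmk (Equiv.refl (X ⊕ C)) x z) := by
  have h1 := assocInvAt_tmk (L := A) (M := B) (N := M) e e' x y z
  have h2 := tensorHomAt_tmk (braid A B) (𝟙 M) (splitLeft e e') (tmk (Equiv.refl (X ⊕ Y)) x y) z
  have h3 : ((braid A B).app (.of (X ⊕ Y))).hom (tmk (Equiv.refl (X ⊕ Y)) x y) =
    tmk (Equiv.sumComm Y X) y x := braidAt_tmk (Equiv.refl (X ⊕ Y)) x y
  rw [h3] at h2
  have h4 := assocAt_tmk (L := B) (M := A) (N := M) (splitLeft e e') (Equiv.sumComm Y X) y x z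
  refine Eq.trans ?_ h4
  refine congrArg (assocAt B A M S) ?_
  refine Eq.trans ?_ h2
  exact congrArg (tensorHomAt (braid A B) (𝟙 M) S) h1

/-- The switch does not move points of the ground set: a base point in `A` stays in `A`, which is
part of the second factor after the switch. -/
theorem vproj_switch_eq_zero {A M : FBModule k} {X Z Y : Type} [Finite X] [Finite Z] [Finite Y]
    (e : X ⊕ Z ≃ Option Y) (a : X) (ha : e (Sum.inl a) = none) (x : A.obj (.of X))
    (w : (tensor (V k) M).obj (.of Z)) :
    vproj (tensor A M) Y (((switch A (V k) M).app (.of (Option Y))).hom (tmk e x w)) = 0 := by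
  have : vproj (tensor A M) Y ∘ₗ ((switch A (V k) M).app (.of (Option Y))).hom ∘ₗ
      tmkL A (tensor (V k) M) e x = 0 := by
    refine tensorV_hom_ext fun B _ e' y => ?_
    rw [LinearMap.comp_apply, LinearMap.comp_apply, tmkL_apply, vin, switch_tmk]
    exact vproj_eq_zero _ _ (Sum.inl a) ha _ _
  exact LinearMap.congr_fun this w

/-- The switch carries the factor `V` to the front without changing its point, so the coefficient
can be taken before or after it. The decomposition `e₂` is `e` with the base point removed on both
sides. -/
theorem vproj_switch {A M : FBModule k} {X Z Y : Type} [Finite X] [Finite Z] [Finite Y]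
    (e : X ⊕ Option Z ≃ Option Y) (e₂ : X ⊕ Z ≃ Y) (hn : e (Sum.inr none) = none)
    (hl : ∀ a, e (Sum.inl a) = some (e₂ (Sum.inl a)))
    (hr : ∀ z, e (Sum.inr (some z)) = some (e₂ (Sum.inr z))) (x : A.obj (.of X))
    (w : (tensor (V k) M).obj (.of (Option Z))) :
    vproj (tensor A M) Y (((switch A (V k) M).app (.of (Option Y))).hom (tmk e x w)) =
      tmk e₂ x (vproj M Z w) := by
  have : vproj (tensor A M) Y ∘ₗ ((switch A (V k) M).app (.of (Option Y))).hom ∘ₗ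
      tmkL A (tensor (V k) M) e x = tmkL A M e₂ x ∘ₗ vproj M Z := by
    refine tensorV_hom_ext fun B _ e' y => ?_
    rw [LinearMap.comp_apply, LinearMap.comp_apply, LinearMap.comp_apply, tmkL_apply, tmkL_apply,
      vin, switch_tmk]
    rcases decomposition_cases e' with ⟨b, hb⟩ | ⟨h0, g, hg⟩
    · rw [vproj_eq_zero M e' b hb, tmk_zero_right]
      refine vproj_eq_zero _ _ (Sum.inr b) ?_ _ _
      change e (Sum.inr (e' (Sum.inr b))) = none
      rw [hb, hn]
    · rw [vproj_tmk M e' g hg,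
        vproj_tmk (tensor A M) _ ((Equiv.sumCongr (Equiv.refl X) g).trans e₂), tensor_act]
      · refine (tmk_act e₂ (Equiv.refl X) g x y).symm.trans ?_
        rw [FBModule.act_refl]
      · rintro (a | b)
        · exact hl a
        · change e (Sum.inr (e' (Sum.inr b))) = _
          rw [hg, hr]
          rfl
  exact LinearMap.congr_fun this w

theorem vproj_assoc_eq_zero {L M : FBModule k} {X C Y : Type} [Finite X] [Finite C] [Finite Y]
    (e : X ⊕ C ≃ Option Y) (c : C) (hc : e (Sum.inr c) = none)
    (w : (tensor (V k) L).obj (.of X)) (x : M.obj (.of C)) :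
    vproj (tensor L M) Y (((assocHom (V k) L M).app (.of (Option Y))).hom (tmk e w x)) = 0 := by
  have : vproj (tensor L M) Y ∘ₗ ((assocHom (V k) L M).app (.of (Option Y))).hom ∘ₗ
      (tmkL (tensor (V k) L) M e).flip x = 0 := by
    refine tensorV_hom_ext fun B _ e' y => ?_
    refine (congrArg (vproj (tensor L M) Y)
      (assocAt_tmk (L := V k) (M := L) (N := M) e e' (V.basis k Unit) y x)).trans ?_
    exact vproj_eq_zero _ _ (Sum.inr c) hc _ _
  exact LinearMap.congr_fun this w

theorem vproj_assoc {L M : FBModule k} {X C Y : Type} [Finite X] [Finite C] [Finite Y]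
    (e : Option X ⊕ C ≃ Option Y) (e₂ : X ⊕ C ≃ Y) (hn : e (Sum.inl none) = none)
    (hl : ∀ a, e (Sum.inl (some a)) = some (e₂ (Sum.inl a)))
    (hr : ∀ c, e (Sum.inr c) = some (e₂ (Sum.inr c)))
    (w : (tensor (V k) L).obj (.of (Option X))) (x : M.obj (.of C)) :
    vproj (tensor L M) Y (((assocHom (V k) L M).app (.of (Option Y))).hom (tmk e w x)) =
      tmk e₂ (vproj L X w) x := by
  have : vproj (tensor L M) Y ∘ₗ ((assocHom (V k) L M).app (.of (Option Y))).hom ∘ₗ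
      (tmkL (tensor (V k) L) M e).flip x = (tmkL L M e₂).flip x ∘ₗ vproj L X := by
    refine tensorV_hom_ext fun B _ e' y => ?_
    refine (congrArg (vproj (tensor L M) Y)
      (assocAt_tmk (L := V k) (M := L) (N := M) e e' (V.basis k Unit) y x)).trans ?_
    rw [LinearMap.comp_apply, LinearMap.flip_apply, tmkL_apply]
    rcases decomposition_cases e' with ⟨b, hb⟩ | ⟨h0, g, hg⟩
    · rw [vin, vproj_eq_zero L e' b hb, tmk_zero_left]
      refine vproj_eq_zero _ _ (Sum.inl b) ?_ _ _
      change e (Sum.inl (e' (Sum.inr b))) = none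
      rw [hb, hn]
    · rw [vproj_vin L e' g hg,
        vproj_tmk (tensor L M) _ ((Equiv.sumCongr g (Equiv.refl C)).trans e₂), tensor_act]
      · refine (tmk_act e₂ g (Equiv.refl C) y x).symm.trans ?_
        rw [FBModule.act_refl]
      · rintro (b | c)
        · change e (Sum.inl (e' (Sum.inr b))) = _
          rw [hg, hl]
          rfl
        · exact hr c
  exact LinearMap.congr_fun this w

/-- Among the summands of `comulAt` only that of the base point has its factor `V` on `{none}`. -/
theorem vproj_comulAt (Y : Type) [Finite Y] :
    vproj (SymV k) Y (comulAt k (Option Y)) = SymV.basis k Y := by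
  rw [comulAt, map_sum, Finset.sum_eq_single none]
  · rw [vtens, tmkL_apply]
    refine vproj_tmk (SymV k) (Equiv.Set.sumCompl {none}) (Equiv.ofBijective
      (fun y : Y => (⟨some y, by simp⟩ : ↥({none}ᶜ : Set (Option Y)))) ⟨?_, ?_⟩).symm ?_ _
    · intro y y' hy
      simpa using hy
    · rintro ⟨_ | y, hy⟩
      · simp at hy
      · exact ⟨y, rfl⟩
    · intro b
      obtain ⟨y, rfl⟩ := (Equiv.ofBijective
        (fun y : Y => (⟨some y, by simp⟩ : ↥({none}ᶜ : Set (Option Y)))) ⟨fun y y' hy => by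
          simpa using hy, by
          rintro ⟨_ | y, hy⟩
          · simp at hy
          · exact ⟨y, rfl⟩⟩).surjective b
      rw [Equiv.symm_apply_apply]
      rfl
  · intro i _ hi
    rw [vtens, tmkL_apply]
    exact vproj_eq_zero (SymV k) _ (⟨none, fun h => hi h.symm⟩ : ↥({i}ᶜ : Set (Option Y))) rfl _ _
  · exact fun h => absurd (@Finset.mem_univ _ (Fintype.ofFinite _) _) h

end Coefficients

section Coefficients

open scoped Classical

attribute [local instance] Fintype.ofFinite

variable {k : Type u} [CommRing k]

/-! ### Removing the base point from a decomposition -/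

theorem exists_removeNone {X Y : Type} (e : Option X ≃ Option Y) (h : e none = none) :
    ∃ e' : X ≃ Y, ∀ x, e (some x) = some (e' x) := by
  refine ⟨Equiv.removeNone e, fun x => ?_⟩
  rw [Equiv.removeNone_some]
  refine Option.ne_none_iff_exists'.1 fun hx => ?_
  simpa using e.injective (hx.trans h.symm)

theorem exists_removeNone_right {A X Y : Type} (e : A ⊕ Option X ≃ Option Y)
    (h : e (Sum.inr none) = none) :
    ∃ e' : A ⊕ X ≃ Y, (∀ a, e (Sum.inl a) = some (e' (Sum.inl a))) ∧
      ∀ x, e (Sum.inr (some x)) = some (e' (Sum.inr x)) := by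
  let ε : Option (A ⊕ X) ≃ A ⊕ Option X :=
    ⟨fun o => o.elim (Sum.inr none) (Sum.map id some),
      Sum.elim (fun a => some (Sum.inl a)) (Option.map Sum.inr),
      by rintro (_ | a | x) <;> rfl, by rintro (a | _ | x) <;> rfl⟩
  obtain ⟨e', he'⟩ := exists_removeNone (ε.trans e) h
  exact ⟨e', fun a => he' (Sum.inl a), fun x => he' (Sum.inr x)⟩

theorem exists_removeNone_left {X C Y : Type} (e : Option X ⊕ C ≃ Option Y)
    (h : e (Sum.inl none) = none) :
    ∃ e' : X ⊕ C ≃ Y, (∀ x, e (Sum.inl (some x)) = some (e' (Sum.inl x))) ∧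
      ∀ c, e (Sum.inr c) = some (e' (Sum.inr c)) := by
  obtain ⟨e', h1, h2⟩ := exists_removeNone_right ((Equiv.sumComm _ _).trans e) h
  exact ⟨(Equiv.sumComm _ _).trans e', h2, h1⟩

/-- The exchange of the two base points. -/
def optionSwap (Z : Type) : Option (Option Z) ≃ Option (Option Z) where
  toFun
    | none => some none
    | some none => none
    | some (some z) => some (some z)
  invFun
    | none => some none
    | some none => none
    | some (some z) => some (some z)
  left_inv := by rintro (_ | _ | z) <;> rfl
  right_inv := by rintro (_ | _ | z) <;> rfl

/-- The exchange of the first two of three pieces. -/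
def sumSwap (A B C : Type) : B ⊕ (A ⊕ C) ≃ A ⊕ (B ⊕ C) :=
  splitRight (splitLeft (Equiv.refl _) (Equiv.refl _)) (Equiv.sumComm B A)

/-! ### The coefficients of a map `Sym(V) ⊗ M → V ⊗ M` -/

variable {M : FBModule k}

/-- The coefficient of `t ^ none` in `a (t ^ B ⊗ x)`. -/
noncomputable def coef (a : tensor (SymV k) M ⟶ tensor (V k) M) {B X Y : Type} [Finite B]
    [Finite X] [Finite Y] (e : B ⊕ X ≃ Option Y) : M.obj (.of X) →ₗ[k] M.obj (.of Y) :=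
  vproj M Y ∘ₗ (a.app (.of (Option Y))).hom ∘ₗ tmkL (SymV k) M e (SymV.basis k B)

theorem coef_apply (a : tensor (SymV k) M ⟶ tensor (V k) M) {B X Y : Type} [Finite B]
    [Finite X] [Finite Y] (e : B ⊕ X ≃ Option Y) (x : M.obj (.of X)) :
    coef a e x = vproj M Y ((a.app (.of (Option Y))).hom (tmk e (SymV.basis k B) x)) := rfl

theorem act_coef (a : tensor (SymV k) M ⟶ tensor (V k) M) {B X Y Y' : Type} [Finite B]
    [Finite X] [Finite Y] [Finite Y'] (e : B ⊕ X ≃ Option Y) (h : Y ≃ Y') (x : M.obj (.of X)) :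
    M.act h (coef a e x) = coef a (e.trans (Equiv.optionCongr h)) x := by
  rw [coef_apply, coef_apply, ← vproj_act M h (Equiv.optionCongr h) rfl fun _ => rfl,
    ← tensor_act]
  exact congrArg (vproj M Y') (FBModule.app_act a _ _).symm

theorem coef_act (a : tensor (SymV k) M ⟶ tensor (V k) M) {B B' X X' Y : Type} [Finite B]
    [Finite B'] [Finite X] [Finite X'] [Finite Y] (e : B' ⊕ X' ≃ Option Y) (f : B ≃ B')
    (h : X ≃ X') (x : M.obj (.of X)) :
    coef a e (M.act h x) = coef a ((Equiv.sumCongr f h).trans e) x := by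
  rw [coef_apply, coef_apply, ← tmk_act]
  rfl

/-- The decomposition of `Option Y` into the image of `X` and its complement. -/
noncomputable def complEquiv {X Y : Type} (p : X → Option Y) (hp : p.Injective) :
    ↥(Set.range p)ᶜ ⊕ X ≃ Option Y :=
  (Equiv.sumComm _ _).trans
    ((Equiv.sumCongr (Equiv.ofInjective p hp) (Equiv.refl _)).trans
      (Equiv.Set.sumCompl (Set.range p)))

theorem complEquiv_inl {X Y : Type} (p : X → Option Y) (hp : p.Injective)
    (b : ↥(Set.range p)ᶜ) : complEquiv p hp (Sum.inl b) = b := rfl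

/-- The coefficient of `t ^ none` in `a (t ^ B ⊗ x)`, where `B` is the complement of the image of
the injection `p : X → Y ⊔ {none}` and `x` is in `M(X)`. -/
noncomputable def coefOp (a : tensor (SymV k) M ⟶ tensor (V k) M) {X Y : Type} [Finite X]
    [Finite Y] (p : X → Option Y) (hp : p.Injective) : M.obj (.of X) →ₗ[k] M.obj (.of Y) :=
  coef a (complEquiv p hp)

/-- The bijection `e` is determined by its restriction `p` to `X` up to a relabelling of `B`, and
relabellings carry `t^B` to itself. This reduces all data of `a` to operations indexed by
injections. -/
theorem coef_eq_coefOp (a : tensor (SymV k) M ⟶ tensor (V k) M) {B X Y : Type} [Finite B]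
    [Finite X] [Finite Y] (e : B ⊕ X ≃ Option Y) (p : X → Option Y) (hp : p.Injective)
    (h : ∀ x, e (Sum.inr x) = p x) : coef a e = coefOp a p hp := by
  obtain rfl : p = fun x => e (Sum.inr x) := funext fun x => (h x).symm
  ext x
  let f : B ≃ ↥(Set.range fun x => e (Sum.inr x))ᶜ := rightEquiv ((Equiv.sumComm X B).trans e)
  have h1 := coef_act a (complEquiv _ hp) f (Equiv.refl X) x
  rw [FBModule.act_refl] at h1
  refine Eq.trans ?_ h1.symm
  congr 2
  ext (b | x) <;> rfl

theorem act_coefOp (a : tensor (SymV k) M ⟶ tensor (V k) M) {X Y Y' : Type} [Finite X]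
    [Finite Y] [Finite Y'] (p : X → Option Y) (hp : p.Injective) (h : Y ≃ Y')
    (p' : X → Option Y') (hp' : p'.Injective) (hpp : ∀ x, p' x = (p x).map h)
    (x : M.obj (.of X)) : M.act h (coefOp a p hp x) = coefOp a p' hp' x := by
  rw [coefOp, act_coef, coef_eq_coefOp a _ p' hp']
  intro x
  rw [hpp]
  rfl

theorem coefOp_act (a : tensor (SymV k) M ⟶ tensor (V k) M) {X X' Y : Type} [Finite X]
    [Finite X'] [Finite Y] (p : X' → Option Y) (hp : p.Injective) (h : X ≃ X')
    (p' : X → Option Y) (hp' : p'.Injective) (hpp : ∀ x, p' x = p (h x))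
    (x : M.obj (.of X)) : coefOp a p hp (M.act h x) = coefOp a p' hp' x := by
  rw [coefOp, coef_act a _ (Equiv.refl _), coef_eq_coefOp a _ p' hp']
  intro x
  rw [hpp]
  rfl

/-! ### The coefficients of the defining relation -/

/-- The vector `t ^ A ⊗ (t ^ B ⊗ x)`. -/
noncomputable def stdTensor (M : FBModule k) {A B C S : Type} [Finite A] [Finite B] [Finite C]
    [Finite S] (E : A ⊕ (B ⊕ C) ≃ S) (x : M.obj (.of C)) :
    (tensor (SymV k) (tensor (SymV k) M)).obj (.of S) :=
  tmk E (SymV.basis k A) (tmk (Equiv.refl (B ⊕ C)) (SymV.basis k B) x)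

theorem stdTensor_act {A B C S S' : Type} [Finite A] [Finite B] [Finite C]
    [Finite S] [Finite S'] (E : A ⊕ (B ⊕ C) ≃ S) (h : S ≃ S') (x : M.obj (.of C)) :
    (tensor (SymV k) (tensor (SymV k) M)).act h (stdTensor M E x) = stdTensor M (E.trans h) x :=
  tensor_act _ _ _ _

theorem switch_stdTensor {A B C S : Type} [Finite A] [Finite B] [Finite C]
    [Finite S] (E : A ⊕ (B ⊕ C) ≃ S) (x : M.obj (.of C)) :
    ((switch (SymV k) (SymV k) M).app (.of S)).hom (stdTensor M E x) =
      stdTensor M ((sumSwap A B C).trans E) x := by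
  refine (switch_tmk E (Equiv.refl (B ⊕ C)) _ _ x).trans ?_
  unfold stdTensor
  congr 1

/-- `Sym(V)` has rank one on every set, so scalars can be pulled out of both symmetric factors. -/
theorem stdTensor_hom_ext {S : Type} [Finite S] {P : Type*} [AddCommGroup P] [Module k P]
    {f g : (tensor (SymV k) (tensor (SymV k) M)).obj (.of S) →ₗ[k] P}
    (h : ∀ (A B C : Type) [Finite A] [Finite B] [Finite C] (E : A ⊕ (B ⊕ C) ≃ S)
      (x : M.obj (.of C)), f (stdTensor M E x) = g (stdTensor M E x)) : f = g := by
  refine tensor_hom_ext_right fun A B C X _ _ _ _ e e' c d x => ?_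
  have h1 : (tmk e c (tmk e' d x) : (tensor (SymV k) (tensor (SymV k) M)).obj (.of S)) =
      (show k from c) • (show k from d) •
        stdTensor M ((Equiv.sumCongr (Equiv.refl A) e').trans e) x := by
    have hc : c = (show k from c) • SymV.basis k A := (mul_one (show k from c)).symm
    have hd : d = (show k from d) • SymV.basis k B := (mul_one (show k from d)).symm
    conv_lhs => rw [hc, hd, tmk_smul_left, tmk_smul_left, ← tmkL_apply e, map_smul, tmkL_apply]
    rw [stdTensor, ← tmk_act, tensor_act, FBModule.act_refl]
    rfl
  rw [h1, map_smul, map_smul, map_smul, map_smul, h]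

/-- The coefficient of `t ^ none ⊗ t ^ (some none)` of a vector in `V ⊗ (V ⊗ M)`. -/
noncomputable def vproj₂ (M : FBModule k) (Z : Type) [Finite Z] :
    (tensor (V k) (tensor (V k) M)).obj (.of (Option (Option Z))) →ₗ[k] M.obj (.of Z) :=
  vproj M Z ∘ₗ vproj (tensor (V k) M) (Option Z)

/-- Switching the two factors `V` turns the coefficient of `t^i ⊗ t^j` into that of `t^j ⊗ t^i`, and
the labels `i`, `j` are here the two base points. -/
theorem vproj₂_switch (Z : Type) [Finite Z]
    (w : (tensor (V k) (tensor (V k) M)).obj (.of (Option (Option Z)))) :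
    vproj₂ M Z (((switch (V k) (V k) M).app (.of (Option (Option Z)))).hom w) =
      vproj₂ M Z ((tensor (V k) (tensor (V k) M)).act (optionSwap Z) w) := by
  have : vproj₂ M Z ∘ₗ ((switch (V k) (V k) M).app (.of (Option (Option Z)))).hom =
      vproj₂ M Z ∘ₗ (tensor (V k) (tensor (V k) M)).act (optionSwap Z) := by
    refine tensorV_hom_ext fun X _ e w => ?_
    simp only [vproj₂, LinearMap.comp_apply]
    rcases decomposition_cases e with ⟨b, hb⟩ | ⟨h0, -⟩
    -- The inner set contains the point `b` over `none`. Making `b` the base point of the inner set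
    -- brings the vector into the form required by `vproj_switch`.
    · obtain ⟨w, rfl⟩ : ∃ w', w = (tensor (V k) M).act (Equiv.optionSubtypeNe b) w' :=
        ⟨_, (FBModule.act_act_symm _ _ w).symm⟩
      have h1 : vin (tensor (V k) M) e ((tensor (V k) M).act (Equiv.optionSubtypeNe b) w) =
          vin (tensor (V k) M)
            ((Equiv.sumCongr (Equiv.refl Unit) (Equiv.optionSubtypeNe b)).trans e) w :=
        tmk_act e (Equiv.refl Unit) (Equiv.optionSubtypeNe b) (V.basis k Unit) w
      rw [h1]
      generalize he' : (Equiv.sumCongr (Equiv.refl Unit) (Equiv.optionSubtypeNe b)).trans e = e'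
      have hn : e' (Sum.inr none) = none := by rw [← he']; exact hb
      obtain ⟨e₂, hl, hr⟩ := exists_removeNone_right e' hn
      rw [vin, vproj_switch e' e₂ hn hl hr, tensor_act]
      rcases decomposition_cases e₂ with ⟨b, hb⟩ | ⟨h0, g, hg⟩
      · rw [vproj_eq_zero M e₂ b hb, vproj_eq_zero _ _ (some b), map_zero]
        rw [Equiv.trans_apply, hr, hb]
        rfl
      · rw [vproj_tmk M e₂ g hg, vproj_tmk _ _ (Equiv.optionCongr g),
          vproj_act M g _ rfl fun _ => rfl]
        rintro (_ | x)
        · rw [Equiv.trans_apply, hn]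
          rfl
        · rw [Equiv.trans_apply, hr, hg]
          rfl
    -- The outer factor `V` sits on `none`. It becomes the inner factor after the switch, and it
    -- sits on `some none` after the exchange of base points, so both sides vanish.
    · rw [vin, vproj_switch_eq_zero e () h0, tensor_act]
      obtain ⟨⟨⟩ | b, hb⟩ := (e.trans (optionSwap Z)).surjective none
      · rw [Equiv.trans_apply, h0] at hb
        exact absurd hb (by simp [optionSwap])
      · rw [vproj_eq_zero _ _ b hb]
  exact LinearMap.congr_fun this w

/-- The composite of two applications of `a`, the first to the second symmetric algebra. -/
noncomputable def doubleAction (a : tensor (SymV k) M ⟶ tensor (V k) M) :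
    tensor (SymV k) (tensor (SymV k) M) ⟶ tensor (V k) (tensor (V k) M) :=
  tensorHom (𝟙 (SymV k)) a ≫ switch (SymV k) (V k) M ≫ tensorHom (𝟙 (V k)) a

theorem doubleAction_stdTensor (a : tensor (SymV k) M ⟶ tensor (V k) M) {A B C S : Type} [Finite A]
    [Finite B] [Finite C] [Finite S] (E : A ⊕ (B ⊕ C) ≃ S) (x : M.obj (.of C)) :
    ((doubleAction a).app (.of S)).hom (stdTensor M E x) =
      ((tensorHom (𝟙 (V k)) a).app (.of S)).hom (((switch (SymV k) (V k) M).app (.of S)).hom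
        (tmk E (SymV.basis k A) ((a.app (.of (B ⊕ C))).hom
          (tmk (Equiv.refl (B ⊕ C)) (SymV.basis k B) x)))) := by
  refine congrArg (fun w => ((tensorHom (𝟙 (V k)) a).app (.of S)).hom
    (((switch (SymV k) (V k) M).app (.of S)).hom w)) ?_
  exact tensorHomAt_tmk (𝟙 (SymV k)) a E _ _

/-- The first factor `V` of the result is produced from `t^B ⊗ x`, hence sits on a point of `B ⊔ C`,
never on one of `A`. -/
theorem vproj₂_doubleAction_eq_zero (a : tensor (SymV k) M ⟶ tensor (V k) M) {A B C Z : Type}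
    [Finite A] [Finite B] [Finite C] [Finite Z] (E : A ⊕ (B ⊕ C) ≃ Option (Option Z)) (i : A)
    (hi : E (Sum.inl i) = none) (x : M.obj (.of C)) :
    vproj₂ M Z (((doubleAction a).app (.of (Option (Option Z)))).hom (stdTensor M E x)) = 0 := by
  rw [doubleAction_stdTensor, vproj₂, LinearMap.comp_apply, vproj_tensorHom,
    vproj_switch_eq_zero E i hi, map_zero, map_zero]

/-- The first application of `a` splits off `none` and leaves a vector of `M(Y)`; the second one
acts on `t^A` and this vector. In `Option Z` the set `A` is the complement of the image of `q`, so
the second coefficient is the operation of `q`. -/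
theorem vproj₂_doubleAction (a : tensor (SymV k) M ⟶ tensor (V k) M) {A B C Y Z : Type}
    [Finite A] [Finite B] [Finite C] [Finite Y] [Finite Z] (E : A ⊕ (B ⊕ C) ≃ Option (Option Z))
    (e : B ⊕ C ≃ Option Y) (q : Y → Option Z) (hq : q.Injective)
    (hE : ∀ w, E (Sum.inr w) = (e w).map q) (x : M.obj (.of C)) :
    vproj₂ M Z (((doubleAction a).app (.of (Option (Option Z)))).hom (stdTensor M E x)) =
      coefOp a q hq (coef a e x) := by
  let E' : A ⊕ Option Y ≃ Option (Option Z) := (Equiv.sumCongr (Equiv.refl A) e.symm).trans E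
  have hn : E' (Sum.inr none) = none := by simp [E', hE]
  obtain ⟨e₂, hl, hr⟩ := exists_removeNone_right E' hn
  have h1 : (tmk E (SymV.basis k A) ((a.app (.of (B ⊕ C))).hom
      (tmk (Equiv.refl (B ⊕ C)) (SymV.basis k B) x)) :
        (tensor (SymV k) (tensor (V k) M)).obj (.of (Option (Option Z)))) =
      tmk E' (SymV.basis k A) ((a.app (.of (Option Y))).hom (tmk e (SymV.basis k B) x)) := by
    have h2 : (tmk e (SymV.basis k B) x : (tensor (SymV k) M).obj (.of (Option Y))) =
        (tensor (SymV k) M).act e (tmk (Equiv.refl (B ⊕ C)) (SymV.basis k B) x) :=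
      (tensor_act e (Equiv.refl (B ⊕ C)) _ x).symm
    rw [h2, FBModule.app_act]
    refine Eq.trans ?_ (tmk_act E' (Equiv.refl A) e (SymV.basis k A) _).symm
    congr 1
    ext (a | w) <;> simp [E']
  rw [doubleAction_stdTensor, h1, vproj₂, LinearMap.comp_apply, vproj_tensorHom,
    vproj_switch E' e₂ hn hl hr, ← coef_apply, ← coef_apply, coef_eq_coefOp a e₂ q hq]
  intro y
  have h3 := hr y
  simp only [E', Equiv.trans_apply, Equiv.sumCongr_apply, Sum.map_inr, hE,
    Equiv.apply_symm_apply, Option.map_some, Option.some.injEq] at h3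
  exact h3.symm

theorem wittPrime_stdTensor (a : tensor (SymV k) M ⟶ tensor (V k) M) {A B C S : Type} [Finite A]
    [Finite B] [Finite C] [Finite S] (E : A ⊕ (B ⊕ C) ≃ S) (x : M.obj (.of C)) :
    ((wittPrime a).app (.of S)).hom (stdTensor M E x) =
      ((tensorHom (𝟙 (V k)) a).app (.of S)).hom (((tensorHom (𝟙 (V k))
        (assocInv (SymV k) (SymV k) M ≫ tensorHom (mulV k) (𝟙 M))).app (.of S)).hom
        (((switch (SymV k) (V k) (tensor (SymV k) M)).app (.of S)).hom
          (tmk E (SymV.basis k A) (((assocHom (V k) (SymV k) M).app (.of (B ⊕ C))).hom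
            (tmk (Equiv.refl (B ⊕ C)) (comulAt k B) x))))) := by
  refine congrArg (fun w => ((tensorHom (𝟙 (V k)) a).app (.of S)).hom (((tensorHom (𝟙 (V k))
        (assocInv (SymV k) (SymV k) M ≫ tensorHom (mulV k) (𝟙 M))).app (.of S)).hom
        (((switch (SymV k) (V k) (tensor (SymV k) M)).app (.of S)).hom w))) ?_
  refine (tensorHomAt_tmk (𝟙 (SymV k)) _ E _ _).trans ?_
  refine congrArg (tmk E (SymV.basis k A)) ?_
  refine congrArg ((assocHom (V k) (SymV k) M).app (.of (B ⊕ C))).hom ?_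
  refine (tensorHomAt_tmk (comulV k) (𝟙 M) (Equiv.refl (B ⊕ C)) (SymV.basis k B) x).trans ?_
  refine congrArg (fun w => tmk (Equiv.refl (B ⊕ C)) w x) ?_
  exact one_smul k (comulAt k B)

end Coefficients

/-! ### The coefficients of `a'`, and the defining relation in terms of coefficients -/

section Coefficients

open scoped Classical

attribute [local instance] Fintype.ofFinite

variable {k : Type u} [CommRing k] {M : FBModule k}

/-- The first factor `V` of `a'` comes from the comultiplication of `t^B`, so the base point must
lie in `B`. This lemma excludes `A`, and its right-hand counterpart excludes `C`. -/
theorem vproj₂_wittPrime_eq_zero_left (a : tensor (SymV k) M ⟶ tensor (V k) M) {A B C Z : Type}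
    [Finite A] [Finite B] [Finite C] [Finite Z] (E : A ⊕ (B ⊕ C) ≃ Option (Option Z)) (i : A)
    (hi : E (Sum.inl i) = none) (x : M.obj (.of C)) :
    vproj₂ M Z (((wittPrime a).app (.of (Option (Option Z)))).hom (stdTensor M E x)) = 0 := by
  rw [wittPrime_stdTensor, vproj₂, LinearMap.comp_apply, vproj_tensorHom, vproj_tensorHom,
    vproj_switch_eq_zero E i hi, map_zero, map_zero, map_zero]

/-- The coefficient of `t ^ none` after comultiplying the second symmetric algebra and moving the
new factor to the front. -/
theorem exists_vproj_switch_comul {A B C Y Z : Type} [Finite A] [Finite B] [Finite C] [Finite Y]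
    [Finite Z] (E : A ⊕ (B ⊕ C) ≃ Option Z) (h : B ⊕ C ≃ Option Y)
    (hE : E (Sum.inr (h.symm none)) = none) (x : M.obj (.of C)) :
    ∃ e₂ : A ⊕ Y ≃ Z, (∀ w y, h w = some y → E (Sum.inr w) = some (e₂ (Sum.inr y))) ∧
      vproj (tensor (SymV k) (tensor (SymV k) M)) Z
        (((switch (SymV k) (V k) (tensor (SymV k) M)).app (.of (Option Z))).hom
          (tmk E (SymV.basis k A) (((assocHom (V k) (SymV k) M).app (.of (B ⊕ C))).hom
            (tmk (Equiv.refl (B ⊕ C)) (comulAt k B) x)))) =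
      tmk e₂ (SymV.basis k A) (vproj (tensor (SymV k) M) Y
        (((assocHom (V k) (SymV k) M).app (.of (Option Y))).hom (tmk h (comulAt k B) x))) := by
  let E' : A ⊕ Option Y ≃ Option Z := (Equiv.sumCongr (Equiv.refl A) h.symm).trans E
  obtain ⟨e₂, hl, hr⟩ := exists_removeNone_right E' hE
  refine ⟨e₂, fun w y hw => ?_, ?_⟩
  · rw [← hr, ← hw]
    simp [E']
  have h1 : (tmk E (SymV.basis k A) (((assocHom (V k) (SymV k) M).app (.of (B ⊕ C))).hom
      (tmk (Equiv.refl (B ⊕ C)) (comulAt k B) x)) :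
        (tensor (SymV k) (tensor (V k) (tensor (SymV k) M))).obj (.of (Option Z))) =
      tmk E' (SymV.basis k A) (((assocHom (V k) (SymV k) M).app (.of (Option Y))).hom
        (tmk h (comulAt k B) x)) := by
    have h2 : (tmk h (comulAt k B) x :
          (tensor (tensor (V k) (SymV k)) M).obj (.of (Option Y))) =
        (tensor (tensor (V k) (SymV k)) M).act h (tmk (Equiv.refl (B ⊕ C)) (comulAt k B) x) :=
      (tensor_act h (Equiv.refl (B ⊕ C)) _ x).symm
    rw [h2, FBModule.app_act]
    refine Eq.trans ?_ (tmk_act E' (Equiv.refl A) h (SymV.basis k A) _).symm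
    congr 1
    ext (a | w) <;> simp [E']
  rw [h1, vproj_switch E' e₂ hE hl hr]

theorem vproj₂_wittPrime_eq_zero_right (a : tensor (SymV k) M ⟶ tensor (V k) M) {A B C Z : Type}
    [Finite A] [Finite B] [Finite C] [Finite Z] (E : A ⊕ (B ⊕ C) ≃ Option (Option Z)) (i : C)
    (hi : E (Sum.inr (Sum.inr i)) = none) (x : M.obj (.of C)) :
    vproj₂ M Z (((wittPrime a).app (.of (Option (Option Z)))).hom (stdTensor M E x)) = 0 := by
  let h : B ⊕ C ≃ Option {w : B ⊕ C // w ≠ Sum.inr i} :=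
    (Equiv.optionSubtypeNe (Sum.inr i : B ⊕ C)).symm
  obtain ⟨e₂, -, he₂⟩ := exists_vproj_switch_comul (M := M) E h hi x
  rw [wittPrime_stdTensor, vproj₂, LinearMap.comp_apply, vproj_tensorHom, vproj_tensorHom, he₂,
    vproj_assoc_eq_zero h i (Equiv.optionSubtypeNe_symm_self (Sum.inr i : B ⊕ C)), tmk_zero_right,
    map_zero, map_zero, map_zero]

/-- Only the summand `t^i ⊗ t^(B \ i)` of the comultiplication contributes. The product of `t^A` and
`t^(B \ i)` sits on the complement of the image of `C`, so what remains is the single operation of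
`p`. -/
theorem vproj₂_wittPrime (a : tensor (SymV k) M ⟶ tensor (V k) M) {A B C Z : Type}
    [Finite A] [Finite B] [Finite C] [Finite Z] (E : A ⊕ (B ⊕ C) ≃ Option (Option Z)) (i : B)
    (hi : E (Sum.inr (Sum.inl i)) = none) (p : C → Option Z) (hp : p.Injective)
    (hE : ∀ c, E (Sum.inr (Sum.inr c)) = some (p c)) (x : M.obj (.of C)) :
    vproj₂ M Z (((wittPrime a).app (.of (Option (Option Z)))).hom (stdTensor M E x)) =
      coefOp a p hp x := by
  let h : B ⊕ C ≃ Option {w : B ⊕ C // w ≠ Sum.inl i} :=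
    (Equiv.optionSubtypeNe (Sum.inl i : B ⊕ C)).symm
  have hhi : h (Sum.inl i) = none := Equiv.optionSubtypeNe_symm_self (Sum.inl i : B ⊕ C)
  -- Makes `i` the base point of `B`, so that `vproj_comulAt` evaluates the coefficient of the
  -- comultiplication.
  let β : B ≃ Option {b : B // b ≠ i} := (Equiv.optionSubtypeNe i).symm
  have hβi : β.symm none = i := rfl
  let h' : Option {b : B // b ≠ i} ⊕ C ≃ Option {w : B ⊕ C // w ≠ Sum.inl i} :=
    (Equiv.sumCongr β.symm (Equiv.refl C)).trans h
  have hh' : h' (Sum.inl none) = none := hhi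
  obtain ⟨e₂, hw, he₂⟩ := exists_vproj_switch_comul (M := M) E h hi x
  obtain ⟨e₃, hl, hr⟩ := exists_removeNone_left h' hh'
  have h1 : (tmk h (comulAt k B) x : (tensor (tensor (V k) (SymV k)) M).obj (.of (Option _))) =
      tmk h' (comulAt k (Option {b : B // b ≠ i})) x := by
    rw [← comulAt_act β]
    refine Eq.trans ?_ (congrArg (tmk h' _) (FBModule.act_refl M x))
    refine Eq.trans ?_ (tmk_act h' β (Equiv.refl C) (comulAt k B) x).symm
    congr 1
    ext (b | c) <;> simp [h']
  rw [wittPrime_stdTensor, vproj₂, LinearMap.comp_apply, vproj_tensorHom, vproj_tensorHom, he₂, h1,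
    vproj_assoc h' e₃ hh' hl hr, vproj_comulAt]
  have h2 : ((assocInv (SymV k) (SymV k) M ≫ tensorHom (mulV k) (𝟙 M)).app (.of (Option Z))).hom
      (tmk e₂ (SymV.basis k A) (tmk e₃ (SymV.basis k {b : B // b ≠ i}) x)) =
      tmk (splitLeft e₂ e₃) (SymV.basis k (A ⊕ {b : B // b ≠ i})) x := by
    refine (congrArg (tensorHomAt (mulV k) (𝟙 M) (Option Z))
      (assocInvAt_tmk (L := SymV k) (M := SymV k) (N := M) e₂ e₃ _ _ x)).trans ?_
    refine (tensorHomAt_tmk (mulV k) (𝟙 M) (splitLeft e₂ e₃) _ x).trans ?_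
    refine congrArg (fun c => tmk (splitLeft e₂ e₃) c x) ?_
    -- The basis vectors are both `1`, so their product is again the basis vector.
    refine (mulAt_tmk k (Equiv.refl _) _ _).trans ?_
    exact mul_one (1 : k)
  rw [h2, ← coef_apply, coef_eq_coefOp a _ p hp]
  intro c
  have h3 := hw (Sum.inr c) (e₃ (Sum.inr c)) (hr c)
  rw [hE] at h3
  exact (Option.some.inj h3).symm

theorem FBModule.hom_ext {M N : FBModule k} {f g : M ⟶ N}
    (h : ∀ (S : Type) [Finite S], (f.app (.of S)).hom = (g.app (.of S)).hom) : f = g := by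
  ext S : 2
  ext1
  exact h S.carrier

theorem FBModule.sub_app_apply {M N : FBModule k} (f g : M ⟶ N) (S : FB) (x : M.obj S) :
    ((f - g).app S).hom x = (f.app S).hom x - (g.app S).hom x := rfl

theorem FBModule.comp_app_apply {M N P : FBModule k} (f : M ⟶ N) (g : N ⟶ P) (S : FB)
    (x : M.obj S) : ((f ≫ g).app S).hom x = (g.app S).hom ((f.app S).hom x) := rfl

/-- The composite `a₁ a₂` is `doubleAction` followed by the switch of the factors `V`. The switch
becomes an exchange of base points, which naturality moves into the decomposition `E`. In this way
all four terms of the relation are expressed by `doubleAction` and `wittPrime`. -/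
theorem vproj₂_firstSecond (a : tensor (SymV k) M ⟶ tensor (V k) M) {A B C Z : Type}
    [Finite A] [Finite B] [Finite C] [Finite Z] (E : A ⊕ (B ⊕ C) ≃ Option (Option Z))
    (x : M.obj (.of C)) :
    vproj₂ M Z (((firstSecond a).app (.of (Option (Option Z)))).hom (stdTensor M E x)) =
      vproj₂ M Z (((doubleAction a).app (.of (Option (Option Z)))).hom
        (stdTensor M (E.trans (optionSwap Z)) x)) := by
  have h : firstSecond a = doubleAction a ≫ switch (V k) (V k) M := by
    simp only [firstSecond, doubleAction, Category.assoc]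
  rw [h, FBModule.comp_app_apply, vproj₂_switch, ← FBModule.app_act, stdTensor_act]

theorem secondFirst_stdTensor (a : tensor (SymV k) M ⟶ tensor (V k) M) {A B C S : Type}
    [Finite A] [Finite B] [Finite C] [Finite S] (E : A ⊕ (B ⊕ C) ≃ S)
    (x : M.obj (.of C)) :
    ((secondFirst a).app (.of S)).hom (stdTensor M E x) =
      ((doubleAction a).app (.of S)).hom (stdTensor M ((sumSwap A B C).trans E) x) := by
  have h : secondFirst a = switch (SymV k) (SymV k) M ≫ doubleAction a := by
    simp only [secondFirst, doubleAction]
  rw [h, FBModule.comp_app_apply, switch_stdTensor]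

theorem vproj₂_wittDoublePrime (a : tensor (SymV k) M ⟶ tensor (V k) M) {A B C Z : Type}
    [Finite A] [Finite B] [Finite C] [Finite Z] (E : A ⊕ (B ⊕ C) ≃ Option (Option Z))
    (x : M.obj (.of C)) :
    vproj₂ M Z (((wittDoublePrime a).app (.of (Option (Option Z)))).hom (stdTensor M E x)) =
      vproj₂ M Z (((wittPrime a).app (.of (Option (Option Z)))).hom
        (stdTensor M ((sumSwap A B C).trans (E.trans (optionSwap Z))) x)) := by
  rw [wittDoublePrime, FBModule.comp_app_apply, FBModule.comp_app_apply, vproj₂_switch,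
    ← FBModule.app_act, switch_stdTensor, stdTensor_act, Equiv.trans_assoc]

/-- The defining relation of the curried Witt algebra holds if and only if it holds for all
coefficients. -/
theorem isWittRep_iff (X : WittData k) : IsWittRep k X ↔
    ∀ (A B C Z : Type) [Finite A] [Finite B] [Finite C] [Finite Z]
      (E : A ⊕ (B ⊕ C) ≃ Option (Option Z)) (x : X.obj.obj (.of C)),
      vproj₂ X.obj Z (((doubleAction X.map).app (.of (Option (Option Z)))).hom
          (stdTensor X.obj (E.trans (optionSwap Z)) x)) -
        vproj₂ X.obj Z (((doubleAction X.map).app (.of (Option (Option Z)))).hom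
          (stdTensor X.obj ((sumSwap A B C).trans E) x)) =
      vproj₂ X.obj Z (((wittPrime X.map).app (.of (Option (Option Z)))).hom
          (stdTensor X.obj E x)) -
        vproj₂ X.obj Z (((wittPrime X.map).app (.of (Option (Option Z)))).hom
          (stdTensor X.obj ((sumSwap A B C).trans (E.trans (optionSwap Z))) x)) := by
  constructor
  · intro h A B C Z _ _ _ _ E x
    have h1 : vproj₂ X.obj Z (((firstSecond X.map - secondFirst X.map).app
        (.of (Option (Option Z)))).hom (stdTensor X.obj E x)) = vproj₂ X.obj Z
        (((wittPrime X.map - wittDoublePrime X.map).app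
          (.of (Option (Option Z)))).hom (stdTensor X.obj E x)) := by
      rw [show firstSecond X.map - secondFirst X.map = wittPrime X.map - wittDoublePrime X.map
        from h]
    rw [FBModule.sub_app_apply, FBModule.sub_app_apply, map_sub, map_sub, vproj₂_firstSecond,
      secondFirst_stdTensor, vproj₂_wittDoublePrime] at h1
    exact h1
  · intro h
    have key : ∀ (S : Type) [Finite S],
        ((firstSecond X.map - secondFirst X.map).app (.of S)).hom =
          ((wittPrime X.map - wittDoublePrime X.map).app (.of S)).hom := by
      intro S _
      refine stdTensor_hom_ext fun A B C _ _ _ E x => ?_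
      -- Taking coefficients twice detects vectors of `V ⊗ (V ⊗ M)`. Naturality absorbs the
      -- relabellings `e`, `e'` into `E`, and only ground sets with two base points remain.
      refine tensorV_ext _ fun Y _ e => tensorV_ext _ fun Z _ e' => ?_
      rw [← vproj_act _ e' (Equiv.optionCongr e') rfl fun _ => rfl, ← FBModule.act_trans,
        ← vproj_act _ e' (Equiv.optionCongr e') rfl fun _ => rfl, ← FBModule.act_trans,
        ← FBModule.app_act, ← FBModule.app_act, stdTensor_act]
      generalize E.trans (e.trans (Equiv.optionCongr e')) = E
      change vproj₂ X.obj Z _ = vproj₂ X.obj Z _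
      rw [FBModule.sub_app_apply, FBModule.sub_app_apply, map_sub, map_sub,
        vproj₂_firstSecond, secondFirst_stdTensor, vproj₂_wittDoublePrime]
      exact h A B C Z E x
    exact FBModule.hom_ext fun S _ => key S

end Coefficients

/-! ### The Witt relation as commutation and merging of operations -/

section HookOp

open scoped Classical

attribute [local instance] Fintype.ofFinite

variable {k : Type u} [CommRing k]

theorem optionSwap_eq_none {Z : Type} {o : Option (Option Z)} :
    optionSwap Z o = none ↔ o = some none := by
  rcases o with _ | _ | z <;> simp [optionSwap]

theorem optionSwap_eq_some_none {Z : Type} {o : Option (Option Z)} :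
    optionSwap Z o = some none ↔ o = none := by
  rcases o with _ | _ | z <;> simp [optionSwap]

theorem optionSwap_eq_some_some {Z : Type} {o : Option (Option Z)} {z : Z} :
    optionSwap Z o = some (some z) ↔ o = some (some z) := by
  rcases o with _ | _ | z <;> simp [optionSwap]

theorem optionSwap_optionSwap {Z : Type} (o : Option (Option Z)) :
    optionSwap Z (optionSwap Z o) = o := by
  rcases o with _ | _ | z <;> rfl

theorem optionSwap_trans_optionSwap (Z : Type) :
    (optionSwap Z).trans (optionSwap Z) = Equiv.refl _ :=
  Equiv.ext optionSwap_optionSwap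

/-- Four injections that remove two points from a set in the two possible orders, such that the
points added in the two steps are disjoint. The first order is `p`, `q`, and the second order is
`q'`, `p'`. -/
structure IsHookSquare {C Y Y' Z : Type} (p : C → Option Y) (q : Y → Option Z)
    (q' : C → Option Y') (p' : Y' → Option Z) : Prop where
  comm : ∀ x, optionSwap Z ((p x).map q) = (q' x).map p'
  mem : ∀ y, q y = none → ∃ x, p x = some y
  mem' : ∀ y, p' y = none → ∃ x, q' x = some y
  inter : ∀ y y' z, q y = some z → p' y' = some z → ∃ x, p x = some y
  union : ∀ z, (∃ y, q y = some z) ∨ ∃ y, p' y = some z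

/-- All conditions but `inter` are visibly symmetric. For `inter`, a common point `z` comes from
some `x` in `C` through the first order, hence through the second by `comm`, and injectivity of `p'`
identifies the intermediate point. -/
theorem IsHookSquare.symm {C Y Y' Z : Type} {p : C → Option Y} {q : Y → Option Z}
    {q' : C → Option Y'} {p' : Y' → Option Z} (h : IsHookSquare p q q' p') (hp' : p'.Injective) :
    IsHookSquare q' p' p q where
  comm x := by rw [← h.comm, optionSwap_optionSwap]
  mem := h.mem'
  mem' := h.mem
  inter y' y z hy' hy := by
    obtain ⟨x, hx⟩ := h.inter y y' z hy hy'
    have h1 := h.comm x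
    rw [hx, Option.map_some, hy] at h1
    obtain ⟨y'', hy'', h2⟩ := Option.map_eq_some_iff.1 h1.symm
    exact ⟨x, by rw [hy'', hp' (h2.trans hy'.symm)]⟩
  union z := (h.union z).symm

/-- The decomposition of the last ground set in the first of the two orders. -/
noncomputable def IsHookSquare.equiv {C Y Y' Z : Type} {p : C → Option Y} {q : Y → Option Z}
    {q' : C → Option Y'} {p' : Y' → Option Z} (h : IsHookSquare p q q' p') (hq : q.Injective)
    (hp' : p'.Injective) : ↥(Set.range q')ᶜ ⊕ Y ≃ Option Z :=
  -- A point outside the image of `q'` is either the base point split off first in the second order,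
  -- which is the one split off last in the first order and so goes to `none`, or a point of `Y'`,
  -- which `p'` maps to `Option Z`.
  Equiv.ofBijective (Sum.elim (fun a => (a : Option Y').bind p') q) (by
    constructor
    · rintro (⟨a, ha⟩ | y) (⟨a', ha'⟩ | y') hy
      · congr
        rcases a with _ | a <;> rcases a' with _ | a'
        · rfl
        · exact absurd (h.mem' a' hy.symm) ha'
        · exact absurd (h.mem' a hy) ha
        · exact congrArg some (hp' hy)
      · exfalso
        change a.bind p' = q y' at hy
        rcases a with _ | a
        · obtain ⟨x, hx⟩ := h.mem y' hy.symm
          have h1 := h.comm x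
          rw [hx, Option.map_some, ← hy, Option.bind_none, optionSwap_eq_none.2 rfl] at h1
          exact ha ⟨x, Option.map_eq_none_iff.1 h1.symm⟩
        · rcases hz : q y' with _ | z
          · exact ha (h.mem' a (hy.trans hz))
          · exact ha ((h.symm hp').inter a y' z (hy.trans hz) hz)
      · exfalso
        change q y = a'.bind p' at hy
        rcases a' with _ | a'
        · obtain ⟨x, hx⟩ := h.mem y hy
          have h1 := h.comm x
          rw [hx, Option.map_some, hy, Option.bind_none, optionSwap_eq_none.2 rfl] at h1
          exact ha' ⟨x, Option.map_eq_none_iff.1 h1.symm⟩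
        · rcases hz : q y with _ | z
          · exact ha' (h.mem' a' (hy.symm.trans hz))
          · exact ha' ((h.symm hp').inter a' y z (hy.symm.trans hz) hz)
      · exact congrArg _ (hq hy)
    · rintro (_ | z)
      · by_cases hn : none ∈ Set.range q'
        · obtain ⟨x, hx⟩ := hn
          have h1 := h.comm x
          rw [hx, Option.map_none, optionSwap_eq_none] at h1
          obtain ⟨y, -, hy⟩ := Option.map_eq_some_iff.1 h1
          exact ⟨Sum.inr y, hy⟩
        · exact ⟨Sum.inl ⟨none, hn⟩, rfl⟩
      · rcases h.union z with ⟨y, hy⟩ | ⟨y', hy'⟩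
        · exact ⟨Sum.inr y, hy⟩
        · by_cases hn : some y' ∈ Set.range q'
          · obtain ⟨x, hx⟩ := hn
            have h1 := h.comm x
            rw [hx, Option.map_some, hy', optionSwap_eq_some_some] at h1
            obtain ⟨y, -, hy⟩ := Option.map_eq_some_iff.1 h1
            exact ⟨Sum.inr y, hy⟩
          · exact ⟨Sum.inl ⟨some y', hn⟩, hy'⟩)

/-- An injection `p : C → Y ⊔ {none}`, followed by an injection `q : Y → Z ⊔ {none}` that removes
a point which is not in the image of `p`. -/
structure IsHookMerge {C Y Z : Type} (p : C → Option Y) (q : Y → Option Z) (r : C → Option Z) :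
    Prop where
  exists_new : ∃ y, q y = none ∧ ∀ x, p x ≠ some y
  eq_bind : ∀ x, r x = (p x).bind q

/-- Operations `M(X) → M(Y)` for injections `X → Y ⊔ {none}` that satisfy the relations between the
coefficients of a representation of the curried Witt algebra. -/
structure IsWittOp {M : FBModule k} (op : ∀ {X Y : Type} [Finite X] [Finite Y] (p : X → Option Y),
    p.Injective → (M.obj (.of X) →ₗ[k] M.obj (.of Y))) : Prop where
  comm : ∀ {C Y Y' Z : Type} [Finite C] [Finite Y] [Finite Y'] [Finite Z] (p : C → Option Y)
    (q : Y → Option Z) (q' : C → Option Y') (p' : Y' → Option Z) (hp : p.Injective)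
    (hq : q.Injective) (hq' : q'.Injective) (hp' : p'.Injective), IsHookSquare p q q' p' →
    ∀ x, op q hq (op p hp x) = op p' hp' (op q' hq' x)
  merge : ∀ {C Y Z : Type} [Finite C] [Finite Y] [Finite Z] (p : C → Option Y)
    (q : Y → Option Z) (r : C → Option Z) (hp : p.Injective)
    (hq : q.Injective) (hr : r.Injective), IsHookMerge p q r →
    ∀ x, op q hq (op p hp x) = op r hr x

variable {M : FBModule k}

/-- The decomposition of a set with two base points obtained from two successive decompositions,
where the base point of the second one becomes the second base point. -/
def doubleEquiv {A W Y Z : Type} (e₁ : W ≃ Option Y) (e₂ : A ⊕ Y ≃ Option Z) :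
    A ⊕ W ≃ Option (Option Z) where
  toFun := Sum.elim (fun a => some (e₂ (Sum.inl a))) fun w => (e₁ w).map fun y => e₂ (Sum.inr y)
  invFun o := o.elim (Sum.inr (e₁.symm none)) fun z =>
    Sum.map id (fun y => e₁.symm (some y)) (e₂.symm z)
  left_inv := by
    rintro (a | w)
    · simp
    · obtain ⟨_ | y, rfl⟩ := e₁.symm.surjective w <;> simp
  right_inv := by
    rintro (_ | z)
    · simp
    · obtain ⟨a | y, rfl⟩ := e₂.surjective z <;> simp

theorem vproj₂_wittPrime_eq_zero (a : tensor (SymV k) M ⟶ tensor (V k) M) {A B C Z : Type}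
    [Finite A] [Finite B] [Finite C] [Finite Z] (E : A ⊕ (B ⊕ C) ≃ Option (Option Z))
    (hE : ∀ b, E (Sum.inr (Sum.inl b)) ≠ none) (x : M.obj (.of C)) :
    vproj₂ M Z (((wittPrime a).app (.of (Option (Option Z)))).hom (stdTensor M E x)) = 0 := by
  obtain ⟨i | i | i, hi⟩ := E.surjective none
  · exact vproj₂_wittPrime_eq_zero_left a E i hi x
  · exact absurd hi (hE i)
  · exact vproj₂_wittPrime_eq_zero_right a E i hi x

/-- The rules are instances of the coefficient relation for a decomposition in which `B` is the
complement of the image of `p`, and `A` is the complement of the image of `q'` (for commutation) or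
of `q` (for merging). In the first case both terms on the right vanish; in the second case `a''` and
one of the composites do. -/
theorem isWittOp_of_isWittRep (X : WittData k) (hX : IsWittRep k X) :
    IsWittOp (M := X.obj) (coefOp X.map) where
  comm {C Y Y' Z} _ _ _ _ p q q' p' hp hq hq' hp' h x := by
    let e₂ : ↥(Set.range q')ᶜ ⊕ Y ≃ Option Z := h.equiv hq hp'
    let E := doubleEquiv (complEquiv p hp) e₂
    -- The relation is used for the exchange of base points applied to `E`, because its first term
    -- exchanges them once more and is then taken at `E` itself.
    have h1 := (isWittRep_iff X).1 hX _ _ _ _ (E.trans (optionSwap Z)) x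
    rw [Equiv.trans_assoc, optionSwap_trans_optionSwap, Equiv.trans_refl,
      vproj₂_doubleAction X.map E (complEquiv p hp) q hq (fun w => rfl),
      vproj₂_doubleAction X.map _ (complEquiv q' hq') p' hp', vproj₂_wittPrime_eq_zero,
      vproj₂_wittPrime_eq_zero, sub_eq_sub_iff_add_eq_add, add_zero, zero_add] at h1
    · exact h1
    · intro b hb
      exact Option.some_ne_none _ hb
    · rintro ⟨b, hb⟩ hbn
      rw [Equiv.trans_apply, optionSwap_eq_none] at hbn
      obtain ⟨y, hy, hqy⟩ := Option.map_eq_some_iff.1 hbn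
      rw [complEquiv_inl] at hy
      obtain ⟨c, hc⟩ := h.mem y hqy
      exact hb ⟨c, hc.trans hy.symm⟩
    · rintro (⟨a, ha⟩ | c)
      · change optionSwap Z (some (a.bind p')) = a.map p'
        rcases a with _ | y'
        · rfl
        · rcases hz : p' y' with _ | z
          · exact absurd (h.mem' y' hz) ha
          · rw [Option.bind_some, Option.map_some, hz]
            rfl
      · exact h.comm c
  merge {C Y Z} _ _ _ p q r hp hq hr h x := by
    obtain ⟨y₀, hq₀, hp₀⟩ := h.exists_new
    let E := doubleEquiv (complEquiv p hp) (complEquiv q hq)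
    -- The point of `B` that `q` removes. After the exchange of base points it is `none`, which
    -- kills the second composite and makes `a'` contribute.
    let i : ↥(Set.range p)ᶜ := ⟨some y₀, fun ⟨x, hx⟩ => hp₀ x hx⟩
    have hi : (E.trans (optionSwap Z)) (Sum.inr (Sum.inl i)) = none := by
      rw [Equiv.trans_apply, optionSwap_eq_none]
      exact congrArg some hq₀
    have h1 := (isWittRep_iff X).1 hX _ _ _ _ (E.trans (optionSwap Z)) x
    rw [Equiv.trans_assoc, optionSwap_trans_optionSwap, Equiv.trans_refl,
      vproj₂_doubleAction X.map E (complEquiv p hp) q hq (fun w => rfl),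
      vproj₂_doubleAction_eq_zero X.map _ i hi, vproj₂_wittPrime X.map _ i hi r hr,
      vproj₂_wittPrime_eq_zero, sub_zero, sub_zero] at h1
    · exact h1
    · intro b hb
      exact Option.some_ne_none _ hb
    · intro c
      change optionSwap Z ((p c).map q) = some (r c)
      rw [h.eq_bind]
      rcases hc : p c with _ | y
      · rfl
      · rcases hz : q y with _ | z
        · exact absurd (hc.trans (congrArg some (hq (hz.trans hq₀.symm)))) (hp₀ c)
        · rw [Option.bind_some, Option.map_some, hz]
          rfl

theorem exists_eq_map {A W Z : Type} [Finite W] (E : A ⊕ W ≃ Option Z) (w : W)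
    (hw : E (Sum.inr w) = none) :
    ∃ (Y : Type) (_ : Finite Y) (e : W ≃ Option Y) (q : Y → Z),
      q.Injective ∧ ∀ w, E (Sum.inr w) = (e w).map q := by
  let e : W ≃ Option {w' // w' ≠ w} := (Equiv.optionSubtypeNe w).symm
  obtain ⟨e₂, hl, hr⟩ := exists_removeNone_right
    ((Equiv.sumCongr (Equiv.refl A) e.symm).trans E) hw
  refine ⟨{w' // w' ≠ w}, inferInstance, e, fun y => e₂ (Sum.inr y),
    e₂.injective.comp Sum.inr_injective, fun w' => ?_⟩
  obtain ⟨_ | y, rfl⟩ := e.symm.surjective w'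
  · rw [Equiv.apply_symm_apply]
    exact hw
  · rw [Equiv.apply_symm_apply]
    exact hr y

/-- The converse reading of `vproj₂_doubleAction`: if `none` is not in `A`, it can be split off from
`B ⊔ C`, and the two injections are read off from the given decomposition. -/
theorem exists_coefOp_eq_doubleAction (a : tensor (SymV k) M ⟶ tensor (V k) M) {A B C Z : Type}
    [Finite A] [Finite B] [Finite C] [Finite Z] (E : A ⊕ (B ⊕ C) ≃ Option (Option Z))
    (hE : ∀ i, E (Sum.inl i) ≠ none) :
    ∃ (Y : Type) (_ : Finite Y) (e : B ⊕ C ≃ Option Y) (q : Y → Option Z) (p : C → Option Y)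
      (hq : q.Injective) (hp : p.Injective), (∀ w, E (Sum.inr w) = (e w).map q) ∧
      (∀ c, e (Sum.inr c) = p c) ∧ ∀ x : M.obj (.of C),
      vproj₂ M Z (((doubleAction a).app (.of (Option (Option Z)))).hom (stdTensor M E x)) =
        coefOp a q hq (coefOp a p hp x) := by
  obtain ⟨i | w, hw⟩ := E.surjective none
  · exact absurd hw (hE i)
  · obtain ⟨Y, hY, e, q, hq, h⟩ := exists_eq_map E w hw
    have hp : Function.Injective fun c => e (Sum.inr c) := e.injective.comp Sum.inr_injective
    refine ⟨Y, hY, e, q, _, hq, hp, h, fun _ => rfl, fun x => ?_⟩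
    rw [vproj₂_doubleAction a E e q hq h, coef_eq_coefOp a e _ hp fun _ => rfl]

theorem exists_coefOp_eq_wittPrime (a : tensor (SymV k) M ⟶ tensor (V k) M) {A B C Z : Type}
    [Finite A] [Finite B] [Finite C] [Finite Z] (E : A ⊕ (B ⊕ C) ≃ Option (Option Z)) (i : B)
    (hi : E (Sum.inr (Sum.inl i)) = none) :
    ∃ (r : C → Option Z) (hr : r.Injective), (∀ c, E (Sum.inr (Sum.inr c)) = some (r c)) ∧
      ∀ x : M.obj (.of C),
      vproj₂ M Z (((wittPrime a).app (.of (Option (Option Z)))).hom (stdTensor M E x)) =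
        coefOp a r hr x := by
  have h1 : ∀ c, ∃ z, E (Sum.inr (Sum.inr c)) = some z := fun c =>
    Option.ne_none_iff_exists'.1 fun hc => by simpa using E.injective (hc.trans hi.symm)
  choose r hr using h1
  have hrI : r.Injective := fun c c' hc => by
    have : E (Sum.inr (Sum.inr c)) = E (Sum.inr (Sum.inr c')) := by rw [hr, hr, hc]
    simpa using this
  exact ⟨r, hrI, hr, fun x => vproj₂_wittPrime a E i hi r hrI hr x⟩

/-- The case of one nonzero composite against `a'`. Since `some none` is not in `A`, the composite
is a product of two operations. The point `i` of `B` is removed by the second of them and is outside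
the image of `p`, so the merging rule applies. -/
theorem doubleAction_eq_wittPrime (a : tensor (SymV k) M ⟶ tensor (V k) M)
    (ha : IsWittOp (M := M) (coefOp a)) {A B C Z : Type} [Finite A] [Finite B] [Finite C]
    [Finite Z] (E : A ⊕ (B ⊕ C) ≃ Option (Option Z)) (hA : ∀ i, E (Sum.inl i) ≠ some none) (i : B)
    (hi : E (Sum.inr (Sum.inl i)) = none) (x : M.obj (.of C)) :
    vproj₂ M Z (((doubleAction a).app (.of (Option (Option Z)))).hom
        (stdTensor M (E.trans (optionSwap Z)) x)) =
      vproj₂ M Z (((wittPrime a).app (.of (Option (Option Z)))).hom (stdTensor M E x)) := by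
  obtain ⟨Y, _, e, q, p, hq, hp, h1, h2, h3⟩ :=
    exists_coefOp_eq_doubleAction a (E.trans (optionSwap Z))
      (fun i hi => hA i (optionSwap_eq_none.1 hi))
  obtain ⟨r, hr, h4, h5⟩ := exists_coefOp_eq_wittPrime a E i hi
  rw [h3, h5]
  refine ha.merge p q r hp hq hr ⟨?_, fun c => ?_⟩ x
  · have h6 := h1 (Sum.inl i)
    rw [Equiv.trans_apply, hi] at h6
    obtain ⟨y, hy, hqy⟩ := Option.map_eq_some_iff.1 h6.symm
    refine ⟨y, hqy, fun c hc => ?_⟩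
    simpa using e.injective (hy.trans (hc.symm.trans (h2 c).symm))
  · have h6 := h1 (Sum.inr c)
    rw [Equiv.trans_apply, h4, h2] at h6
    rcases hc : p c with _ | y
    · rw [hc, Option.map_none, optionSwap_eq_none] at h6
      exact Option.some.inj h6
    · rw [hc, Option.map_some] at h6
      rcases hz : q y with _ | z
      · rw [hz, optionSwap_eq_some_none] at h6
        exact absurd h6 (Option.some_ne_none _)
      · rw [hz, optionSwap_eq_some_some] at h6
        rw [Option.bind_some, hz]
        exact Option.some.inj h6

/-- The case in which both composites survive. The conditions of a hook square express that `A`,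
`B`, `C` partition the ground set: `mem` and `mem'` say that the point removed second was not added
in the first step, `inter` that `A` and `B` are disjoint, and `union` that every point is reached in
at least one order. -/
theorem doubleAction_comm (a : tensor (SymV k) M ⟶ tensor (V k) M)
    (ha : IsWittOp (M := M) (coefOp a)) {A B C Z : Type} [Finite A] [Finite B] [Finite C]
    [Finite Z] (E : A ⊕ (B ⊕ C) ≃ Option (Option Z)) (hA : ∀ i, E (Sum.inl i) ≠ some none)
    (hB : ∀ i, E (Sum.inr (Sum.inl i)) ≠ none) (x : M.obj (.of C)) :
    vproj₂ M Z (((doubleAction a).app (.of (Option (Option Z)))).hom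
        (stdTensor M (E.trans (optionSwap Z)) x)) =
      vproj₂ M Z (((doubleAction a).app (.of (Option (Option Z)))).hom
        (stdTensor M ((sumSwap A B C).trans E) x)) := by
  obtain ⟨Y, _, e, q, p, hq, hp, h1, h2, h3⟩ :=
    exists_coefOp_eq_doubleAction a (E.trans (optionSwap Z))
      (fun i hi => hA i (optionSwap_eq_none.1 hi))
  obtain ⟨Y', _, e', p', q', hp', hq', h1', h2', h3'⟩ :=
    exists_coefOp_eq_doubleAction a ((sumSwap A B C).trans E) hB
  have h4 : ∀ w, E (Sum.inr w) = optionSwap Z ((e w).map q) := fun w => by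
    rw [← h1, Equiv.trans_apply, optionSwap_optionSwap]
  have h5 : ∀ a, E (Sum.inl a) = (e' (Sum.inl a)).map p' := fun a => h1' (Sum.inl a)
  have h6 : ∀ c, E (Sum.inr (Sum.inr c)) = (e' (Sum.inr c)).map p' := fun c => h1' (Sum.inr c)
  suffices h : IsHookSquare p q q' p' from
    (h3 x).trans ((ha.comm p q q' p' hp hq hq' hp' h x).trans (h3' x).symm)
  refine ⟨fun c => ?_, fun y hy => ?_, fun y hy => ?_,
    fun y y' z hy hy' => ?_, fun z => ?_⟩
  · rw [← h2, ← h2', ← h4, h6]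
  · obtain ⟨b | c, hw⟩ := e.surjective (some y)
    · have h7 := h4 (Sum.inl b)
      rw [hw, Option.map_some, hy, optionSwap_eq_none.2 rfl] at h7
      exact absurd h7 (hB b)
    · exact ⟨c, (h2 c).symm.trans hw⟩
  · obtain ⟨b | c, hw⟩ := e'.surjective (some y)
    · have h7 := h5 b
      rw [hw, Option.map_some, hy] at h7
      exact absurd h7 (hA b)
    · exact ⟨c, (h2' c).symm.trans hw⟩
  · obtain ⟨b | c, hw⟩ := e.surjective (some y)
    · exfalso
      have h7 := h4 (Sum.inl b)
      rw [hw, Option.map_some, hy, optionSwap_eq_some_some.2 rfl] at h7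
      obtain ⟨a | c, hw'⟩ := e'.surjective (some y')
      · have h8 := h5 a
        rw [hw', Option.map_some, hy'] at h8
        simpa using E.injective (h7.trans h8.symm)
      · have h8 := h6 c
        rw [hw', Option.map_some, hy'] at h8
        simpa using E.injective (h7.trans h8.symm)
    · exact ⟨c, (h2 c).symm.trans hw⟩
  · obtain ⟨a | w, hw⟩ := E.surjective (some (some z))
    · rw [h5] at hw
      obtain ⟨y, -, hy⟩ := Option.map_eq_some_iff.1 hw
      exact Or.inr ⟨y, hy⟩
    · rw [h4, optionSwap_eq_some_some] at hw
      obtain ⟨y, -, hy⟩ := Option.map_eq_some_iff.1 hw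
      exact Or.inl ⟨y, hy⟩

/-- Four cases, according to whether `some none` lies in `A` and whether `none` lies in `B`. If
neither holds, the commutation rule applies; if exactly one holds, the merging rule applies; if both
hold, no rule is needed. -/
theorem isWittRep_of_isWittOp (X : WittData k) (hX : IsWittOp (M := X.obj) (coefOp X.map)) :
    IsWittRep k X := by
  rw [isWittRep_iff]
  intro A B C Z _ _ _ _ E x
  have hE' : ((sumSwap A B C).trans (E.trans (optionSwap Z))).trans (optionSwap Z) =
      (sumSwap A B C).trans E := by
    rw [Equiv.trans_assoc, Equiv.trans_assoc, optionSwap_trans_optionSwap, Equiv.trans_refl]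
  have hE₁ : ∀ b, ((sumSwap A B C).trans (E.trans (optionSwap Z))) (Sum.inl b) =
      optionSwap Z (E (Sum.inr (Sum.inl b))) := fun _ => rfl
  have hE₂ : ∀ a, ((sumSwap A B C).trans (E.trans (optionSwap Z))) (Sum.inr (Sum.inl a)) =
      optionSwap Z (E (Sum.inl a)) := fun _ => rfl
  have hE₃ : ∀ c, ((sumSwap A B C).trans (E.trans (optionSwap Z))) (Sum.inr (Sum.inr c)) =
      optionSwap Z (E (Sum.inr (Sum.inr c))) := fun _ => rfl
  rw [← hE']
  generalize (sumSwap A B C).trans (E.trans (optionSwap Z)) = E' at hE' hE₁ hE₂ hE₃ ⊢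
  by_cases hA : ∃ j, E (Sum.inl j) = some none
  · obtain ⟨j, hj⟩ := hA
    have hj' : E' (Sum.inr (Sum.inl j)) = none := by rw [hE₂, hj]; rfl
    rw [vproj₂_doubleAction_eq_zero X.map _ j (by rw [Equiv.trans_apply, hj]; rfl)]
    by_cases hB : ∃ i, E (Sum.inr (Sum.inl i)) = none
    · obtain ⟨i, hi⟩ := hB
      obtain ⟨r, hr, h1, h2⟩ := exists_coefOp_eq_wittPrime X.map E i hi
      obtain ⟨r', hr', h1', h2'⟩ := exists_coefOp_eq_wittPrime X.map E' j hj'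
      -- Both base points lie in `A ⊔ B`, so `C` maps into `Z`, where the exchange of base points
      -- does nothing. Hence `a'` and `a''` have equal coefficients, and both composites vanish.
      have hrr : r = r' := by
        funext c
        have h3 : optionSwap Z (E (Sum.inr (Sum.inr c))) = some (r' c) :=
          (hE₃ c).symm.trans (h1' c)
        rw [h1] at h3
        rcases hc : r c with _ | z
        · have h4 := h1 c
          rw [hc] at h4
          simpa using E.injective (h4.trans hj.symm)
        · rw [hc] at h3
          exact Option.some.inj h3
      subst hrr
      have hi' : (E'.trans (optionSwap Z)) (Sum.inl i) = none := by
        rw [Equiv.trans_apply, hE₁, hi]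
        rfl
      rw [vproj₂_doubleAction_eq_zero X.map _ i hi', h2, h2', sub_self, sub_self]
    -- The mirror image of the merging case: in `E'` the sets `A` and `B`, and the two base points,
    -- have exchanged their roles.
    · rw [vproj₂_wittPrime_eq_zero X.map E fun b hb => hB ⟨b, hb⟩,
        doubleAction_eq_wittPrime X.map hX E' (fun b hb => hB ⟨b, ?_⟩) j hj']
      exact optionSwap_eq_some_none.1 ((hE₁ b).symm.trans hb)
  · have h0 : ∀ b, E' (Sum.inr (Sum.inl b)) ≠ none := fun b hb =>
      hA ⟨b, optionSwap_eq_none.1 ((hE₂ b).symm.trans hb)⟩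
    rw [vproj₂_wittPrime_eq_zero X.map E' h0, sub_zero]
    by_cases hB : ∃ i, E (Sum.inr (Sum.inl i)) = none
    · obtain ⟨i, hi⟩ := hB
      have hi' : (E'.trans (optionSwap Z)) (Sum.inl i) = none := by
        rw [Equiv.trans_apply, hE₁, hi]
        rfl
      rw [vproj₂_doubleAction_eq_zero X.map _ i hi', sub_zero]
      exact doubleAction_eq_wittPrime X.map hX E (fun j hj => hA ⟨j, hj⟩) i hi x
    · rw [vproj₂_wittPrime_eq_zero X.map E fun b hb => hB ⟨b, hb⟩, sub_eq_zero, hE']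
      exact doubleAction_comm X.map hX E (fun j hj => hA ⟨j, hj⟩) (fun b hb => hB ⟨b, hb⟩) x

end HookOp

/-! ### The standard condition in terms of coefficients -/

section Standard

open scoped Classical

attribute [local instance] Fintype.ofFinite

variable {k : Type u} [CommRing k]

/-- A map `Sym(V) ⊗ M → V ⊗ M` is determined by its coefficients. -/
theorem hom_ext_of_coefOp {M : FBModule k} {a b : tensor (SymV k) M ⟶ tensor (V k) M}
    (h : ∀ (X Y : Type) [Finite X] [Finite Y] (p : X → Option Y) (hp : p.Injective)
      (x : M.obj (.of X)), coefOp a p hp x = coefOp b p hp x) : a = b := by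
  refine FBModule.hom_ext fun S _ => tensor_hom_ext fun A B _ _ e c x => ?_
  have hc : c = (show k from c) • SymV.basis k A := (mul_one (show k from c)).symm
  rw [hc, tmk_smul_left, map_smul, map_smul]
  congr 1
  refine tensorV_ext _ fun Y _ e' => ?_
  have hp : Function.Injective fun b => (e.trans e') (Sum.inr b) :=
    (e.trans e').injective.comp Sum.inr_injective
  rw [← FBModule.app_act, ← FBModule.app_act, tensor_act, ← coef_apply, ← coef_apply,
    coef_eq_coefOp a _ _ hp fun _ => rfl, coef_eq_coefOp b _ _ hp fun _ => rfl, h]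

theorem coefOp_naturality {X Y : WittData k} (φ : X ⟶ Y) {A B : Type} [Finite A] [Finite B]
    (p : A → Option B) (hp : p.Injective) (x : X.obj.obj (.of A)) :
    (φ.hom.app (.of B)).hom (coefOp X.map p hp x) =
      coefOp Y.map p hp ((φ.hom.app (.of A)).hom x) := by
  have h1 : ((X.map ≫ tensorHom (𝟙 (V k)) φ.hom).app (.of (Option B))).hom
      (tmk (complEquiv p hp) (SymV.basis k _) x) =
    ((tensorHom (𝟙 (SymV k)) φ.hom ≫ Y.map).app (.of (Option B))).hom
      (tmk (complEquiv p hp) (SymV.basis k _) x) := by rw [φ.comm]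
  have h2 := tensorHomAt_tmk (𝟙 (SymV k)) φ.hom (complEquiv p hp) (SymV.basis k _) x
  rw [coefOp, coef_apply, ← vproj_tensorHom, ← FBModule.comp_app_apply, h1, coefOp, coef_apply]
  exact congrArg (fun w => vproj Y.obj B ((Y.map.app (.of (Option B))).hom w)) h2

theorem iota_apply_of_eq {S : Type} (i j : S) (s : ↥({j}ᶜ : Set S)) (hs : (s : S) = i) :
    (iota i j s : S) = j := by
  change Equiv.swap i j s = j
  rw [hs, Equiv.swap_apply_left]

theorem iota_apply_of_ne {S : Type} (i j : S) (s : ↥({j}ᶜ : Set S)) (hs : (s : S) ≠ i) :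
    (iota i j s : S) = s :=
  Equiv.swap_apply_of_ne_of_ne hs s.2

/-- The complement of the base point. -/
noncomputable def noneCompl (Y : Type) : ↥({none}ᶜ : Set (Option Y)) ≃ Y :=
  (Equiv.optionSubtype none ⟨Equiv.refl (Option Y), rfl⟩).symm

theorem some_noneCompl {Y : Type} (y : ↥({none}ᶜ : Set (Option Y))) :
    some (noneCompl Y y) = (y : Option Y) := by
  rcases y with ⟨_ | y, hy⟩
  · exact absurd rfl hy
  · rfl

theorem vproj_vtens {M : FBModule k} {Y : Type} [Finite Y]
    (x : M.obj (.of ↥({none}ᶜ : Set (Option Y)))) :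
    vproj M Y (vtens M none x) = M.act (noneCompl Y) x :=
  vproj_tmk M _ _ (fun b => (some_noneCompl b).symm) x

theorem vproj_vtens_eq_zero {M : FBModule k} {Y : Type} [Finite Y] (i : Option Y) (hi : i ≠ none)
    (x : M.obj (.of ↥({i}ᶜ : Set (Option Y)))) : vproj M Y (vtens M i x) = 0 :=
  vproj_eq_zero M _ (⟨none, fun h => hi h.symm⟩ : ↥({i}ᶜ : Set (Option Y))) rfl _ _

theorem vproj_sum_vtens {M : FBModule k} {Y : Type} [Finite Y] (s : Finset (Option Y))
    (z : ∀ i : Option Y, M.obj (.of ↥({i}ᶜ : Set (Option Y)))) :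
    vproj M Y (∑ i ∈ s, vtens M i (z i)) =
      if none ∈ s then M.act (noneCompl Y) (z none) else 0 := by
  rw [map_sum]
  split_ifs with h
  · rw [Finset.sum_eq_single_of_mem none h fun i _ hi => vproj_vtens_eq_zero i hi _, vproj_vtens]
  · exact Finset.sum_eq_zero fun i hi => vproj_vtens_eq_zero i (fun h' => h (h' ▸ hi)) _

/-- On a one-point set `inclV` sends the generator of `V` to that of `Sym(V)`, so the coefficients
with one-point `B` only involve the restriction of `a` to `V`. -/
theorem coef_eq_glMap (X : WittData k) {A Y : Type} [Finite A] [Finite Y]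
    (e : Unit ⊕ A ≃ Option Y) (x : X.obj.obj (.of A)) :
    coef X.map e x = vproj X.obj Y ((X.glMap.app (.of (Option Y))).hom (vin X.obj e x)) := by
  have h1 : ((inclV k).app (.of Unit)).hom (V.basis k Unit) = SymV.basis k Unit := by
    have h : Nat.card Unit = 1 := by simp
    change (dite _ _ _ : (PLift (Nat.card Unit = 1) → k) →ₗ[k] k) _ = _
    rw [dif_pos h]
    rfl
  rw [coef_apply, ← h1]
  exact congrArg (fun w => vproj X.obj Y ((X.map.app (.of (Option Y))).hom w))
    (tensorHomAt_tmk (inclV k) (𝟙 X.obj) e (V.basis k Unit) x).symm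

/-- The two kinds of coefficients that are prescribed for standard representations. -/
structure IsStandardOp (δ : k) {M : FBModule k}
    (op : ∀ {X Y : Type} [Finite X] [Finite Y] (p : X → Option Y),
      p.Injective → (M.obj (.of X) →ₗ[k] M.obj (.of Y))) : Prop where
  op_some : ∀ {X Y : Type} [Finite X] [Finite Y] (e : X ≃ Y) (p : X → Option Y)
    (hp : p.Injective), (∀ x, p x = some (e x)) → ∀ x, op p hp x = δ • M.act e x
  op_none : ∀ {X Y : Type} [Finite X] [Finite Y] (e : X ≃ Y) (x₀ : X) (p : X → Option Y)
    (hp : p.Injective), p x₀ = none → (∀ x, x ≠ x₀ → p x = some (e x)) → ∀ x, op p hp x = M.act e x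

/-- Both rules concern a one-point set `B = {j}`. If `j` is the base point, the coefficient picks
out the diagonal term `δ t^j ⊗ x`; otherwise it picks out the term `i = none` of the sum. -/
theorem isStandardOp_of_isStandardGL {δ : k} (X : WittData k) (hX : IsStandardGL δ X.glMap) :
    IsStandardOp δ (M := X.obj) (coefOp X.map) where
  op_some {A Y} _ _ e p hp h x := by
    let E : Unit ⊕ A ≃ Option Y :=
      ((Equiv.sumComm _ _).trans (Equiv.optionEquivSumPUnit A).symm).trans (Equiv.optionCongr e)
    let g : A ≃ ↥({none}ᶜ : Set (Option Y)) := e.trans (noneCompl Y).symm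
    have hg : ∀ a, (g a : Option Y) = E (Sum.inr a) := fun a => by
      rw [← some_noneCompl]
      simp [g, E]
    have hE : ∀ a, E (Sum.inr a) = p a := fun a => (h a).symm
    rw [← coef_eq_coefOp X.map E p hp hE, coef_eq_glMap, vin_of_vtens X.obj none E rfl g hg,
      hX (.of (Option Y)), map_add, map_smul, vproj_vtens, vproj_sum_vtens, if_neg, add_zero,
      ← FBModule.act_trans]
    · congr 2
    · simp
  op_none {A Y} _ _ e a₀ p hp h₀ h x := by
    have hj : ∀ a, p a ≠ some (e a₀) := by
      intro a ha
      by_cases haa : a = a₀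
      · rw [haa, h₀] at ha
        exact Option.some_ne_none _ ha.symm
      · rw [h a haa] at ha
        exact haa (e.injective (Option.some.inj ha))
    -- The point `e a₀` is the only one that `p` misses, since `p` sends `a₀` to `none` instead.
    let E : Unit ⊕ A ≃ Option Y := Equiv.ofBijective
      (Sum.elim (fun _ => some (e a₀)) p) (by
        constructor
        · rintro (⟨⟩ | a) (⟨⟩ | a') haa
          · rfl
          · exact absurd haa.symm (hj a')
          · exact absurd haa (hj a)
          · exact congrArg _ (hp haa)
        · rintro (_ | y)
          · exact ⟨Sum.inr a₀, h₀⟩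
          · obtain ⟨a, rfl⟩ := e.surjective y
            by_cases haa : a = a₀
            · exact ⟨Sum.inl (), by rw [haa]; rfl⟩
            · exact ⟨Sum.inr a, h a haa⟩)
    let g : A ≃ ↥({some (e a₀)}ᶜ : Set (Option Y)) := Equiv.ofBijective
      (fun a => ⟨p a, hj a⟩) (by
        constructor
        · intro a a' haa
          exact hp (congrArg Subtype.val haa)
        · rintro ⟨y, hy⟩
          obtain ⟨⟨⟩ | a, rfl⟩ := E.surjective y
          · exact absurd rfl hy
          · exact ⟨a, rfl⟩)
    rw [← coef_eq_coefOp X.map E p hp fun _ => rfl, coef_eq_glMap,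
      vin_of_vtens X.obj (some (e a₀)) E rfl g fun _ => rfl,
      hX (.of (Option Y)), map_add, map_smul, vproj_vtens_eq_zero _ (Option.some_ne_none _),
      smul_zero, zero_add, vproj_sum_vtens, if_pos, ← FBModule.act_trans, ← FBModule.act_trans]
    · congr 2
      ext a
      refine Option.some.inj ((some_noneCompl _).trans ?_)
      by_cases haa : a = a₀
      · rw [iota_apply_of_eq none _ (g a) (by rw [haa]; exact h₀), haa]
      · rw [iota_apply_of_ne none _ (g a)]
        · exact h a haa
        · intro h'
          exact Option.some_ne_none _ ((h a haa).symm.trans h')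
    · simp

end Standard

/-! ### Restricted diagrams as cospans, and composition as gluing -/

section Cospan

open scoped Classical

variable {k : Type u} [CommRing k] {δ : k}

theorem ofDiagram_comp {S T U : ResPartitionCat k δ} (ρ : Diagram S.carrier T.carrier)
    (hρ : ρ.IsRestricted) (σ : Diagram T.carrier U.carrier) (hσ : σ.IsRestricted) :
    ResPartitionCat.ofDiagram k δ ρ hρ ≫ ResPartitionCat.ofDiagram k δ σ hσ =
      δ ^ ρ.loops σ • ResPartitionCat.ofDiagram k δ (ρ.comp σ) (hρ.comp hσ) := by
  refine Subtype.ext ?_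
  refine (compHom_single δ ρ σ 1 1).trans ?_
  change _ = δ ^ ρ.loops σ • Finsupp.single (ρ.comp σ) (1 : k)
  rw [Finsupp.smul_single, smul_eq_mul, mul_one, mul_one, one_mul]

/-- The diagram whose parts are the nonempty fibers of a map to `J`. -/
abbrev kerDiagram {S T J : Type} (s : S → J) (f : T → J) : Diagram S T := Setoid.ker (Sum.elim s f)

theorem kerDiagram_isRestricted {S T J : Type} {s : S → J} (hs : s.Injective) (f : T → J) :
    (kerDiagram s f).IsRestricted := fun _ _ h => hs h

/-- The number of elements that are in the image of neither of two maps. -/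
noncomputable def numMissed {S T J : Type} (s : S → J) (f : T → J) : ℕ :=
  Nat.card {j : J // (∀ a, s a ≠ j) ∧ ∀ x, f x ≠ j}

/-- The morphism given by an injection `s : S → J` and a map `f : T → J`: it is the diagram whose
parts are the fibers over `J`, where each empty fiber counts as a factor `δ`. -/
noncomputable def cospanHom (δ : k) {S T J : Type} [Finite S] [Finite T] (s : S → J)
    (hs : s.Injective) (f : T → J) : (ResPartitionCat.of S : ResPartitionCat k δ) ⟶ .of T :=
  δ ^ numMissed s f •
    ResPartitionCat.ofDiagram k δ (S := .of S) (T := .of T) (kerDiagram s f)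
      (kerDiagram_isRestricted hs f)

theorem smul_ofDiagram_congr {S T : Type} [Finite S] [Finite T] {ρ σ : Diagram S T}
    (h : ρ = σ) (hρ : ρ.IsRestricted) (hσ : σ.IsRestricted) {m n : ℕ} (hmn : m = n) :
    (δ ^ m • ResPartitionCat.ofDiagram k δ (S := .of S) (T := .of T) ρ hρ) =
      δ ^ n • ResPartitionCat.ofDiagram k δ (S := .of S) (T := .of T) σ hσ := by
  subst h hmn
  rfl

/-- The gluing of two cospans along an injection. -/
structure IsCospanGlue {S T U J K L : Type} (s : S → J) (f : T → J) (t : T → K) (g : U → K)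
    (a : J → L) (b : K → L) : Prop where
  comm : ∀ x, a (f x) = b (t x)
  left_inj : a.Injective
  right_inj : ∀ y y', b y = b y' → y = y' ∨ y ∈ Set.range t ∧ y' ∈ Set.range t
  inter : ∀ j y, a j = b y → y ∈ Set.range t
  union : ∀ l, (∃ j, a j = l) ∨ ∃ y, b y = l

/-- The conditions on `a` and `b` make `L` the pushout of `J` and `K` over the middle vertices, so
the parts of the stacked diagram are the nonempty fibers over `L`. As `t` is injective, only `K` can
acquire new identifications. -/
theorem IsCospanGlue.glue_eq {S T U J K L : Type} {s : S → J} {f : T → J} {t : T → K} {g : U → K}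
    {a : J → L} {b : K → L} (h : IsCospanGlue s f t g a b) :
    Diagram.glue (kerDiagram s f) (kerDiagram t g) =
      Setoid.ker (Sum.elim (a ∘ s) (Sum.elim (a ∘ f) (b ∘ g))) := by
  set G := Diagram.glue (kerDiagram s f) (kerDiagram t g) with hG
  have h1 : kerDiagram s f ≤ G.comap (Sum.map id Sum.inl) := (map_le_iff _ _ _).1 le_sup_left
  have h2 : kerDiagram t g ≤ G.comap Sum.inr := (map_le_iff _ _ _).1 le_sup_right
  have hj : ∀ x y : S ⊕ T, Sum.elim s f x = Sum.elim s f y →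
      G (Sum.map id Sum.inl x) (Sum.map id Sum.inl y) := fun x y hxy => h1 hxy
  have hy : ∀ x y : T ⊕ U, Sum.elim t g x = Sum.elim t g y →
      G (Sum.inr x) (Sum.inr y) := fun x y hxy => h2 hxy
  apply le_antisymm
  · refine sup_le ((map_le_iff _ _ _).2 ?_) ((map_le_iff _ _ _).2 ?_)
    · have h3 : ∀ x : S ⊕ T, Sum.elim (a ∘ s) (Sum.elim (a ∘ f) (b ∘ g)) (Sum.map id Sum.inl x) =
          a (Sum.elim s f x) := by rintro (x | x) <;> rfl
      intro x y hxy
      change _ = _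
      rw [h3, h3]
      exact congrArg a hxy
    · have h3 : ∀ x : T ⊕ U, Sum.elim (a ∘ s) (Sum.elim (a ∘ f) (b ∘ g)) (Sum.inr x) =
          b (Sum.elim t g x) := by
        rintro (x | x)
        · exact h.comm x
        · rfl
      intro x y hxy
      change _ = _
      rw [h3, h3]
      exact congrArg b hxy
  · have hST : ∀ (x : S ⊕ T) (u : U), a (Sum.elim s f x) = b (g u) →
        G (Sum.map id Sum.inl x) (Sum.inr (Sum.inr u)) := by
      intro x u hxu
      obtain ⟨t₀, ht₀⟩ := h.inter _ _ hxu
      rw [← ht₀, ← h.comm] at hxu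
      exact G.trans (hj x (Sum.inr t₀) (h.left_inj hxu)) (hy (Sum.inl t₀) (Sum.inr u) ht₀)
    -- Distinct points of `K` with the same image in `L` both come from middle vertices, and the
    -- connection passes through one of these.
    have hUU : ∀ u u' : U, b (g u) = b (g u') → G (Sum.inr (Sum.inr u)) (Sum.inr (Sum.inr u')) := by
      intro u u' huu
      rcases h.right_inj _ _ huu with h3 | ⟨⟨t₀, ht₀⟩, ⟨t₁, ht₁⟩⟩
      · exact hy (Sum.inr u) (Sum.inr u') h3
      · have h4 := huu
        rw [← ht₀, ← h.comm] at h4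
        exact G.trans (hy (Sum.inr u) (Sum.inl t₀) ht₀.symm) (hST (Sum.inr t₀) u' h4)
    rintro (x | x | x) (y | y | y) hxy
    · exact hj (Sum.inl x) (Sum.inl y) (h.left_inj hxy)
    · exact hj (Sum.inl x) (Sum.inr y) (h.left_inj hxy)
    · exact hST (Sum.inl x) y hxy
    · exact hj (Sum.inr x) (Sum.inl y) (h.left_inj hxy)
    · exact hj (Sum.inr x) (Sum.inr y) (h.left_inj hxy)
    · exact hST (Sum.inr x) y hxy
    · exact G.symm (hST (Sum.inl y) x hxy.symm)
    · exact G.symm (hST (Sum.inr y) x hxy.symm)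
    · exact hUU x y hxy

theorem IsCospanGlue.comp_eq {S T U J K L : Type} {s : S → J} {f : T → J} {t : T → K} {g : U → K}
    {a : J → L} {b : K → L} (h : IsCospanGlue s f t g a b) :
    (kerDiagram s f).comp (kerDiagram t g) = kerDiagram (a ∘ s) (b ∘ g) := by
  rw [Diagram.comp, h.glue_eq]
  ext (x | x) (y | y) <;> rfl

/-- A point of `L` hit neither by `S` nor by `U` is of exactly one of three kinds. If a middle
vertex hits it, it is a removed loop. If none does and it lies in the image of `J`, it is an empty
part of the first cospan. Otherwise it is an empty part of the second one. -/
theorem IsCospanGlue.numMissed_eq {S T U J K L : Type} [Finite J] [Finite K] [Finite L] {s : S → J}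
    {f : T → J} {t : T → K} {g : U → K} {a : J → L} {b : K → L} (h : IsCospanGlue s f t g a b) :
    numMissed (a ∘ s) (b ∘ g) = numMissed s f + numMissed t g +
      (kerDiagram s f).loops (kerDiagram t g) := by
  let F : S ⊕ (T ⊕ U) → L := Sum.elim (a ∘ s) (Sum.elim (a ∘ f) (b ∘ g))
  have h1 : (kerDiagram s f).loops (kerDiagram t g) =
      Nat.card {l : L // ((∀ x, a (s x) ≠ l) ∧ ∀ u, b (g u) ≠ l) ∧ ∃ x, a (f x) = l} := by
    rw [Diagram.loops, h.glue_eq, numAvoid]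
    refine Nat.card_congr (Equiv.ofBijective (fun c => ⟨Quotient.lift F (fun _ _ h => h) c.1, ?_⟩)
      ⟨?_, ?_⟩)
    · obtain ⟨c, hc⟩ := c
      induction c using Quotient.inductionOn with
      | h x =>
        refine ⟨⟨fun y hy => ?_, fun u hu => ?_⟩, ?_⟩
        · exact hc (Sum.inl y) ⟨Sum.inl y, rfl⟩ (Quotient.sound hy)
        · exact hc (Sum.inr (Sum.inr u)) ⟨Sum.inr u, rfl⟩ (Quotient.sound hu)
        · rcases x with x | x | x
          · exact absurd rfl (hc (Sum.inl x) ⟨Sum.inl x, rfl⟩)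
          · exact ⟨x, rfl⟩
          · exact absurd rfl (hc (Sum.inr (Sum.inr x)) ⟨Sum.inr x, rfl⟩)
    · rintro ⟨c, hc⟩ ⟨d, hd⟩ hcd
      induction c using Quotient.inductionOn with
      | h x =>
        induction d using Quotient.inductionOn with
        | h y => exact Subtype.ext (Quotient.sound (congrArg Subtype.val hcd))
    · rintro ⟨l, ⟨hl₁, hl₂⟩, x, hx⟩
      refine ⟨⟨Quotient.mk _ (Sum.inr (Sum.inl x)), ?_⟩, Subtype.ext hx⟩
      rintro _ ⟨y | y, rfl⟩ hy
      · exact hl₁ y ((Quotient.exact hy : F _ = F _).trans hx)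
      · exact hl₂ y ((Quotient.exact hy : F _ = F _).trans hx)
  have h2 : numMissed s f = Nat.card {l : L // ((∀ x, a (s x) ≠ l) ∧ ∀ u, b (g u) ≠ l) ∧
      (∀ x, a (f x) ≠ l) ∧ ∃ j, a j = l} := by
    refine Nat.card_congr (Equiv.ofBijective (fun j => ⟨a j, ⟨⟨fun x hx => ?_, fun u hu => ?_⟩,
      fun x hx => ?_, j, rfl⟩⟩) ⟨?_, ?_⟩)
    · exact j.2.1 x (h.left_inj hx)
    · obtain ⟨t₀, ht₀⟩ := h.inter _ _ hu.symm
      rw [← ht₀, ← h.comm] at hu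
      exact j.2.2 t₀ (h.left_inj hu)
    · exact j.2.2 x (h.left_inj hx)
    · intro j j' hj
      exact Subtype.ext (h.left_inj (congrArg Subtype.val hj))
    · rintro ⟨_, ⟨h3, h4⟩, h5, j, rfl⟩
      exact ⟨⟨j, fun x hx => h3 x (congrArg a hx), fun x hx => h5 x (congrArg a hx)⟩, rfl⟩
  have h3 : numMissed t g = Nat.card {l : L // ((∀ x, a (s x) ≠ l) ∧ ∀ u, b (g u) ≠ l) ∧
      (∀ x, a (f x) ≠ l) ∧ ¬ ∃ j, a j = l} := by
    refine Nat.card_congr (Equiv.ofBijective (fun y => ⟨b y, ⟨⟨fun x hx => ?_, fun u hu => ?_⟩,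
      fun x hx => ?_, fun ⟨j, hj⟩ => ?_⟩⟩) ⟨?_, ?_⟩)
    · obtain ⟨t₀, ht₀⟩ := h.inter _ _ hx
      exact y.2.1 t₀ ht₀
    · rcases h.right_inj _ _ hu with h4 | ⟨-, t₀, ht₀⟩
      · exact y.2.2 u h4
      · exact y.2.1 t₀ ht₀
    · obtain ⟨t₀, ht₀⟩ := h.inter _ _ hx
      exact y.2.1 t₀ ht₀
    · obtain ⟨t₀, ht₀⟩ := h.inter _ _ hj
      exact y.2.1 t₀ ht₀
    · intro y y' hy
      rcases h.right_inj _ _ (congrArg Subtype.val hy) with h4 | ⟨⟨t₀, ht₀⟩, -⟩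
      · exact Subtype.ext h4
      · exact absurd ht₀ (y.2.1 t₀)
    · rintro ⟨l, ⟨h3, h4⟩, h5, h6⟩
      obtain ⟨y, rfl⟩ := (h.union l).resolve_left h6
      refine ⟨⟨y, fun x hx => h6 ⟨f x, ?_⟩, fun x hx => h4 x (congrArg b hx)⟩, rfl⟩
      rw [h.comm, hx]
  rw [h1, h2, h3, numMissed, ← Nat.card_sum, ← Nat.card_sum]
  let P : L → Prop := fun l => (∀ x, a (s x) ≠ l) ∧ ∀ u, b (g u) ≠ l
  let Q : L → Prop := fun l => ∀ x, a (f x) ≠ l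
  let R : L → Prop := fun l => ∃ j, a j = l
  -- The trichotomy: `Q` says that no middle vertex hits the point, and `R` that the point comes
  -- from `J`.
  have e : {l // P l} ≃ ({l // P l ∧ Q l ∧ R l} ⊕ {l // P l ∧ Q l ∧ ¬ R l}) ⊕
      {l // P l ∧ ∃ x, a (f x) = l} :=
    { toFun := fun l => if hq : Q l then if hr : R l then Sum.inl (Sum.inl ⟨l, l.2, hq, hr⟩)
        else Sum.inl (Sum.inr ⟨l, l.2, hq, hr⟩) else Sum.inr ⟨l, l.2, by simpa [Q] using hq⟩
      invFun := Sum.elim (Sum.elim (fun l => ⟨l, l.2.1⟩) fun l => ⟨l, l.2.1⟩) fun l => ⟨l, l.2.1⟩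
      left_inv := by
        rintro ⟨l, hl⟩
        dsimp only
        split_ifs <;> rfl
      right_inv := by
        rintro ((⟨l, hl⟩ | ⟨l, hl⟩) | ⟨l, hl⟩)
        · exact (dif_pos hl.2.1).trans (dif_pos hl.2.2)
        · exact (dif_pos hl.2.1).trans (dif_neg hl.2.2)
        · have hq : ¬ Q l := fun hq => hl.2.elim hq
          exact dif_neg hq }
  exact Nat.card_congr e

/-- Here the convention that an empty part counts as `δ` pays off: loops become empty parts, and
composition is gluing without a correction factor. -/
theorem cospanHom_comp {S T U J K L : Type} [Finite S] [Finite T] [Finite U] [Finite J] [Finite K]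
    [Finite L] {s : S → J} {f : T → J} {t : T → K} {g : U → K} {a : J → L} {b : K → L}
    (h : IsCospanGlue s f t g a b) (hs : s.Injective) (ht : t.Injective) :
    cospanHom δ s hs f ≫ cospanHom δ t ht g =
      cospanHom δ (a ∘ s) (h.left_inj.comp hs) (b ∘ g) := by
  rw [cospanHom, cospanHom, Linear.smul_comp, Linear.comp_smul, ofDiagram_comp, smul_smul,
    smul_smul, ← pow_add, ← pow_add]
  refine smul_ofDiagram_congr (h.comp_eq) _ _ ?_
  rw [h.numMissed_eq, add_assoc]

end Cospan

/-! ### Hook morphisms and their relations -/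

section Hook

open scoped Classical

variable {k : Type u} [CommRing k] {δ : k}

/-- The parts of the diagram of an injection `p : X → Y ⊔ {none}`, which joins `none` to the points
of `Y` that are not in the image of `p`. -/
def HookPart {X Y : Type} (p : X → Option Y) : Type := {o : Option Y // o = none ∨ ∃ x, p x = o}

instance {X Y : Type} [Finite Y] (p : X → Option Y) : Finite (HookPart p) :=
  inferInstanceAs (Finite {o : Option Y // o = none ∨ ∃ x, p x = o})

def hookIn {X Y : Type} (p : X → Option Y) (x : X) : HookPart p := ⟨p x, Or.inr ⟨x, rfl⟩⟩

theorem hookIn_injective {X Y : Type} {p : X → Option Y} (hp : p.Injective) :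
    (hookIn p).Injective := fun _ _ h => hp (congrArg Subtype.val h)

noncomputable def hookOut {X Y : Type} (p : X → Option Y) (y : Y) : HookPart p :=
  ⟨if ∃ x, p x = some y then some y else none, by
    split_ifs with h
    · exact Or.inr h
    · exact Or.inl rfl⟩

theorem hookOut_of_mem {X Y : Type} {p : X → Option Y} {y : Y} {x : X} (h : p x = some y) :
    hookOut p y = hookIn p x :=
  Subtype.ext ((if_pos ⟨x, h⟩).trans h.symm)

theorem hookOut_of_notMem {X Y : Type} {p : X → Option Y} {y : Y} (h : ¬ ∃ x, p x = some y) :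
    hookOut p y = ⟨none, Or.inl rfl⟩ := Subtype.ext (if_neg h)

/-- The morphism of an injection `p : X → Y ⊔ {none}`. -/
noncomputable def hookHom (δ : k) {X Y : Type} [Finite X] [Finite Y] (p : X → Option Y)
    (hp : p.Injective) : (ResPartitionCat.of X : ResPartitionCat k δ) ⟶ .of Y :=
  cospanHom δ (hookIn p) (hookIn_injective hp) (hookOut p)

theorem cospanHom_congr {S T J J' : Type} [Finite S] [Finite T] (σ : J ≃ J') {s : S → J} {f : T → J}
    {s' : S → J'} {f' : T → J'} (hs : s.Injective) (hs' : s'.Injective) (h₁ : ∀ a, s' a = σ (s a))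
    (h₂ : ∀ x, f' x = σ (f x)) : cospanHom δ s hs f = cospanHom δ s' hs' f' := by
  obtain rfl : s' = σ ∘ s := funext h₁
  obtain rfl : f' = σ ∘ f := funext h₂
  refine smul_ofDiagram_congr ?_ _ _ (Nat.card_congr (σ.subtypeEquiv fun j => ?_))
  · ext (x | x) (y | y) <;> exact σ.injective.eq_iff.symm
  · simp

/-- The point `y₀` belongs to the hook of `p`, because it is outside the image of `p`, and to the
hook of `q`, because `q` sends it to `none`. So the two hooks become a single part of the composite.
-/
theorem hookHom_merge {C Y Z : Type} [Finite C] [Finite Y] [Finite Z] {p : C → Option Y}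
    {q : Y → Option Z} {r : C → Option Z} (hp : p.Injective) (hq : q.Injective) (hr : r.Injective)
    (h : IsHookMerge p q r) : hookHom δ p hp ≫ hookHom δ q hq = hookHom δ r hr := by
  obtain ⟨y₀, hq₀, hp₀⟩ := h.exists_new
  let a : HookPart p → HookPart r := fun o => ⟨o.1.bind q, by
    obtain ⟨o, rfl | ⟨x, rfl⟩⟩ := o
    · exact Or.inl rfl
    · exact Or.inr ⟨x, h.eq_bind x⟩⟩
  -- The parts of the second diagram that are not reached from `C` are attached to the hook of `p`,
  -- and so they all end up in the merged part `none`.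
  let b : HookPart q → HookPart r := fun o => ⟨if ∃ x, r x = o.1 then o.1 else none, by
    split_ifs with h
    · exact Or.inr h
    · exact Or.inl rfl⟩
  have hb₁ : ∀ o, (∃ x, r x = o.1) → (b o).1 = o.1 := fun o ho => if_pos ho
  have hb₀ : ∀ o, (¬ ∃ x, r x = o.1) → (b o).1 = none := fun o ho => if_neg ho
  -- As `q` takes the value `none` at `y₀`, every part of the second diagram contains a middle
  -- vertex. This makes the conditions `right_inj` and `inter` automatic.
  have hmem : ∀ o : HookPart q, o ∈ Set.range (hookIn q) := by
    rintro ⟨o, rfl | ⟨y, rfl⟩⟩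
    · exact ⟨y₀, Subtype.ext hq₀⟩
    · exact ⟨y, rfl⟩
  have hglue : IsCospanGlue (hookIn p) (hookOut p) (hookIn q) (hookOut q) a b := by
    refine ⟨fun y => ?_, ?_, fun o o' _ => Or.inr ⟨hmem o, hmem o'⟩, fun _ o _ => hmem o, ?_⟩
    · refine Subtype.ext ?_
      by_cases hy : ∃ x, p x = some y
      · obtain ⟨x, hx⟩ := hy
        have hrx : r x = q y := by rw [h.eq_bind, hx]; rfl
        rw [hookOut_of_mem hx, hb₁ _ ⟨x, hrx⟩]
        change (p x).bind q = q y
        rw [hx]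
        rfl
      · rw [hookOut_of_notMem hy]
        by_cases hr' : ∃ x, r x = q y
        · rw [hb₁ _ hr']
          obtain ⟨x, hx⟩ := hr'
          rw [h.eq_bind] at hx
          change none = q y
          rcases hpx : p x with _ | y'
          · rw [← hx, hpx]; rfl
          · rw [hpx] at hx
            exact absurd ⟨x, hpx.trans (congrArg some (hq hx))⟩ hy
        · rw [hb₀ _ hr']
          rfl
    · have hne : ∀ x y, p x = some y → q y ≠ none := fun x y hx hy =>
        hp₀ x (hx.trans (congrArg some (hq (hy.trans hq₀.symm))))
      rintro ⟨_ | y, ho⟩ ⟨_ | y', ho'⟩ hoo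
      · rfl
      · obtain ⟨x, hx⟩ := ho'.resolve_left (Option.some_ne_none _)
        exact absurd (congrArg Subtype.val hoo).symm (hne x y' hx)
      · obtain ⟨x, hx⟩ := ho.resolve_left (Option.some_ne_none _)
        exact absurd (congrArg Subtype.val hoo) (hne x y hx)
      · exact Subtype.ext (congrArg some (hq (congrArg Subtype.val hoo)))
    · rintro ⟨o, rfl | ⟨x, rfl⟩⟩
      · exact Or.inl ⟨⟨none, Or.inl rfl⟩, rfl⟩
      · exact Or.inl ⟨hookIn p x, Subtype.ext (h.eq_bind x).symm⟩
  refine (cospanHom_comp hglue _ _).trans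
    (cospanHom_congr (Equiv.refl _) _ _ (fun x => Subtype.ext (h.eq_bind x)) fun z => ?_)
  refine Subtype.ext ?_
  change _ = (b (hookOut q z)).1
  by_cases hz : ∃ x, r x = some z
  · obtain ⟨x, hx⟩ := hz
    obtain ⟨y, -, hy⟩ := Option.bind_eq_some_iff.1 ((h.eq_bind x).symm.trans hx)
    rw [hookOut_of_mem hx, hookOut_of_mem hy, hb₁ _ ⟨x, hx.trans hy.symm⟩]
    exact hx.trans hy.symm
  · rw [hookOut_of_notMem hz]
    by_cases hy : ∃ y, q y = some z
    · obtain ⟨y, hy⟩ := hy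
      rw [hookOut_of_mem hy, hb₀]
      rintro ⟨x, hx⟩
      exact hz ⟨x, hx.trans hy⟩
    · rw [hookOut_of_notMem hy]
      exact (ite_self none).symm

/-- The parts of the diagram of two successive injections that remove different points. -/
def SquarePart {C Y Z : Type} (p : C → Option Y) (q : Y → Option Z) : Type :=
  {o : Option (Option Z) // (o = none ∨ o = some none) ∨ ∃ x, optionSwap Z ((p x).map q) = o}

instance {C Y Z : Type} [Finite Z] (p : C → Option Y) (q : Y → Option Z) :
    Finite (SquarePart p q) :=
  inferInstanceAs (Finite {o : Option (Option Z) //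
    (o = none ∨ o = some none) ∨ ∃ x, optionSwap Z ((p x).map q) = o})

def squareIn {C Y Z : Type} (p : C → Option Y) (q : Y → Option Z) (x : C) : SquarePart p q :=
  ⟨optionSwap Z ((p x).map q), Or.inr ⟨x, rfl⟩⟩

theorem squareIn_injective {C Y Z : Type} {p : C → Option Y} {q : Y → Option Z} (hp : p.Injective)
    (hq : q.Injective) : (squareIn p q).Injective := fun _ _ h =>
  hp (Option.map_injective hq ((optionSwap Z).injective (congrArg Subtype.val h)))

/-- The label `none` stands for the hook of `q` and `some none` for the hook of `p`. A point outside
the image of `q` belongs to the former, and a point that comes from `Y` but not from `C` belongs to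
the latter. -/
noncomputable def squareOut {C Y Z : Type} (p : C → Option Y) (q : Y → Option Z) (z : Z) :
    SquarePart p q :=
  ⟨if ∃ x, (p x).map q = some (some z) then some (some z)
    else if ∃ y, q y = some z then some none else none, by
    split_ifs with h
    · exact Or.inr (h.imp fun _ hx => optionSwap_eq_some_some.2 hx)
    · exact Or.inl (Or.inr rfl)
    · exact Or.inl (Or.inl rfl)⟩

/-- The source point of the second hook, if any, is in the image of `p`, hence not in the hook of
`p`. So the two hooks remain different parts of the composite. -/
theorem hookHom_comp_eq {C Y Z : Type} [Finite C] [Finite Y] [Finite Z] {p : C → Option Y}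
    {q : Y → Option Z} (hp : p.Injective) (hq : q.Injective)
    (h : ∀ y, q y = none → ∃ x, p x = some y) : hookHom δ p hp ≫ hookHom δ q hq =
      cospanHom δ (squareIn p q) (squareIn_injective hp hq) (squareOut p q) := by
  let a : HookPart p → SquarePart p q := fun o => ⟨optionSwap Z (o.1.map q), by
    obtain ⟨o, rfl | ⟨x, rfl⟩⟩ := o
    · exact Or.inl (Or.inr rfl)
    · exact Or.inr ⟨x, rfl⟩⟩
  let b : HookPart q → SquarePart p q := fun o =>
    ⟨o.1.elim none fun z => if ∃ x, (p x).map q = some (some z) then some (some z) else some none, by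
      rcases o.1 with _ | z
      · exact Or.inl (Or.inl rfl)
      · rw [Option.elim_some]
        split_ifs with h
        · exact Or.inr (h.imp fun _ hx => optionSwap_eq_some_some.2 hx)
        · exact Or.inl (Or.inr rfl)⟩
  have hb : ∀ o, o.1 = none → (b o).1 = none := fun o ho => by
    change o.1.elim _ _ = _
    rw [ho]; rfl
  have hb₁ : ∀ o z, o.1 = some z → (∃ x, (p x).map q = some (some z)) → (b o).1 = some (some z) :=
    fun o z ho hz => by
      change o.1.elim _ _ = _
      rw [ho, Option.elim_some, if_pos hz]
  have hb₀ : ∀ o z, o.1 = some z → (¬ ∃ x, (p x).map q = some (some z)) → (b o).1 = some none :=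
    fun o z ho hz => by
      change o.1.elim _ _ = _
      rw [ho, Option.elim_some, if_neg hz]
  have hbn : ∀ o, (b o).1 = none → o.1 = none := fun o ho => by
    rcases hz : o.1 with _ | z
    · rfl
    · by_cases hx : ∃ x, (p x).map q = some (some z)
      · rw [hb₁ o z hz hx] at ho
        exact absurd ho (Option.some_ne_none _)
      · rw [hb₀ o z hz hx] at ho
        exact absurd ho (Option.some_ne_none _)
  have hmem : ∀ o : HookPart q, o.1 ≠ none → o ∈ Set.range (hookIn q) := by
    rintro ⟨o, rfl | ⟨y, rfl⟩⟩ ho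
    · exact absurd rfl ho
    · exact ⟨y, rfl⟩
  have hglue : IsCospanGlue (hookIn p) (hookOut p) (hookIn q) (hookOut q) a b := by
    refine ⟨fun y => ?_, ?_, fun o o' hoo => ?_, fun o o' hoo => ?_, ?_⟩
    · refine Subtype.ext ?_
      by_cases hy : ∃ x, p x = some y
      · obtain ⟨x, hx⟩ := hy
        rw [hookOut_of_mem hx]
        change optionSwap Z ((p x).map q) = _
        rw [hx, Option.map_some]
        rcases hz : q y with _ | z
        · rw [hb _ hz]; rfl
        · rw [hb₁ _ z hz ⟨x, by rw [hx, Option.map_some, hz]⟩]; rfl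
      · rw [hookOut_of_notMem hy]
        rcases hz : q y with _ | z
        · exact absurd (h y hz) hy
        · rw [hb₀ _ z hz]
          · rfl
          · rintro ⟨x, hx⟩
            obtain ⟨y', hy', hqy'⟩ := Option.map_eq_some_iff.1 hx
            rw [hq (hqy'.trans hz.symm)] at hy'
            exact hy ⟨x, hy'⟩
    · intro o o' hoo
      exact Subtype.ext (Option.map_injective hq ((optionSwap Z).injective
        (congrArg Subtype.val hoo)))
    · by_cases ho : o.1 = none
      · have h1 := hbn o' ((congrArg Subtype.val hoo).symm.trans (hb o ho))
        exact Or.inl (Subtype.ext (ho.trans h1.symm))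
      · by_cases ho' : o'.1 = none
        · exact absurd (hbn o ((congrArg Subtype.val hoo).trans (hb o' ho'))) ho
        · exact Or.inr ⟨hmem o ho, hmem o' ho'⟩
    · by_cases ho' : o'.1 = none
      · have h1 : optionSwap Z (o.1.map q) = none := (congrArg Subtype.val hoo).trans (hb o' ho')
        rw [optionSwap_eq_none] at h1
        obtain ⟨y, -, hy⟩ := Option.map_eq_some_iff.1 h1
        exact ⟨y, Subtype.ext (hy.trans ho'.symm)⟩
      · exact hmem o' ho'
    · rintro ⟨o, (rfl | rfl) | ⟨x, rfl⟩⟩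
      · exact Or.inr ⟨⟨none, Or.inl rfl⟩, rfl⟩
      · exact Or.inl ⟨⟨none, Or.inl rfl⟩, rfl⟩
      · exact Or.inl ⟨hookIn p x, rfl⟩
  refine (cospanHom_comp hglue _ _).trans
    (cospanHom_congr (Equiv.refl _) _ _ (fun x => rfl) fun z => ?_)
  refine Subtype.ext ?_
  change _ = (b (hookOut q z)).1
  by_cases hz : ∃ x, (p x).map q = some (some z)
  · obtain ⟨x, hx⟩ := hz
    obtain ⟨y, -, hy⟩ := Option.map_eq_some_iff.1 hx
    rw [hookOut_of_mem hy, hb₁ _ z hy ⟨x, hx⟩]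
    exact if_pos ⟨x, hx⟩
  · refine (if_neg hz).trans ?_
    by_cases hy : ∃ y, q y = some z
    · rw [if_pos hy]
      obtain ⟨y, hy⟩ := hy
      rw [hookOut_of_mem hy, hb₀ _ z hy hz]
    · rw [if_neg hy, hookOut_of_notMem hy]
      rfl

/-- Both composites have the images of `C` and two hooks as parts, and the exchange of base points
matches the labels. The points of `Z` that do not come from `C` go to corresponding hooks: `inter`
shows that such a point is not reached in both orders, and `union` that it is reached in one. -/
theorem hookHom_comm {C Y Y' Z : Type} [Finite C] [Finite Y] [Finite Y'] [Finite Z]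
    {p : C → Option Y} {q : Y → Option Z} {q' : C → Option Y'} {p' : Y' → Option Z}
    (hp : p.Injective) (hq : q.Injective) (hq' : q'.Injective) (hp' : p'.Injective)
    (h : IsHookSquare p q q' p') :
    hookHom δ p hp ≫ hookHom δ q hq = hookHom δ q' hq' ≫ hookHom δ p' hp' := by
  rw [hookHom_comp_eq hp hq h.mem, hookHom_comp_eq hq' hp' h.mem']
  let σ : SquarePart p q ≃ SquarePart q' p' := (optionSwap Z).subtypeEquiv fun o => by
    refine or_congr ?_ (exists_congr fun x => ?_)
    · rw [optionSwap_eq_none, optionSwap_eq_some_none, or_comm]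
    · rw [(optionSwap Z).apply_eq_iff_eq, h.comm]
  refine cospanHom_congr σ _ _ (fun x => Subtype.ext ?_) fun z => Subtype.ext ?_
  · change optionSwap Z ((q' x).map p') = optionSwap Z (optionSwap Z ((p x).map q))
    rw [h.comm]
  · have hiff : (∃ x, (q' x).map p' = some (some z)) ↔ ∃ x, (p x).map q = some (some z) :=
      exists_congr fun x => by rw [← h.comm, optionSwap_eq_some_some]
    change (if _ then _ else _) = optionSwap Z (if _ then _ else _)
    rw [apply_ite (optionSwap Z), hiff]
    refine ite_congr rfl (fun _ => rfl) fun hz => ?_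
    by_cases hy : ∃ y, q y = some z
    · rw [if_pos hy, if_neg]
      · rfl
      · rintro ⟨y', hy'⟩
        obtain ⟨y, hy⟩ := hy
        obtain ⟨x, hx⟩ := h.inter y y' z hy hy'
        exact hz ⟨x, by rw [hx, Option.map_some, hy]⟩
    · rw [if_neg hy, if_pos ((h.union z).resolve_left hy)]
      rfl

/-! ### Generation of the restricted partition category -/

/-- The set obtained from the source of a map `f : X → J` by replacing the fiber over `z` by the
fiber of `s : S → J`. -/
def ReplaceFiber {S X J : Type} (s : S → J) (f : X → J) (z : J) : Type :=
  {x : X // f x ≠ z} ⊕ {a : S // s a = z}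

instance {S X J : Type} [Finite S] [Finite X] (s : S → J) (f : X → J) (z : J) :
    Finite (ReplaceFiber s f z) :=
  inferInstanceAs (Finite ({x : X // f x ≠ z} ⊕ {a : S // s a = z}))

def replaceMap {S X J : Type} (s : S → J) (f : X → J) (z : J) : ReplaceFiber s f z → J :=
  Sum.elim (fun x => f x) fun a => s a

/-- The hook that restores the replaced fiber: it joins the fiber of `s` over `z`, at most one point
when `s` is injective, to the points of `X` over `z`. -/
def replaceHook {S X J : Type} (s : S → J) (f : X → J) (z : J) : ReplaceFiber s f z → Option X :=
  Sum.elim (fun x => some x) fun _ => none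

theorem replaceHook_injective {S X J : Type} {s : S → J} (hs : s.Injective) (f : X → J) (z : J) :
    (replaceHook s f z).Injective := by
  rintro (x | a) (y | b) h
  · exact congrArg Sum.inl (Subtype.ext (Option.some.inj h))
  · exact absurd h (Option.some_ne_none _)
  · exact absurd h.symm (Option.some_ne_none _)
  · exact congrArg Sum.inr (Subtype.ext (hs (a.2.trans b.2.symm)))

theorem exists_replaceHook {S X J : Type} {s : S → J} {f : X → J} {z : J} {x : X} :
    (∃ u, replaceHook s f z u = some x) ↔ f x ≠ z := by
  constructor
  · rintro ⟨y | a, h⟩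
    · rw [← Option.some.inj h]
      exact y.2
    · exact absurd h.symm (Option.some_ne_none _)
  · exact fun h => ⟨Sum.inl ⟨x, h⟩, rfl⟩

/-- The fibers of `f` over the points that are not in the list `l` are those of `s`. -/
structure AgreesOff {S X J : Type} (l : List J) (s : S → J) (f : X → J) : Prop where
  exists_left : ∀ x, f x ∉ l → ∃ a, s a = f x
  exists_right : ∀ a, s a ∉ l → ∃ x, f x = s a
  inj : ∀ x y, f x ∉ l → f x = f y → x = y

/-- After the replacement the fiber over `z` is that of `s`, so `z` no longer needs to be an
exception. -/
theorem AgreesOff.replace {S X J : Type} {l : List J} {z : J} {s : S → J} {f : X → J}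
    (hs : s.Injective) (h : AgreesOff (z :: l) s f) : AgreesOff l s (replaceMap s f z) where
  exists_left := by
    rintro (x | a) hx
    · exact h.exists_left x fun hx' => (List.mem_cons.1 hx').elim x.2 hx
    · exact ⟨a, rfl⟩
  exists_right a ha := by
    by_cases haz : s a = z
    · exact ⟨Sum.inr ⟨a, haz⟩, rfl⟩
    · obtain ⟨x, hx⟩ := h.exists_right a fun ha' => (List.mem_cons.1 ha').elim haz ha
      exact ⟨Sum.inl ⟨x, fun hxz => haz (hx.symm.trans hxz)⟩, hx⟩
  inj := by
    rintro (x | a) (y | b) hx hxy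
    · exact congrArg Sum.inl (Subtype.ext (h.inj x y
        (fun hx' => (List.mem_cons.1 hx').elim x.2 hx) hxy))
    · exact absurd (Eq.trans hxy b.2) x.2
    · exact absurd (Eq.trans hxy.symm a.2) y.2
    · exact congrArg Sum.inr (Subtype.ext (hs hxy))

/-- The points of `J` that are in the image of `s` or in the list `l`. -/
def ListPart {S J : Type} (l : List J) (s : S → J) : Type := {j : J // (∃ a, s a = j) ∨ j ∈ l}

instance {S J : Type} [Finite J] (l : List J) (s : S → J) : Finite (ListPart l s) :=
  inferInstanceAs (Finite {j : J // (∃ a, s a = j) ∨ j ∈ l})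

def listIn {S J : Type} (l : List J) (s : S → J) (a : S) : ListPart l s := ⟨s a, Or.inl ⟨a, rfl⟩⟩

theorem listIn_injective {S J : Type} (l : List J) {s : S → J} (hs : s.Injective) :
    (listIn l s).Injective := fun _ _ h => hs (congrArg Subtype.val h)

def AgreesOff.out {S X J : Type} {l : List J} {s : S → J} {f : X → J} (h : AgreesOff l s f)
    (x : X) : ListPart l s := ⟨f x, or_iff_not_imp_right.2 (h.exists_left x)⟩

/-- Splits off the part of `z` as a last hook. As `z ∉ l`, the intermediate cospan contains `z` only
if it is in the image of `s`. Thus an empty part over `z` is counted once, by the factor `δ` of the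
hook. -/
theorem cospanHom_cons {S X J : Type} [Finite S] [Finite X] [Finite J] {l : List J} {z : J}
    {s : S → J} {f : X → J} (hs : s.Injective) (hz : z ∉ l) (h : AgreesOff (z :: l) s f) :
    cospanHom δ (listIn (z :: l) s) (listIn_injective _ hs) h.out =
      cospanHom δ (listIn l s) (listIn_injective _ hs) (h.replace hs).out ≫
        hookHom δ (replaceHook s f z) (replaceHook_injective hs f z) := by
  let a : ListPart l s → ListPart (z :: l) s :=
    fun j => ⟨j.1, j.2.imp_right (List.mem_cons_of_mem z)⟩
  let b : HookPart (replaceHook s f z) → ListPart (z :: l) s := fun o =>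
    o.1.elim ⟨z, Or.inr List.mem_cons_self⟩ h.out
  have hout : ∀ (o : HookPart (replaceHook s f z)) x, o.1 = some x → f x ≠ z := fun o x ho => by
    obtain ⟨o, rfl | ⟨u, rfl⟩⟩ := o
    · exact absurd ho.symm (Option.some_ne_none _)
    · exact exists_replaceHook.1 ⟨u, ho⟩
  have hbz : ∀ o, (b o).1 = z → o.1 = none := fun o ho => by
    rcases hx : o.1 with _ | x
    · rfl
    · refine absurd ?_ (hout o x hx)
      rw [← ho]
      change _ = (o.1.elim _ h.out).1
      rw [hx]
      rfl
  have hmem : ∀ o : HookPart (replaceHook s f z), o.1 ≠ none →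
      o ∈ Set.range (hookIn (replaceHook s f z)) := by
    rintro ⟨o, rfl | ⟨u, rfl⟩⟩ ho
    · exact absurd rfl ho
    · exact ⟨u, rfl⟩
  have hglue : IsCospanGlue (listIn l s) (h.replace hs).out (hookIn (replaceHook s f z))
      (hookOut (replaceHook s f z)) a b := by
    refine ⟨?_, fun j j' hj => ?_, fun o o' hoo => ?_,
      fun j o hjo => ?_, ?_⟩
    · rintro (x | c)
      · rfl
      · exact Subtype.ext c.2
    · have h1 := congrArg Subtype.val hj
      exact Subtype.ext h1
    · by_cases ho : o.1 = none
      · refine Or.inl (Subtype.ext (ho.trans (hbz o' ?_).symm))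
        rw [← hoo]
        change (o.1.elim _ h.out).1 = z
        rw [ho]
        rfl
      · by_cases ho' : o'.1 = none
        · refine absurd (hbz o ?_) ho
          rw [hoo]
          change (o'.1.elim _ h.out).1 = z
          rw [ho']
          rfl
        · exact Or.inr ⟨hmem o ho, hmem o' ho'⟩
    · by_cases ho : o.1 = none
      · have h1 : j.1 = z := by
          refine (congrArg Subtype.val hjo).trans ?_
          change (o.1.elim _ h.out).1 = z
          rw [ho]
          rfl
        obtain ⟨c, hc⟩ := j.2.resolve_right (h1 ▸ hz)
        exact ⟨Sum.inr ⟨c, hc.trans h1⟩, Subtype.ext ho.symm⟩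
      · exact hmem o ho
    · rintro ⟨j, hj⟩
      by_cases hjz : j = z
      · subst hjz
        exact Or.inr ⟨⟨none, Or.inl rfl⟩, rfl⟩
      · exact Or.inl ⟨⟨j, hj.imp_right fun hj' => (List.mem_cons.1 hj').resolve_left hjz⟩, rfl⟩
  refine Eq.symm ((cospanHom_comp hglue _ _).trans
    (cospanHom_congr (Equiv.refl _) _ _ (fun x => rfl) fun x => ?_))
  change _ = b (hookOut _ x)
  by_cases hx : f x = z
  · rw [hookOut_of_notMem (fun h' => exists_replaceHook.1 h' hx)]
    exact Subtype.ext hx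
  · rw [hookOut_of_mem (p := replaceHook s f z) (x := Sum.inl ⟨x, hx⟩) rfl]
    rfl

/-- With no exceptions left, every fiber of `f` is a single point, and its part contains exactly one
point of `S`. The diagram is therefore a bijection. -/
theorem cospanHom_nil {S X J : Type} [Finite S] [Finite X] [Finite J] {s : S → J} {f : X → J}
    (hs : s.Injective) (h : AgreesOff [] s f) : ∃ e : S ≃ X,
    cospanHom δ (listIn [] s) (listIn_injective _ hs) h.out =
      ResPartitionCat.ofDiagram k δ (S := .of S) (T := .of X) (Diagram.ofEquiv e)
        (Diagram.isRestricted_ofEquiv e) := by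
  choose e he using fun a => h.exists_right a List.not_mem_nil
  have hbij : Function.Bijective e := by
    constructor
    · intro a b hab
      exact hs (by rw [← he, ← he, hab])
    · intro x
      obtain ⟨a, ha⟩ := h.exists_left x List.not_mem_nil
      exact ⟨a, h.inj _ _ List.not_mem_nil ((he a).trans ha)⟩
  refine ⟨Equiv.ofBijective e hbij, ?_⟩
  have h1 : numMissed (listIn [] s) h.out = 0 := by
    have : IsEmpty {j : ListPart [] s // (∀ a, listIn [] s a ≠ j) ∧ ∀ x, h.out x ≠ j} := by
      refine ⟨?_⟩
      rintro ⟨⟨j, ⟨a, rfl⟩ | hj⟩, h1, -⟩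
      · exact h1 a rfl
      · exact List.not_mem_nil hj
    exact Nat.card_of_isEmpty
  have h2 : kerDiagram (listIn [] s) h.out = Diagram.ofEquiv (Equiv.ofBijective e hbij) := by
    have h3 : ∀ x : S ⊕ X, (Sum.elim (listIn [] s) h.out x).1 = f (Sum.elim e id x) := by
      rintro (a | x)
      · exact (he a).symm
      · rfl
    ext x y
    change Sum.elim (listIn [] s) h.out x = Sum.elim (listIn [] s) h.out y ↔
      Sum.elim e id x = Sum.elim e id y
    constructor
    · intro hxy
      refine h.inj _ _ List.not_mem_nil ?_
      rw [← h3, ← h3, hxy]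
    · intro hxy
      refine Subtype.ext ?_
      rw [h3, h3, hxy]
  refine (smul_ofDiagram_congr h2 _ (Diagram.isRestricted_ofEquiv _) h1).trans ?_
  rw [pow_zero, one_smul]

theorem numMissed_quotient {S T : Type} (ρ : Diagram S T) :
    numMissed (fun a => Quotient.mk ρ (Sum.inl a)) (fun x => Quotient.mk ρ (Sum.inr x)) = 0 := by
  have : IsEmpty {j : Quotient ρ // (∀ a, Quotient.mk ρ (Sum.inl a) ≠ j) ∧
      ∀ x, Quotient.mk ρ (Sum.inr x) ≠ j} := by
    refine ⟨?_⟩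
    rintro ⟨j, h1, h2⟩
    induction j using Quotient.inductionOn with
    | h x =>
      rcases x with a | x
      · exact h1 a rfl
      · exact h2 x rfl
  exact Nat.card_of_isEmpty

theorem ker_quotient {S T : Type} (ρ : Diagram S T) :
    kerDiagram (fun a => Quotient.mk ρ (Sum.inl a)) (fun x => Quotient.mk ρ (Sum.inr x)) = ρ := by
  have h3 : ∀ x : S ⊕ T, Sum.elim (fun a => Quotient.mk ρ (Sum.inl a))
      (fun x => Quotient.mk ρ (Sum.inr x)) x = Quotient.mk ρ x := by
    rintro (a | x) <;> rfl
  ext x y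
  change Sum.elim _ _ x = Sum.elim _ _ y ↔ _
  rw [h3, h3]
  exact Quotient.eq

theorem IsRestricted_iff_injective {S T : Type} (ρ : Diagram S T) :
    ρ.IsRestricted ↔ Function.Injective fun a => Quotient.mk ρ (Sum.inl a) :=
  forall₂_congr fun _ _ => by rw [Quotient.eq]

/-- The cospan of a diagram over its set of parts has no empty part, so no power of `δ` appears. -/
theorem ofDiagram_eq_cospanHom {S T : Type} [Finite S] [Finite T] (ρ : Diagram S T)
    (hρ : ρ.IsRestricted) :
    ResPartitionCat.ofDiagram k δ (S := .of S) (T := .of T) ρ hρ =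
      cospanHom δ (fun a => Quotient.mk ρ (Sum.inl a)) ((IsRestricted_iff_injective ρ).1 hρ)
        fun x => Quotient.mk ρ (Sum.inr x) := by
  refine Eq.trans ?_ (smul_ofDiagram_congr (ker_quotient ρ) _ hρ (numMissed_quotient ρ)).symm
  rw [pow_zero, one_smul]

theorem hom_induction_ofDiagram {S T : Type} [Finite S] [Finite T]
    (P : ((ResPartitionCat.of S : ResPartitionCat k δ) ⟶ .of T) → Prop) (zero : P 0)
    (add : ∀ f g, P f → P g → P (f + g)) (smul : ∀ (c : k) f, P f → P (c • f))
    (ofDiagram : ∀ ρ hρ, P (ResPartitionCat.ofDiagram k δ (S := .of S) (T := .of T) ρ hρ))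
    (f : (ResPartitionCat.of S : ResPartitionCat k δ) ⟶ .of T) : P f := by
  obtain ⟨f, hf⟩ := f
  induction hf using Submodule.span_induction with
  | zero => exact zero
  | add f g hf hg h h' => exact add ⟨f, hf⟩ ⟨g, hg⟩ h h'
  | smul c f hf h => exact smul c ⟨f, hf⟩ h
  | mem f hf =>
    obtain ⟨ρ, hρ, rfl⟩ := hf
    exact ofDiagram ρ hρ

/-- The restricted partition category is generated by the bijections and the morphisms of the
injections `X → Y ⊔ {none}`. -/
theorem hom_induction {S : Type} [Finite S]
    (P : ∀ (T : Type) [Finite T], ((ResPartitionCat.of S : ResPartitionCat k δ) ⟶ .of T) → Prop)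
    (zero : ∀ (T : Type) [Finite T], P T 0)
    (add : ∀ (T : Type) [Finite T] f g, P T f → P T g → P T (f + g))
    (smul : ∀ (T : Type) [Finite T] (c : k) f, P T f → P T (c • f))
    (ofEquiv : ∀ (T : Type) [Finite T] (e : S ≃ T), P T (ResPartitionCat.ofDiagram k δ (S := .of S)
      (T := .of T) (Diagram.ofEquiv e) (Diagram.isRestricted_ofEquiv e)))
    (comp : ∀ (T U : Type) [Finite T] [Finite U] f (p : T → Option U) (hp : p.Injective),
      P T f → P U (f ≫ hookHom δ p hp))
    (T : Type) [Finite T] (f : (ResPartitionCat.of S : ResPartitionCat k δ) ⟶ .of T) : P T f := by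
  refine hom_induction_ofDiagram (P T) (zero T) (add T) (smul T) (fun ρ hρ => ?_) f
  -- Induction on the list of parts that are still to be split off. It is applied to the list of all
  -- parts, where `AgreesOff` holds vacuously.
  have key : ∀ (J : Type) [Finite J] (s : S → J) (hs : s.Injective) (l : List J), l.Nodup →
      ∀ (X : Type) [Finite X] (f : X → J) (h : AgreesOff l s f),
        P X (cospanHom δ (listIn l s) (listIn_injective l hs) h.out) := by
    intro J _ s hs l
    induction l with
    | nil =>
      intro _ X _ f h
      obtain ⟨e, he⟩ := cospanHom_nil (δ := δ) hs h
      rw [he]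
      exact ofEquiv X e
    | cons z l ih =>
      intro hl X _ f h
      rw [cospanHom_cons hs (List.nodup_cons.1 hl).1 h]
      exact comp _ _ _ _ _ (ih (List.nodup_cons.1 hl).2 _ _ (h.replace hs))
  have hs := (IsRestricted_iff_injective ρ).1 hρ
  obtain ⟨l, hl, hmem⟩ := Finite.exists_univ_list (Quotient ρ)
  have h : AgreesOff l (fun a => Quotient.mk ρ (Sum.inl a)) fun x => Quotient.mk ρ (Sum.inr x) :=
    ⟨fun x hx => absurd (hmem _) hx, fun x hx => absurd (hmem _) hx,
      fun x _ hx => absurd (hmem _) hx⟩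
  have h1 := key _ _ hs l hl _ _ h
  rw [ofDiagram_eq_cospanHom, cospanHom_congr
    (⟨fun j => ⟨j, Or.inr (hmem j)⟩, Subtype.val, fun _ => rfl, fun _ => rfl⟩ :
      Quotient ρ ≃ ListPart l fun a => Quotient.mk ρ (Sum.inl a)) _ (listIn_injective l hs)
      (s' := listIn l _) (f' := h.out) (fun _ => rfl) fun _ => rfl]
  exact h1

end Hook

/-! ### Composites of operations along the parts of a cospan -/

section Chain

open scoped Classical

variable {k : Type u} [CommRing k] {δ : k}

/-- An `FB`-module with operations `M(X) → M(Y)` for injections `X → Y ⊔ {none}` that satisfy the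
relations between the coefficients of a `δ`-standard representation of the curried Witt algebra. -/
structure HookModule (δ : k) where
  obj : FBModule k
  op : ∀ {X Y : Type} [Finite X] [Finite Y] (p : X → Option Y),
    p.Injective → (obj.obj (.of X) →ₗ[k] obj.obj (.of Y))
  act_op : ∀ {X Y Y' : Type} [Finite X] [Finite Y] [Finite Y'] (p : X → Option Y)
    (hp : p.Injective) (h : Y ≃ Y') (p' : X → Option Y') (hp' : p'.Injective),
    (∀ x, p' x = (p x).map h) → ∀ x, obj.act h (op p hp x) = op p' hp' x
  op_act : ∀ {X X' Y : Type} [Finite X] [Finite X'] [Finite Y] (p : X' → Option Y)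
    (hp : p.Injective) (h : X ≃ X') (p' : X → Option Y) (hp' : p'.Injective),
    (∀ x, p' x = p (h x)) → ∀ x, op p hp (obj.act h x) = op p' hp' x
  isWittOp : IsWittOp (M := obj) op
  isStandardOp : IsStandardOp δ (M := obj) op

namespace HookModule

variable (W : HookModule δ) {S J : Type} [Finite S] {s : S → J} (hs : s.Injective)

/-- The composite of the operations for the points in the list `l`. -/
noncomputable def chain : ∀ (_ : List J) {X : Type} [Finite X] (_ : X → J),
    W.obj.obj (.of S) →ₗ[k] W.obj.obj (.of X)
  -- The value `0` is a default for maps `f` whose fibers do not match those of `s`. Once every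
  -- point of `J` has been processed, the fibers do match.
  | [], X, _, f => if h : ∃ e : S ≃ X, ∀ a, f (e a) = s a then W.obj.act h.choose else 0
  | z :: l, _, _, f =>
    W.op (replaceHook s f z) (replaceHook_injective hs f z) ∘ₗ chain l (replaceMap s f z)

theorem chain_cons (z : J) (l : List J) {X : Type} [Finite X] (f : X → J)
    (x : W.obj.obj (.of S)) : W.chain hs (z :: l) f x =
      W.op (replaceHook s f z) (replaceHook_injective hs f z)
        (W.chain hs l (replaceMap s f z) x) := rfl

/-- The bijection is unique, because `f` is injective when it corresponds to the injection `s`; so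
the choice in the definition is harmless. -/
theorem chain_nil {X : Type} [Finite X] (f : X → J) (e : S ≃ X) (he : ∀ a, f (e a) = s a) :
    W.chain hs [] f = W.obj.act e := by
  have h : ∃ e : S ≃ X, ∀ a, f (e a) = s a := ⟨e, he⟩
  have h1 : h.choose = e := by
    have h2 : Function.Injective f := by
      intro x y hxy
      obtain ⟨a, rfl⟩ := e.surjective x
      obtain ⟨b, rfl⟩ := e.surjective y
      rw [he, he] at hxy
      rw [hs hxy]
    ext a
    exact h2 ((h.choose_spec a).trans (he a).symm)
  rw [chain, dif_pos h, h1]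

theorem chain_nil_eq_zero {X : Type} [Finite X] (f : X → J)
    (h : ¬ ∃ e : S ≃ X, ∀ a, f (e a) = s a) : W.chain hs [] f = 0 := by
  rw [chain, dif_neg h]

theorem chain_act (l : List J) : ∀ {X X' : Type} [Finite X] [Finite X'] (f : X → J) (f' : X' → J)
    (e : X ≃ X'), (∀ x, f' (e x) = f x) → ∀ x, W.chain hs l f' x = W.obj.act e (W.chain hs l f x) := by
  induction l with
  | nil =>
    intro X X' _ _ f f' e he x
    by_cases h : ∃ e : S ≃ X, ∀ a, f (e a) = s a
    · obtain ⟨e', he'⟩ := h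
      rw [W.chain_nil hs f e' he', W.chain_nil hs f' (e'.trans e) fun a => (he _).trans (he' a),
        FBModule.act_trans]
    · rw [W.chain_nil_eq_zero hs f h, W.chain_nil_eq_zero hs f', LinearMap.zero_apply,
        LinearMap.zero_apply, map_zero]
      rintro ⟨e', he'⟩
      exact h ⟨e'.trans e.symm, fun a => by simp [← he, he']⟩
  | cons z l ih =>
    intro X X' _ _ f f' e he x
    let ε : ReplaceFiber s f z ≃ ReplaceFiber s f' z :=
      Equiv.sumCongr (e.subtypeEquiv fun x => by rw [he]) (Equiv.refl _)
    have hε : ∀ u, replaceMap s f' z (ε u) = replaceMap s f z u := by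
      rintro (u | a)
      · exact he u
      · rfl
    have hp : Function.Injective fun u => replaceHook s f' z (ε u) :=
      (replaceHook_injective hs f' z).comp ε.injective
    rw [chain_cons, chain_cons, ih (replaceMap s f z) (replaceMap s f' z) ε hε,
      W.op_act _ _ ε _ hp fun _ => rfl, W.act_op _ _ e _ hp]
    rintro (u | a) <;> rfl

/-- Hooks at different points `z`, `z'` affect disjoint fibers, so they form a hook square and the
commutation rule applies. -/
theorem chain_swap (z z' : J) (l : List J) {X : Type} [Finite X] (f : X → J)
    (x : W.obj.obj (.of S)) : W.chain hs (z :: z' :: l) f x = W.chain hs (z' :: z :: l) f x := by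
  by_cases hz : z = z'
  · rw [hz]
  -- Replacing the two fibers in either order gives the same set up to the nesting of the sums.
  let ε : ReplaceFiber s (replaceMap s f z) z' ≃ ReplaceFiber s (replaceMap s f z') z :=
    { toFun := fun
        | Sum.inl ⟨Sum.inl u, hu⟩ => Sum.inl ⟨Sum.inl ⟨u, hu⟩, u.2⟩
        | Sum.inl ⟨Sum.inr a, _⟩ => Sum.inr a
        | Sum.inr a => Sum.inl ⟨Sum.inr a, fun h => hz (h.symm.trans a.2)⟩
      invFun := fun
        | Sum.inl ⟨Sum.inl u, hu⟩ => Sum.inl ⟨Sum.inl ⟨u, hu⟩, u.2⟩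
        | Sum.inl ⟨Sum.inr a, _⟩ => Sum.inr a
        | Sum.inr a => Sum.inl ⟨Sum.inr a, fun h => hz (a.2.symm.trans h)⟩
      left_inv := by rintro (⟨u | a, h⟩ | a) <;> rfl
      right_inv := by rintro (⟨u | a, h⟩ | a) <;> rfl }
  have hε : ∀ u, replaceMap s (replaceMap s f z') z (ε u) =
      replaceMap s (replaceMap s f z) z' u := by
    rintro (⟨u | a, h⟩ | a) <;> rfl
  have hp : Function.Injective fun u => replaceHook s (replaceMap s f z') z (ε u) :=
    (replaceHook_injective hs _ z).comp ε.injective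
  rw [chain_cons, chain_cons, chain_cons, chain_cons, W.chain_act hs l _ _ ε hε,
    W.op_act _ _ ε _ hp fun _ => rfl]
  refine W.isWittOp.comm _ _ _ _ _ _ _ _ ⟨?_, ?_, ?_, ?_, ?_⟩ _
  · rintro (⟨u | a, h⟩ | a) <;> rfl
  · rintro (u | a) h
    · exact absurd h (Option.some_ne_none _)
    · exact ⟨Sum.inl ⟨Sum.inr a, fun h => hz (a.2.symm.trans h)⟩, rfl⟩
  · rintro (u | a) h
    · exact absurd h (Option.some_ne_none _)
    · exact ⟨Sum.inr a, rfl⟩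
  · rintro (u | a) (u' | a') y hy hy'
    · have hu : u'.1 = u.1 := (Option.some.inj hy').trans (Option.some.inj hy).symm
      exact ⟨Sum.inl ⟨Sum.inl u, fun h => u'.2 ((congrArg f hu).trans h)⟩, rfl⟩
    · exact absurd hy'.symm (Option.some_ne_none _)
    · exact absurd hy.symm (Option.some_ne_none _)
    · exact absurd hy.symm (Option.some_ne_none _)
  · intro y
    by_cases hy : f y = z
    · exact Or.inr ⟨Sum.inl ⟨y, fun h => hz (hy.symm.trans h)⟩, rfl⟩
    · exact Or.inl ⟨Sum.inl ⟨y, hy⟩, rfl⟩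

theorem chain_perm {l l' : List J} (h : l.Perm l') : ∀ {X : Type} [Finite X] (f : X → J)
    (x : W.obj.obj (.of S)), W.chain hs l f x = W.chain hs l' f x := by
  induction h with
  | nil => exact fun _ _ => rfl
  | cons z _ ih => exact fun f x => by rw [chain_cons, chain_cons, ih]
  | swap z z' l => exact fun f x => W.chain_swap hs z' z l f x
  | trans _ _ ih ih' => exact fun f x => (ih f x).trans (ih' f x)

theorem chain_map {J' : Type} {j : J → J'} (hj : j.Injective) (l : List J) :
    ∀ {X : Type} [Finite X] (f : X → J) (x : W.obj.obj (.of S)),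
      W.chain (hj.comp hs) (l.map j) (j ∘ f) x = W.chain hs l f x := by
  induction l with
  | nil =>
    intro X _ f x
    by_cases h : ∃ e : S ≃ X, ∀ a, f (e a) = s a
    · obtain ⟨e, he⟩ := h
      rw [W.chain_nil hs f e he]
      exact LinearMap.congr_fun (W.chain_nil (hj.comp hs) (j ∘ f) e fun a => congrArg j (he a)) x
    · rw [W.chain_nil_eq_zero hs f h]
      refine LinearMap.congr_fun (W.chain_nil_eq_zero (hj.comp hs) (j ∘ f) ?_) x
      rintro ⟨e, he⟩
      exact h ⟨e, fun a => hj (he a)⟩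
  | cons z l ih =>
    intro X _ f x
    let ε : ReplaceFiber s f z ≃ ReplaceFiber (j ∘ s) (j ∘ f) (j z) :=
      Equiv.sumCongr (Equiv.subtypeEquivRight fun x => not_congr hj.eq_iff.symm)
        (Equiv.subtypeEquivRight fun x => hj.eq_iff.symm)
    have hε : ∀ u, replaceMap (j ∘ s) (j ∘ f) (j z) (ε u) = (j ∘ replaceMap s f z) u := by
      rintro (u | a) <;> rfl
    have hp : Function.Injective fun u => replaceHook (j ∘ s) (j ∘ f) (j z) (ε u) :=
      (replaceHook_injective (hj.comp hs) _ _).comp ε.injective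
    rw [List.map_cons, chain_cons, chain_cons, W.chain_act (hj.comp hs) _ _ _ ε hε, ih,
      W.op_act _ _ ε _ hp fun _ => rfl]
    congr 2
    funext u
    rcases u with u | a <;> rfl

/-- Both fibers over `z` are empty, so the hook is a bijection that misses `none`, and the rule
`op_some` gives the factor `δ`. -/
theorem chain_cons_of_missed (z : J) (l : List J) {X : Type} [Finite X] (f : X → J)
    (hz : ∀ a, s a ≠ z) (hf : ∀ x, f x ≠ z) (x : W.obj.obj (.of S)) :
    W.chain hs (z :: l) f x = δ • W.chain hs l f x := by
  let ε : ReplaceFiber s f z ≃ X :=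
    { toFun := Sum.elim (fun u => u) fun a => absurd a.2 (hz a)
      invFun := fun y => Sum.inl ⟨y, hf y⟩
      left_inv := by
        rintro (u | a)
        · rfl
        · exact absurd a.2 (hz a)
      right_inv := fun y => rfl }
  rw [chain_cons, W.isStandardOp.op_some ε, ← W.chain_act hs l (replaceMap s f z) f ε]
  · rintro (u | a)
    · rfl
    · exact absurd a.2 (hz a)
  · rintro (u | a)
    · rfl
    · exact absurd a.2 (hz a)

theorem chain_append_of_missed (m l : List J) {X : Type} [Finite X] (f : X → J)
    (hm : ∀ z ∈ m, (∀ a, s a ≠ z) ∧ ∀ x, f x ≠ z) (x : W.obj.obj (.of S)) :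
    W.chain hs (m ++ l) f x = δ ^ m.length • W.chain hs l f x := by
  induction m with
  | nil => rw [List.length_nil, pow_zero, one_smul]; rfl
  | cons z m ih =>
    rw [List.cons_append, W.chain_cons_of_missed hs z (m ++ l) f (hm z List.mem_cons_self).1
      (hm z List.mem_cons_self).2, ih fun z hz => hm z (List.mem_cons_of_mem _ hz),
      List.length_cons, pow_succ', mul_smul]

/-- Each part is a pair `{a₀, e a₀}`. Its hook replaces the point `a₀` by `e a₀`, which is a mere
relabelling by the rule `op_none`. -/
theorem chain_eq_act (l : List J) (hl : ∀ z ∈ l, ∃ a, s a = z) : ∀ {X : Type} [Finite X]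
    (f : X → J) (e : S ≃ X), (∀ a, f (e a) = s a) → ∀ x, W.chain hs l f x = W.obj.act e x := by
  induction l with
  | nil => exact fun f e he x => by rw [W.chain_nil hs f e he]
  | cons z l ih =>
    intro X _ f e he x
    obtain ⟨a₀, rfl⟩ := hl z List.mem_cons_self
    have hfe : ∀ y, f y = s (e.symm y) := fun y => by rw [← he, e.apply_symm_apply]
    let ε : ReplaceFiber s f (s a₀) ≃ X :=
      { toFun := Sum.elim (fun u => u) fun a => e a
        invFun := fun y => if h : f y = s a₀ then Sum.inr ⟨e.symm y, (hfe y).symm.trans h⟩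
          else Sum.inl ⟨y, h⟩
        left_inv := by
          rintro (u | a)
          · exact dif_neg u.2
          · have h : f (e a) = s a₀ := (he a).trans a.2
            refine (dif_pos h).trans (congrArg Sum.inr (Subtype.ext ?_))
            exact e.symm_apply_apply _
        right_inv := fun y => by
          by_cases h : f y = s a₀
          · exact (congrArg (Sum.elim _ _) (dif_pos h)).trans (e.apply_symm_apply y)
          · exact congrArg (Sum.elim _ _) (dif_neg h) }
    have hε : ∀ u, f (ε u) = replaceMap s f (s a₀) u := by
      rintro (u | a)
      · rfl
      · exact he a
    rw [chain_cons, W.isStandardOp.op_none ε (Sum.inr ⟨a₀, rfl⟩), ← W.chain_act hs l _ f ε hε,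
      ih (fun z hz => hl z (List.mem_cons_of_mem _ hz)) f e he]
    · rfl
    · rintro (u | a) h
      · rfl
      · exact absurd (congrArg Sum.inr (Subtype.ext (hs a.2))) h

/-- The composite of the operations for all points. -/
noncomputable def total [Finite J] {X : Type} [Finite X] (f : X → J) :
    W.obj.obj (.of S) →ₗ[k] W.obj.obj (.of X) :=
  W.chain hs (Finite.exists_univ_list J).choose f

/-- Two enumerations of `J` differ by a permutation, and `chain_perm` applies. -/
theorem total_eq_chain [Finite J] {X : Type} [Finite X] (f : X → J) (l : List J) (hl : l.Nodup)
    (hmem : ∀ j, j ∈ l) (x : W.obj.obj (.of S)) : W.total hs f x = W.chain hs l f x := by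
  obtain ⟨h1, h2⟩ := (Finite.exists_univ_list J).choose_spec
  refine W.chain_perm hs ?_ f x
  rw [List.perm_ext_iff_of_nodup h1 hl]
  exact fun j => iff_of_true (h2 j) (hmem j)

/-- No point of `J` is missed, so the points of the larger set outside the image of `j` are exactly
the missed ones, and each of them contributes a factor `δ`. -/
theorem total_of_injective [Finite J] {J' : Type} [Finite J'] {j : J → J'} (hj : j.Injective)
    {X : Type} [Finite X] (f : X → J) (hJ : numMissed s f = 0) (x : W.obj.obj (.of S)) :
    W.total (hj.comp hs) (j ∘ f) x = δ ^ numMissed (j ∘ s) (j ∘ f) • W.total hs f x := by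
  obtain ⟨l, hl, hmem⟩ := Finite.exists_univ_list J
  obtain ⟨m, hm, hmm⟩ := Finite.exists_univ_list
    {z : J' // (∀ a, (j ∘ s) a ≠ z) ∧ ∀ x, (j ∘ f) x ≠ z}
  have h0 : ∀ i : J, (∃ a, s a = i) ∨ ∃ x, f x = i := by
    intro i
    by_contra! hi
    have : IsEmpty {i : J // (∀ a, s a ≠ i) ∧ ∀ x, f x ≠ i} := by
      -- `Nat.card` is also `0` for infinite types, so the finiteness of `J` is needed to conclude
      -- that the type is empty.
      have h1 := (Nat.card_eq_zero (α := {i : J // (∀ a, s a ≠ i) ∧ ∀ x, f x ≠ i})).1 hJ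
      exact h1.resolve_right (not_infinite_iff_finite.2 inferInstance)
    exact this.elim ⟨i, hi⟩
  have hlen : m.length = numMissed (j ∘ s) (j ∘ f) := by
    have h1 : Fintype {z : J' // (∀ a, (j ∘ s) a ≠ z) ∧ ∀ x, (j ∘ f) x ≠ z} := Fintype.ofFinite _
    rw [numMissed, Nat.card_eq_fintype_card, ← List.toFinset_card_of_nodup hm, ← Finset.card_univ]
    congr 1
    ext z
    simp [hmm]
  -- The set `J'` is enumerated with its missed points first, so that they can be stripped off as a
  -- power of `δ`.
  rw [W.total_eq_chain hs f l hl hmem, W.total_eq_chain (hj.comp hs) (j ∘ f)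
    (m.map Subtype.val ++ l.map j), W.chain_append_of_missed (hj.comp hs), W.chain_map hs hj,
    List.length_map, hlen]
  · intro z hz
    obtain ⟨z, -, rfl⟩ := List.mem_map.1 hz
    exact z.2
  · refine List.Nodup.append (hm.map Subtype.val_injective) (hl.map hj) ?_
    intro z hz hz'
    obtain ⟨z, -, rfl⟩ := List.mem_map.1 hz
    obtain ⟨i, -, hi⟩ := List.mem_map.1 hz'
    rcases h0 i with ⟨a, rfl⟩ | ⟨x, rfl⟩
    · exact z.2.1 a hi
    · exact z.2.2 x hi
  · intro z
    by_cases hz : (∀ a, (j ∘ s) a ≠ z) ∧ ∀ x, (j ∘ f) x ≠ z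
    · exact List.mem_append_left _ (List.mem_map.2 ⟨⟨z, hz⟩, hmm _, rfl⟩)
    · refine List.mem_append_right _ ?_
      rw [not_and_or] at hz
      push Not at hz
      rcases hz with ⟨a, rfl⟩ | ⟨x, rfl⟩
      · exact List.mem_map.2 ⟨s a, hmem _, rfl⟩
      · exact List.mem_map.2 ⟨f x, hmem _, rfl⟩

/-- The added hook starts at `x₀`, so its new points join the part of `x₀`. When this part is
processed last, its hook and `q` merge into the hook of `f'` over the same point; away from this
part `q` is a bijection. -/
theorem total_merge [Finite J] {X Y : Type} [Finite X] [Finite Y] (f : X → J) (f' : Y → J)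
    (q : X → Option Y) (hq : q.Injective) (x₀ : X) (hx₀ : q x₀ = none)
    (h₁ : ∀ x y, q x = some y → f' y = f x)
    (h₂ : ∀ y, (¬ ∃ x, q x = some y) → f' y = f x₀) (x : W.obj.obj (.of S)) :
    W.op q hq (W.total hs f x) = W.total hs f' x := by
  obtain ⟨l, hl, hmem⟩ := Finite.exists_univ_list J
  -- The head of the list is the operation applied last, so `f x₀` is moved there to be adjacent to
  -- `q`.
  obtain ⟨l', hl'⟩ : ∃ l', l.Perm (f x₀ :: l') := ⟨_, List.perm_cons_erase (hmem (f x₀))⟩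
  have hne : ∀ u, f u ≠ f x₀ → ∃ y, q u = some y := fun u hu =>
    Option.ne_none_iff_exists'.1 fun h => hu (by rw [hq (h.trans hx₀.symm)])
  have hf' : ∀ y, f' y ≠ f x₀ → ∃ u, q u = some y := fun y hy => by
    by_contra h
    exact hy (h₂ y h)
  -- The map `q` away from the part of `x₀`: it cannot take the value `none` there, since by
  -- injectivity only `x₀` is sent to `none`.
  let g : {u // f u ≠ f x₀} → {y // f' y ≠ f x₀} := fun u =>
    ⟨(hne u u.2).choose, by rw [h₁ u _ (hne u u.2).choose_spec]; exact u.2⟩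
  have hg : ∀ u : {u // f u ≠ f x₀}, q u = some (g u : Y) := fun u => (hne u u.2).choose_spec
  have hgb : Function.Bijective g := by
    constructor
    · intro u v huv
      refine Subtype.ext (hq ?_)
      rw [hg, hg, huv]
    · rintro ⟨y, hy⟩
      obtain ⟨u, hu⟩ := hf' y hy
      refine ⟨⟨u, by rw [← h₁ u y hu]; exact hy⟩, Subtype.ext (Option.some.inj ?_)⟩
      rw [← hg]
      exact hu
  let ε : ReplaceFiber s f (f x₀) ≃ ReplaceFiber s f' (f x₀) :=
    Equiv.sumCongr (Equiv.ofBijective g hgb) (Equiv.refl _)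
  have hε : ∀ u, replaceMap s f' (f x₀) (ε u) = replaceMap s f (f x₀) u := by
    rintro (u | a)
    · exact h₁ u _ (hg u)
    · rfl
  have hp : Function.Injective fun u => replaceHook s f' (f x₀) (ε u) :=
    (replaceHook_injective hs _ _).comp ε.injective
  rw [W.total_eq_chain hs f l hl hmem, W.total_eq_chain hs f' l hl hmem, W.chain_perm hs hl',
    W.chain_perm hs hl', chain_cons, chain_cons, W.chain_act hs l' _ _ ε hε,
    W.op_act _ _ ε _ hp fun _ => rfl]
  refine W.isWittOp.merge _ _ _ _ _ _ ⟨⟨x₀, hx₀, ?_⟩, ?_⟩ _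
  · exact fun u hu => exists_replaceHook.1 ⟨u, hu⟩ rfl
  · rintro (u | a)
    · exact (hg u).symm
    · rfl

/-- Without a source point over `none`, the new points form a part of their own, labelled by the
extra point of `Option J`. The injection `q` is itself the hook of this part, as `S` has no point
there. -/
theorem total_new [Finite J] {X Y : Type} [Finite X] [Finite Y] (f : X → J) (f' : Y → Option J)
    (q : X → Option Y) (hq : q.Injective) (hqn : ∀ x, q x ≠ none)
    (h₁ : ∀ x y, q x = some y → f' y = some (f x))
    (h₂ : ∀ y, (¬ ∃ x, q x = some y) → f' y = none) (x : W.obj.obj (.of S)) :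
    W.op q hq (W.total hs f x) = W.total ((Option.some_injective J).comp hs) f' x := by
  obtain ⟨l, hl, hmem⟩ := Finite.exists_univ_list J
  have hs' := (Option.some_injective J).comp hs
  have hf' : ∀ y, f' y ≠ none → ∃ u, q u = some y := fun y hy => by
    by_contra h
    exact hy (h₂ y h)
  have hne : ∀ u, ∃ y, q u = some y := fun u => Option.ne_none_iff_exists'.1 (hqn u)
  choose g hg using hne
  let g' : X → ReplaceFiber (some ∘ s) f' none := fun u =>
    Sum.inl ⟨g u, by rw [h₁ u _ (hg u)]; exact Option.some_ne_none _⟩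
  have hg' : Function.Bijective g' := by
    constructor
    · intro u v huv
      refine hq ?_
      rw [hg, hg]
      exact congrArg some (congrArg Subtype.val (Sum.inl.inj huv))
    · rintro (⟨y, hy⟩ | ⟨a, ha⟩)
      · obtain ⟨u, hu⟩ := hf' y hy
        exact ⟨u, congrArg Sum.inl (Subtype.ext (Option.some.inj ((hg u).symm.trans hu)))⟩
      · exact absurd ha (Option.some_ne_none _)
  let ε : X ≃ ReplaceFiber (some ∘ s) f' none := Equiv.ofBijective g' hg'
  have hε : ∀ u, replaceMap (some ∘ s) f' none (ε u) = (some ∘ f) u := fun u => h₁ u _ (hg u)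
  rw [W.total_eq_chain hs f l hl hmem, W.total_eq_chain hs' f' (none :: l.map some), chain_cons,
    W.chain_act hs' _ _ _ ε hε, W.chain_map hs (Option.some_injective J), W.op_act _ _ ε _ hq]
  · exact hg
  · refine List.nodup_cons.2 ⟨?_, hl.map (Option.some_injective J)⟩
    intro h
    obtain ⟨_, -, h⟩ := List.mem_map.1 h
    exact Option.some_ne_none _ h
  · rintro (_ | j)
    · exact List.mem_cons_self
    · exact List.mem_cons_of_mem _ (List.mem_map.2 ⟨j, hmem j, rfl⟩)

end HookModule

end Chain

/-! ### From operations to a module over the restricted partition category -/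

section HookModule

open scoped Classical

variable {k : Type u} [CommRing k] {δ : k}

namespace HookModule

variable (W : HookModule δ)

/-- The map induced by a restricted diagram. -/
noncomputable def diagramMap {S T : Type} [Finite S] [Finite T] (ρ : Diagram S T) :
    W.obj.obj (.of S) →ₗ[k] W.obj.obj (.of T) :=
  if h : ρ.IsRestricted then
    W.total ((IsRestricted_iff_injective ρ).1 h) fun x => Quotient.mk ρ (Sum.inr x)
  -- An irrelevant default: `homMap` uses combinations of restricted diagrams only.
  else 0

/-- The map induced by a morphism of the restricted partition category. -/
noncomputable def homMap {S T : Type} [Finite S] [Finite T] :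
    ((ResPartitionCat.of S : ResPartitionCat k δ) ⟶ .of T) →ₗ[k]
      (W.obj.obj (.of S) →ₗ[k] W.obj.obj (.of T)) :=
  Finsupp.linearCombination k W.diagramMap ∘ₗ (restrictedHom k S T).subtype

theorem homMap_ofDiagram {S T : Type} [Finite S] [Finite T] (ρ : Diagram S T)
    (hρ : ρ.IsRestricted) :
    W.homMap (ResPartitionCat.ofDiagram k δ (S := .of S) (T := .of T) ρ hρ) =
      W.total ((IsRestricted_iff_injective ρ).1 hρ) fun x => Quotient.mk ρ (Sum.inr x) := by
  refine (Finsupp.linearCombination_single k (1 : k) ρ).trans ?_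
  rw [one_smul, diagramMap, dif_pos hρ]

/-- The parts of the diagram embed in `J`, and the complement of their image consists of the empty
parts. These give the same power of `δ` on both sides, by `total_of_injective`. -/
theorem homMap_cospanHom {S T J : Type} [Finite S] [Finite T] [Finite J] {s : S → J}
    (hs : s.Injective) (f : T → J) : W.homMap (cospanHom δ s hs f) = W.total hs f := by
  rw [cospanHom, map_smul, homMap_ofDiagram]
  let j : Quotient (kerDiagram s f) → J := Quotient.lift (Sum.elim s f) fun _ _ h => h
  have hj : j.Injective := by
    intro c c'
    induction c using Quotient.inductionOn
    induction c' using Quotient.inductionOn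
    exact fun h => Quotient.sound h
  ext x
  exact (W.total_of_injective ((IsRestricted_iff_injective _).1 (kerDiagram_isRestricted hs f)) hj
    (fun x => Quotient.mk (kerDiagram s f) (Sum.inr x)) (numMissed_quotient _) x).symm

theorem ofEquiv_eq_cospanHom {S T : Type} [Finite S] [Finite T] (e : S ≃ T) :
    ResPartitionCat.ofDiagram k δ (S := .of S) (T := .of T) (Diagram.ofEquiv e)
      (Diagram.isRestricted_ofEquiv e) = cospanHom δ e e.injective id := by
  have : IsEmpty {j : T // (∀ a, e a ≠ j) ∧ ∀ x, id x ≠ j} := ⟨fun j => j.2.2 j.1 rfl⟩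
  have h : numMissed e (id : T → T) = 0 := Nat.card_of_isEmpty
  rw [cospanHom, h, pow_zero, one_smul]
  rfl

theorem homMap_ofEquiv {S T : Type} [Finite S] [Finite T] (e : S ≃ T) :
    W.homMap (ResPartitionCat.ofDiagram k δ (S := .of S) (T := .of T) (Diagram.ofEquiv e)
      (Diagram.isRestricted_ofEquiv e)) = W.obj.act e := by
  rw [ofEquiv_eq_cospanHom, homMap_cospanHom]
  ext x
  exact W.chain_eq_act _ _ (fun z _ => e.surjective z) id e (fun _ => rfl) x

theorem homMap_comp_ofEquiv {S T U : Type} [Finite S] [Finite T] [Finite U]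
    (f : (ResPartitionCat.of S : ResPartitionCat k δ) ⟶ .of T) (e : T ≃ U) :
    W.homMap (f ≫ ResPartitionCat.ofDiagram k δ (S := .of T) (T := .of U) (Diagram.ofEquiv e)
      (Diagram.isRestricted_ofEquiv e)) = W.obj.act e ∘ₗ W.homMap f := by
  refine hom_induction_ofDiagram (fun f => W.homMap (f ≫ ResPartitionCat.ofDiagram k δ
    (S := .of T) (T := .of U) (Diagram.ofEquiv e) (Diagram.isRestricted_ofEquiv e)) =
      W.obj.act e ∘ₗ W.homMap f) ?_ (fun f g hf hg => ?_) (fun c f hf => ?_) (fun ρ hρ => ?_) f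
  · rw [Limits.zero_comp, map_zero, map_zero, LinearMap.comp_zero]
  · rw [Preadditive.add_comp, map_add, map_add, hf, hg, LinearMap.comp_add]
  · rw [Linear.smul_comp, map_smul, map_smul, hf, LinearMap.comp_smul]
  · have h : IsCospanGlue (fun a => Quotient.mk ρ (Sum.inl a)) (fun x => Quotient.mk ρ (Sum.inr x))
        e id id fun y => Quotient.mk ρ (Sum.inr (e.symm y)) :=
      ⟨fun x => by rw [e.symm_apply_apply]; rfl, Function.injective_id,
        fun y y' _ => Or.inr ⟨e.surjective y, e.surjective y'⟩, fun _ y _ => e.surjective y,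
        fun l => Or.inl ⟨l, rfl⟩⟩
    rw [ofDiagram_eq_cospanHom, ofEquiv_eq_cospanHom, cospanHom_comp h, homMap_cospanHom,
      homMap_cospanHom]
    ext x
    exact W.chain_act _ _ _ _ e (fun x => by simp) x

/-- If `q` takes the value `none`, at `t₀` say, the hook joins the part of `t₀` and the gluing has
the same set `J` of parts. Otherwise the hook is a new part and the gluing lives over `Option J`. -/
theorem homMap_cospanHom_comp_hookHom {S T U J : Type} [Finite S] [Finite T] [Finite U] [Finite J]
    {s : S → J} (hs : s.Injective) (f : T → J) (q : T → Option U) (hq : q.Injective) :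
    W.homMap (cospanHom δ s hs f ≫ hookHom δ q hq) = W.op q hq ∘ₗ W.homMap (cospanHom δ s hs f) := by
  by_cases hn : ∃ t, q t = none
  · obtain ⟨t₀, ht₀⟩ := hn
    -- Every part of the hook now has a source vertex `g o`, unique because `q` is injective, so `f
    -- ∘ g` is the second leg of the gluing.
    have hex : ∀ o : HookPart q, ∃ t, q t = o.1 := fun o =>
      o.2.elim (fun h => ⟨t₀, ht₀.trans h.symm⟩) id
    choose g hg using hex
    have hgi : ∀ o t, q t = o.1 → g o = t := fun o t h => hq ((hg o).trans h.symm)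
    have hr : ∀ o : HookPart q, o ∈ Set.range (hookIn q) := fun o => ⟨g o, Subtype.ext (hg o)⟩
    have h : IsCospanGlue s f (hookIn q) (hookOut q) id (f ∘ g) :=
      ⟨fun x => congrArg f (hgi _ x rfl).symm, Function.injective_id,
        fun y y' _ => Or.inr ⟨hr y, hr y'⟩, fun _ y _ => hr y, fun l => Or.inl ⟨l, rfl⟩⟩
    rw [hookHom, cospanHom_comp h, homMap_cospanHom, homMap_cospanHom]
    ext x
    refine (W.total_merge hs f _ q hq t₀ ht₀ (fun t y h => ?_) (fun y h => ?_) x).symm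
    · exact congrArg f (hgi _ t (congrArg Subtype.val (hookOut_of_mem h)).symm)
    · exact congrArg f (hgi _ t₀ (ht₀.trans (congrArg Subtype.val (hookOut_of_notMem h)).symm))
  · let b : HookPart q → Option J := fun o =>
      if h : ∃ t, q t = o.1 then some (f h.choose) else none
    have hb : ∀ t, b (hookIn q t) = some (f t) := fun t => by
      have h : ∃ t', q t' = (hookIn q t).1 := ⟨t, rfl⟩
      exact (dif_pos h).trans (congrArg (some ∘ f) (hq h.choose_spec))
    have hbn : ∀ o, o ∉ Set.range (hookIn q) → b o = none := fun o ho =>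
      dif_neg fun ⟨t, ht⟩ => ho ⟨t, Subtype.ext ht⟩
    have h : IsCospanGlue s f (hookIn q) (hookOut q) some b := by
      refine ⟨fun x => (hb x).symm, Option.some_injective _, fun o o' hoo => ?_, fun j o ho => ?_,
        ?_⟩
      · by_cases ho : o ∈ Set.range (hookIn q)
        · refine Or.inr ⟨ho, ?_⟩
          by_contra ho'
          obtain ⟨t, rfl⟩ := ho
          rw [hb, hbn _ ho'] at hoo
          exact Option.some_ne_none _ hoo
        · by_cases ho' : o' ∈ Set.range (hookIn q)
          · obtain ⟨t, rfl⟩ := ho'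
            rw [hb, hbn _ ho] at hoo
            exact absurd hoo.symm (Option.some_ne_none _)
          · have key : ∀ o : HookPart q, o ∉ Set.range (hookIn q) → o.1 = none := fun o ho =>
              o.2.resolve_right fun ⟨t, ht⟩ => ho ⟨t, Subtype.ext ht⟩
            exact Or.inl (Subtype.ext ((key o ho).trans (key o' ho').symm))
      · by_contra ho'
        rw [hbn _ ho'] at ho
        exact Option.some_ne_none _ ho
      · rintro (_ | j)
        · refine Or.inr ⟨⟨none, Or.inl rfl⟩, hbn _ ?_⟩
          rintro ⟨t, ht⟩
          exact hn ⟨t, congrArg Subtype.val ht⟩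
        · exact Or.inl ⟨j, rfl⟩
    rw [hookHom, cospanHom_comp h, homMap_cospanHom, homMap_cospanHom]
    ext x
    refine (W.total_new hs f _ q hq (fun t ht => hn ⟨t, ht⟩) (fun t y h => ?_)
      (fun y h => ?_) x).symm
    · exact (congrArg b (hookOut_of_mem h)).trans (hb t)
    · refine (congrArg b (hookOut_of_notMem h)).trans (hbn _ ?_)
      rintro ⟨t, ht⟩
      exact hn ⟨t, congrArg Subtype.val ht⟩

theorem homMap_comp_hookHom {S T U : Type} [Finite S] [Finite T] [Finite U]
    (f : (ResPartitionCat.of S : ResPartitionCat k δ) ⟶ .of T) (q : T → Option U)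
    (hq : q.Injective) : W.homMap (f ≫ hookHom δ q hq) = W.op q hq ∘ₗ W.homMap f := by
  refine hom_induction_ofDiagram (fun f => W.homMap (f ≫ hookHom δ q hq) =
    W.op q hq ∘ₗ W.homMap f) ?_ (fun f g hf hg => ?_) (fun c f hf => ?_) (fun ρ hρ => ?_) f
  · rw [Limits.zero_comp, map_zero, map_zero, LinearMap.comp_zero]
  · rw [Preadditive.add_comp, map_add, map_add, hf, hg, LinearMap.comp_add]
  · rw [Linear.smul_comp, map_smul, map_smul, hf, LinearMap.comp_smul]
  · rw [ofDiagram_eq_cospanHom, homMap_cospanHom_comp_hookHom]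

/-- Induction over generators for `g`, with `f` fixed: composition with a bijection and with a hook
is already known, and the general case follows by associativity. -/
theorem homMap_comp {S T U : Type} [Finite S] [Finite T] [Finite U]
    (f : (ResPartitionCat.of S : ResPartitionCat k δ) ⟶ .of T)
    (g : (ResPartitionCat.of T : ResPartitionCat k δ) ⟶ .of U) :
    W.homMap (f ≫ g) = W.homMap g ∘ₗ W.homMap f := by
  refine hom_induction (fun U _ g => W.homMap (f ≫ g) = W.homMap g ∘ₗ W.homMap f)
    (fun U _ => ?_) (fun U _ g g' hg hg' => ?_) (fun U _ c g hg => ?_) (fun U _ e => ?_)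
    (fun U U' _ _ g p hp hg => ?_) U g
  · rw [Limits.comp_zero, map_zero, map_zero, LinearMap.zero_comp]
  · rw [Preadditive.comp_add, map_add, map_add, hg, hg', LinearMap.add_comp]
  · rw [Linear.comp_smul, map_smul, map_smul, hg, LinearMap.smul_comp]
  · rw [homMap_comp_ofEquiv, homMap_ofEquiv]
  · rw [← Category.assoc, homMap_comp_hookHom, homMap_comp_hookHom, hg, LinearMap.comp_assoc]

theorem homMap_id (S : Type) [Finite S] :
    W.homMap (𝟙 (ResPartitionCat.of S : ResPartitionCat k δ)) = LinearMap.id := by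
  ext x
  exact (LinearMap.congr_fun (W.homMap_ofEquiv (Equiv.refl S)) x).trans (W.obj.act_refl x)

theorem homMap_hookHom {S T : Type} [Finite S] [Finite T] (p : S → Option T) (hp : p.Injective) :
    W.homMap (hookHom δ p hp) = W.op p hp := by
  rw [← Category.id_comp (hookHom δ p hp), homMap_comp_hookHom, homMap_id, LinearMap.comp_id]

/-- The module over the restricted partition category of an `FB`-module with operations. -/
noncomputable def toFunctor : ResPartitionCat k δ ⥤ ModuleCat.{u} k where
  obj S := W.obj.obj (.of S.carrier)
  map f := ModuleCat.ofHom (W.homMap f)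
  map_id S := congrArg ModuleCat.ofHom (W.homMap_id S.carrier)
  map_comp f g := congrArg ModuleCat.ofHom (W.homMap_comp f g)

end HookModule

end HookModule

/-! ### From a module to a standard representation -/

section Action

open scoped Classical

attribute [local instance] Fintype.ofFinite

variable {k : Type u} [CommRing k] {δ : k}

/-- Only the part `none` can be empty. It is so exactly when `p` avoids `none` and reaches all of
`Y`, that is, when `B` is the single point `none`; this is the convention `ω_∅ = δ`. -/
theorem numMissed_hook {X Y : Type} [Finite X] [Finite Y] (p : X → Option Y) :
    numMissed (hookIn p) (hookOut p) = if (Set.range p)ᶜ = {none} then 1 else 0 := by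
  have h1 : ∀ o : HookPart p, (∀ x, hookIn p x ≠ o) → o = ⟨none, Or.inl rfl⟩ := fun o ho =>
    Subtype.ext (o.2.resolve_right fun ⟨x, hx⟩ => ho x (Subtype.ext hx))
  split_ifs with h
  · have hn : none ∉ Set.range p := by rw [← Set.mem_compl_iff, h]; rfl
    refine Nat.card_eq_one_iff_exists.2
      ⟨⟨⟨none, Or.inl rfl⟩, fun x hx => hn ⟨x, congrArg Subtype.val hx⟩, fun y hy => ?_⟩,
        fun o => Subtype.ext (h1 _ o.2.1)⟩
    have hy' : some y ∈ Set.range p := by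
      by_contra hy'
      rw [← Set.mem_compl_iff, h] at hy'
      exact Option.some_ne_none y hy'
    obtain ⟨x, hx⟩ := hy'
    rw [hookOut_of_mem hx] at hy
    exact hn ⟨x, congrArg Subtype.val hy⟩
  · have : IsEmpty {o : HookPart p // (∀ x, hookIn p x ≠ o) ∧ ∀ y, hookOut p y ≠ o} := by
      refine ⟨fun ⟨o, ho, ho'⟩ => h ?_⟩
      obtain rfl := h1 o ho
      ext (_ | y)
      · exact iff_of_true (fun ⟨x, hx⟩ => ho x (Subtype.ext hx)) rfl
      · refine iff_of_false (fun hy => ho' y (hookOut_of_notMem hy)) (Option.some_ne_none y)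
    exact Nat.card_of_isEmpty

theorem hook_comp_ofEquiv {X Y : Type} (p : X → Option Y) (B : Set (Option Y))
    (hB : ∀ o, o ∈ B ↔ o ∉ Set.range p) (r : X ≃ ↥Bᶜ) (hr : ∀ x, (r x : Option Y) = p x) :
    (Diagram.ofEquiv r).comp ((hook none B).comp (Diagram.ofEquiv (noneCompl Y))) =
      kerDiagram (hookIn p) (hookOut p) := by
  rw [Diagram.ofEquiv_comp, Diagram.comp_ofEquiv]
  have h1 : ∀ y, (((noneCompl Y).symm y : ↥({none}ᶜ : Set (Option Y))) : Option Y) = some y :=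
    fun y => by rw [← some_noneCompl, Equiv.apply_symm_apply]
  have h2 : ∀ v : X ⊕ Y, Sum.elim (fun s : ↥Bᶜ => (s : Option Y))
      (fun t : ↥({none}ᶜ : Set (Option Y)) => if (t : Option Y) ∈ B then none else (t : Option Y))
        (Sum.map id (noneCompl Y).symm (Sum.map r id v)) =
      (Sum.elim (hookIn p) (hookOut p) v).1 := by
    rintro (x | y)
    · exact hr x
    · change (if _ then _ else _) = if _ then _ else _
      rw [h1, hB]
      by_cases h : some y ∈ Set.range p
      · exact (if_neg (not_not.2 h)).trans (if_pos h).symm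
      · exact (if_pos h).trans (if_neg h).symm
  ext v w
  exact ⟨fun h => Subtype.ext ((h2 v).symm.trans (Eq.trans h (h2 w))),
    fun h => (h2 v).trans ((congrArg Subtype.val h).trans (h2 w).symm)⟩

theorem ofEquiv_comp_ofDiagram {S T U : Type} [Finite S] [Finite T] [Finite U] (e : S ≃ T)
    (σ : Diagram T U) (hσ : σ.IsRestricted) :
    ResPartitionCat.ofDiagram k δ (S := .of S) (T := .of T) (Diagram.ofEquiv e)
        (Diagram.isRestricted_ofEquiv e) ≫
      ResPartitionCat.ofDiagram k δ (S := .of T) (T := .of U) σ hσ =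
    ResPartitionCat.ofDiagram k δ (S := .of S) (T := .of U) ((Diagram.ofEquiv e).comp σ)
      ((Diagram.isRestricted_ofEquiv e).comp hσ) := by
  rw [ofDiagram_comp, Diagram.loops_ofEquiv_left, pow_zero, one_smul]

theorem ofDiagram_comp_ofEquiv {S T U : Type} [Finite S] [Finite T] [Finite U] (ρ : Diagram S T)
    (hρ : ρ.IsRestricted) (e : T ≃ U) :
    ResPartitionCat.ofDiagram k δ (S := .of S) (T := .of T) ρ hρ ≫
      ResPartitionCat.ofDiagram k δ (S := .of T) (T := .of U) (Diagram.ofEquiv e)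
        (Diagram.isRestricted_ofEquiv e) =
    ResPartitionCat.ofDiagram k δ (S := .of S) (T := .of U) (ρ.comp (Diagram.ofEquiv e))
      (hρ.comp (Diagram.isRestricted_ofEquiv e)) := by
  rw [ofDiagram_comp, Diagram.loops_ofEquiv_right, pow_zero, one_smul]

variable (F : ResPartitionCat k δ ⥤ ModuleCat.{u} k)

theorem hookMap_apply {S : Type} [Finite S] (i : S) (B : Set S) (x : (resFB F).obj (.of ↥Bᶜ)) :
    hookMap F i B x = (if B = {i} then δ else 1) •
      (show (resFB F).obj (.of ↥({i}ᶜ : Set S)) from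
        (F.map (X := .of ↥Bᶜ) (Y := .of ↥({i}ᶜ : Set S))
          (ResPartitionCat.ofDiagram k δ (hook i B) (hook_isRestricted i B))).hom x) := rfl

theorem map_comp_apply {A B C : ResPartitionCat k δ} (f : A ⟶ B) (g : B ⟶ C) (x : F.obj A) :
    (F.map g).hom ((F.map f).hom x) = (F.map (f ≫ g)).hom x :=
  (congrArg (fun f => f.hom x) (F.map_comp f g)).symm

/-- Identifies the operation `hookMap`, formulated with subsets of the ground set, with the action
of the hook morphism of the corresponding injection, including the factor `δ`. -/
theorem act_hookMap [F.Additive] [F.Linear k] {X Y : Type} [Finite X] [Finite Y]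
    (p : X → Option Y) (hp : p.Injective)
    (B : Set (Option Y)) (hB : ∀ o, o ∈ B ↔ o ∉ Set.range p) (r : X ≃ ↥Bᶜ)
    (hr : ∀ x, (r x : Option Y) = p x) (x : (resFB F).obj (.of X)) :
    (resFB F).act (noneCompl Y) (hookMap F none B ((resFB F).act r x)) =
      (F.map (hookHom δ p hp)).hom x := by
  have hB' : B = (Set.range p)ᶜ := Set.ext hB
  have hδ : (if B = {none} then δ else 1) = δ ^ numMissed (hookIn p) (hookOut p) := by
    rw [numMissed_hook, hB']
    split_ifs
    · rw [pow_one]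
    · rw [pow_zero]
  have h1 : hookHom δ p hp = (if B = {none} then δ else 1) •
      (ResPartitionCat.ofDiagram k δ (S := .of X) (T := .of ↥Bᶜ) (Diagram.ofEquiv r)
        (Diagram.isRestricted_ofEquiv r) ≫
      ResPartitionCat.ofDiagram k δ (S := .of ↥Bᶜ) (T := .of ↥({none}ᶜ : Set (Option Y)))
        (hook none B) (hook_isRestricted none B) ≫
      ResPartitionCat.ofDiagram k δ (S := .of ↥({none}ᶜ : Set (Option Y))) (T := .of Y)
        (Diagram.ofEquiv (noneCompl Y)) (Diagram.isRestricted_ofEquiv _)) := by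
    rw [ofDiagram_comp_ofEquiv, ofEquiv_comp_ofDiagram, hδ]
    exact smul_ofDiagram_congr (hook_comp_ofEquiv p B hB r hr).symm _ _ rfl
  rw [h1, F.map_smul, F.map_comp, F.map_comp, hookMap_apply, map_smul]
  rfl

theorem actionAt_tmk {A B S : Type} [Finite A] [Finite B] [Finite S] (e : A ⊕ B ≃ S)
    (x : (resFB F).obj (.of B)) :
    actionAt F S (tmk e (SymV.basis k A) x) = actionSum F _ ((resFB F).act (rightEquiv e) x) :=
  (tdesc_tmk _ e (SymV.basis k A) x).trans (one_smul k _)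

/-- The link between the two sides: the coefficients of the action of a module are the maps induced
by hooks. The Witt relation then follows from the relations between hooks. -/
theorem coefOp_action [F.Additive] [F.Linear k] {X Y : Type} [Finite X] [Finite Y]
    (p : X → Option Y) (hp : p.Injective) (x : (resFB F).obj (.of X)) :
    coefOp (action F) p hp x = (F.map (hookHom δ p hp)).hom x := by
  rw [coefOp, coef_apply]
  refine (congrArg (vproj (resFB F) Y) (actionAt_tmk F (complEquiv p hp) x)).trans ?_
  rw [actionSum, LinearMap.sum_apply]
  refine (vproj_sum_vtens _ fun i => hookMap F i _ _).trans ?_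
  rw [if_pos (@Finset.mem_univ _ (_) _)]
  refine act_hookMap F p hp _ (fun o => ?_) _ (fun x => rfl) x
  constructor
  · rintro ⟨a, rfl⟩
    exact a.2
  · exact fun ho => ⟨⟨o, ho⟩, rfl⟩

theorem isWittRep_action [F.Additive] [F.Linear k] : IsWittRep k ⟨resFB F, action F⟩ := by
  refine isWittRep_of_isWittOp _ ⟨fun p q q' p' hp hq hq' hp' h x => ?_,
    fun p q r hp hq hr h x => ?_⟩
  · rw [coefOp_action, coefOp_action, coefOp_action, coefOp_action]
    refine (map_comp_apply F _ _ x).trans (Eq.trans ?_ (map_comp_apply F _ _ x).symm)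
    exact congrArg (fun f => (F.map f).hom x) (hookHom_comm hp hq hq' hp' h)
  · rw [coefOp_action, coefOp_action, coefOp_action]
    refine (map_comp_apply F _ _ x).trans ?_
    exact congrArg (fun f => (F.map f).hom x) (hookHom_merge hp hq hr h)

theorem hook_singleton {S : Type} (i j : S) : hook i {j} = Diagram.ofEquiv (iota i j) := by
  -- Composing with the injective transposition does not change the kernel, and it turns the map
  -- that defines `hook` into the one that defines the diagram of `iota`.
  have h : ∀ v : ↥({j}ᶜ : Set S) ⊕ ↥({i}ᶜ : Set S), Equiv.swap i j
      (Sum.elim (fun s : ↥({j}ᶜ : Set S) => (s : S))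
      (fun t : ↥({i}ᶜ : Set S) => if (t : S) ∈ ({j} : Set S) then i else (t : S)) v) =
        (Sum.elim (iota i j) id v : ↥({i}ᶜ : Set S)).1 := by
    rintro (s | t)
    · rfl
    · change Equiv.swap i j (if _ then _ else _) = (t : S)
      split_ifs with ht
      · rw [Equiv.swap_apply_left]
        exact ht.symm
      · exact Equiv.swap_apply_of_ne_of_ne t.2 ht
  ext v w
  exact ⟨fun h' => Subtype.ext ((h v).symm.trans ((congrArg (Equiv.swap i j) h').trans (h w))),
    fun h' => (Equiv.swap i j).injective
      ((h v).trans ((congrArg Subtype.val h').trans (h w).symm))⟩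

theorem hookMap_singleton {S : Type} [Finite S] (i j : S)
    (x : (resFB F).obj (.of ↥({j}ᶜ : Set S))) :
    hookMap F i {j} x = (if i = j then δ else 1) • (resFB F).act (iota i j) x := by
  rw [hookMap_apply]
  congr 1
  · simp only [Set.singleton_eq_singleton_iff, eq_comm]
  · have : ∀ (ρ : Diagram ↥({j}ᶜ : Set S) ↥({i}ᶜ : Set S)) (hρ : ρ.IsRestricted),
        ρ = Diagram.ofEquiv (iota i j) →
        (F.map (ResPartitionCat.ofDiagram k δ (S := .of _) (T := .of _) ρ hρ)).hom x =
          (resFB F).act (iota i j) x := by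
      rintro _ _ rfl
      rfl
    exact this _ _ (hook_singleton i j)

theorem iota_self {S : Type} (i : S) : iota i i = Equiv.refl _ := by
  ext s
  exact congrArg (fun e : Equiv.Perm S => e s) (Equiv.swap_self i)

theorem actionSum_congr {S : Type} [Finite S] {B B' : Set S} (h : B = B') (r : ↥B'ᶜ ≃ ↥Bᶜ)
    (hr : ∀ s, (r s : S) = s) (x : (resFB F).obj (.of ↥B'ᶜ)) :
    actionSum F B ((resFB F).act r x) = actionSum F B' x := by
  subst h
  obtain rfl : r = Equiv.refl _ := Equiv.ext fun s => Subtype.ext (hr s)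
  rw [FBModule.act_refl]

theorem glMap_action {S : Type} [Finite S] (j : S) (x : (resFB F).obj (.of ↥({j}ᶜ : Set S))) :
    ((WittData.glMap ⟨resFB F, action F⟩).app (.of S)).hom (vtens (resFB F) j x) =
      actionSum F {j} x := by
  have h1 : ((inclV k).app (.of ↥({j} : Set S))).hom (V.basis k _) = SymV.basis k _ := by
    have h : Nat.card ↥({j} : Set S) = 1 := by simp
    change (dite _ _ _ : (PLift (Nat.card ↥({j} : Set S) = 1) → k) →ₗ[k] k) _ = _
    rw [dif_pos h]
    rfl
  refine (congrArg (actionAt F S) (tensorHomAt_tmk (inclV k) (𝟙 (resFB F))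
    (Equiv.Set.sumCompl {j}) (V.basis k _) x)).trans ?_
  rw [h1]
  refine (actionAt_tmk F _ _).trans (actionSum_congr F ?_ _ (fun s => rfl) x)
  ext s
  constructor
  · rintro ⟨a, rfl⟩
    exact a.2
  · exact fun hs => ⟨⟨s, hs⟩, rfl⟩

/-- For `B = {j}` the operation is `δ` times the identity at `i = j`, and the relabelling `iota` at
every other `i`. -/
theorem isStandardGL_action : IsStandardGL δ (WittData.glMap ⟨resFB F, action F⟩) := by
  intro S j x
  refine (glMap_action F j x).trans ?_
  rw [actionSum, LinearMap.sum_apply, ← Finset.add_sum_erase _ _ (Finset.mem_univ j)]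
  congr 1
  · rw [LinearMap.comp_apply, hookMap_singleton, if_pos rfl, map_smul, iota_self,
      FBModule.act_refl]
  · refine Finset.sum_congr rfl fun i hi => ?_
    rw [LinearMap.comp_apply, hookMap_singleton, if_neg (Finset.ne_of_mem_erase hi), one_smul]

end Action

/-! ### The two functors and the comparison of their composites -/

section Equivalence

open scoped Classical

variable {k : Type u} [CommRing k] {δ : k}

variable (δ) in
/-- The functor from modules over the restricted partition category to standard representations of
the curried Witt algebra. -/
noncomputable def toStandardWittRep : ResPartitionModule k δ ⥤ StandardWittRep δ :=
  (IsStandard δ).lift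
    ((IsWittRep k).lift (toWittData δ) fun F =>
      have := F.property.1
      have := F.property.2
      isWittRep_action F.obj)
    fun F => isStandardGL_action F.obj

/-- The operations on the `FB`-module of a standard representation. -/
noncomputable def HookModule.ofStandard (X : StandardWittRep δ) : HookModule δ where
  obj := X.obj.obj.obj
  op := coefOp X.obj.obj.map
  act_op := act_coefOp X.obj.obj.map
  op_act := coefOp_act X.obj.obj.map
  isWittOp := isWittOp_of_isWittRep X.obj.obj X.obj.property
  isStandardOp := isStandardOp_of_isStandardGL X.obj.obj X.property

/-- It is enough to check naturality on generators. Bijections are covered because `φ` is a map of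
`FB`-modules, and hooks by the hypothesis. -/
theorem HookModule.homMap_naturality {W W' : HookModule δ} (φ : W.obj ⟶ W'.obj)
    (hφ : ∀ {X Y : Type} [Finite X] [Finite Y] (p : X → Option Y) (hp : p.Injective)
      (x : W.obj.obj (.of X)), (φ.app (.of Y)).hom (W.op p hp x) =
        W'.op p hp ((φ.app (.of X)).hom x)) {S T : Type} [Finite S] [Finite T]
    (f : (ResPartitionCat.of S : ResPartitionCat k δ) ⟶ .of T) (x : W.obj.obj (.of S)) :
    (φ.app (.of T)).hom (W.homMap f x) = W'.homMap f ((φ.app (.of S)).hom x) := by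
  refine hom_induction (fun T _ f => (φ.app (.of T)).hom (W.homMap f x) =
    W'.homMap f ((φ.app (.of S)).hom x))
    (fun T _ => ?_) (fun T _ f g hf hg => ?_) (fun T _ c f hf => ?_) (fun T _ e => ?_)
    (fun T U _ _ f p hp hf => ?_) T f
  · rw [map_zero, map_zero, LinearMap.zero_apply, LinearMap.zero_apply, map_zero]
  · rw [map_add, map_add, LinearMap.add_apply, LinearMap.add_apply, map_add, hf, hg]
  · rw [map_smul, map_smul, LinearMap.smul_apply, LinearMap.smul_apply, map_smul, hf]
  · rw [homMap_ofEquiv, homMap_ofEquiv, FBModule.app_act]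
  · rw [homMap_comp_hookHom, homMap_comp_hookHom, LinearMap.comp_apply, LinearMap.comp_apply, hφ,
      hf]

variable (δ) in
/-- The functor from standard representations of the curried Witt algebra to modules over the
restricted partition category. -/
noncomputable def ofStandardWittRep : StandardWittRep δ ⥤ ResPartitionModule k δ where
  obj X := ⟨(HookModule.ofStandard X).toFunctor,
    ⟨fun {_ _ f g} => congrArg ModuleCat.ofHom (map_add (HookModule.ofStandard X).homMap f g)⟩,
    ⟨fun f c => congrArg ModuleCat.ofHom (map_smul (HookModule.ofStandard X).homMap c f)⟩⟩
  map {X Y} φ := ObjectProperty.homMk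
    { app := fun S => φ.hom.hom.hom.app (.of S.carrier)
      naturality := fun _ _ f => ModuleCat.hom_ext (LinearMap.ext fun x =>
        HookModule.homMap_naturality (W := HookModule.ofStandard X)
          (W' := HookModule.ofStandard Y) φ.hom.hom.hom (coefOp_naturality φ.hom.hom) f x) }
  map_id _ := rfl
  map_comp _ _ := rfl

/-- The composites of the two functors return objects that are only provably equal to the given
ones, so morphisms are compared by heterogeneous equality, one layer of structure at a time. -/
theorem natTrans_heq {C D : Type*} [Category* C] [Category* D] {F F' G G' : C ⥤ D} (hF : F = F')
    (hG : G = G') {α : F ⟶ G} {β : F' ⟶ G'} (h : ∀ X, HEq (α.app X) (β.app X)) : HEq α β := by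
  subst hF hG
  exact heq_of_eq (NatTrans.ext (funext fun X => eq_of_heq (h X)))

theorem fullSubcategory_hom_heq {C : Type*} [Category* C] {P : ObjectProperty C}
    {X X' Y Y' : P.FullSubcategory} (hX : X = X') (hY : Y = Y') {f : X ⟶ Y} {g : X' ⟶ Y'}
    (h : HEq f.hom g.hom) : HEq f g := by
  subst hX hY
  exact heq_of_eq (ObjectProperty.hom_ext _ (eq_of_heq h))

theorem wittData_hom_heq {X X' Y Y' : WittData k} (hX : X = X') (hY : Y = Y') {f : X ⟶ Y}
    {g : X' ⟶ Y'} (h : HEq f.hom g.hom) : HEq f g := by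
  subst hX hY
  exact heq_of_eq (WittData.Hom.ext (eq_of_heq h))

theorem wittData_ext {X Y : WittData k} (hobj : X.obj = Y.obj)
    (h : ∀ (A B : Type) [Finite A] [Finite B] (p : A → Option B) (hp : p.Injective)
      (x : X.obj.obj (.of A)) (y : Y.obj.obj (.of A)), HEq x y →
        HEq (coefOp X.map p hp x) (coefOp Y.map p hp y)) : X = Y := by
  obtain ⟨M, a⟩ := X
  obtain ⟨N, b⟩ := Y
  obtain rfl : M = N := hobj
  congr 1
  exact hom_ext_of_coefOp fun A B _ _ p hp x => eq_of_heq (h A B p hp x x HEq.rfl)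

/-- The map built from the coefficients of the action agrees with the given functor on bijections
and on hooks, hence everywhere by linearity and functoriality. -/
theorem homMap_ofStandard (F : ResPartitionModule k δ) {S T : Type} [Finite S] [Finite T]
    (f : (ResPartitionCat.of S : ResPartitionCat k δ) ⟶ .of T) (x : F.obj.obj (.of S)) :
    (HookModule.ofStandard ((toStandardWittRep δ).obj F)).homMap f x = (F.obj.map f).hom x := by
  have := F.property.1
  have := F.property.2
  refine hom_induction (fun T _ f => (HookModule.ofStandard ((toStandardWittRep δ).obj F)).homMap
    f x = (F.obj.map f).hom x)
    (fun T _ => ?_) (fun T _ f g hf hg => ?_) (fun T _ c f hf => ?_) (fun T _ e => ?_)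
    (fun T U _ _ f p hp hf => ?_) T f
  · rw [map_zero, F.obj.map_zero]
    rfl
  · rw [map_add, F.obj.map_add]
    exact congrArg₂ (· + ·) hf hg
  · rw [map_smul, F.obj.map_smul]
    exact congrArg (c • ·) hf
  · rw [HookModule.homMap_ofEquiv]
    rfl
  · rw [HookModule.homMap_comp_hookHom]
    exact (congrArg (coefOp (action F.obj) p hp) hf).trans
      ((coefOp_action F.obj p hp _).trans (map_comp_apply F.obj f _ x))

theorem ofStandardWittRep_obj_toStandardWittRep (F : ResPartitionModule k δ) :
    (ofStandardWittRep δ).obj ((toStandardWittRep δ).obj F) = F := by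
  have h : ((ofStandardWittRep δ).obj ((toStandardWittRep δ).obj F)).obj = F.obj :=
    Functor.hext (fun S => rfl) fun S T f => heq_of_eq (ModuleCat.hom_ext
      (LinearMap.ext fun x => homMap_ofStandard F f x))
  exact ObjectProperty.FullSubcategory.ext h

/-- The underlying `FB`-module is recovered from the action of bijections, and the map `a` from its
coefficients, which are the actions of hooks. -/
theorem toStandardWittRep_obj_ofStandardWittRep (X : StandardWittRep δ) :
    (toStandardWittRep δ).obj ((ofStandardWittRep δ).obj X) = X := by
  have h1 : resFB (HookModule.ofStandard X).toFunctor = X.obj.obj.obj :=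
    Functor.hext (fun S => rfl) fun S T e => heq_of_eq (ModuleCat.hom_ext
      ((HookModule.ofStandard X).homMap_ofEquiv (S := S.carrier) (T := T.carrier) e))
  have h : ((toStandardWittRep δ).obj ((ofStandardWittRep δ).obj X)).obj.obj = X.obj.obj := by
    refine wittData_ext h1 fun A B _ _ p hp x y hxy => ?_
    obtain rfl : x = y := eq_of_heq hxy
    have := ((ofStandardWittRep δ).obj X).property.1
    have := ((ofStandardWittRep δ).obj X).property.2
    exact heq_of_eq ((coefOp_action ((ofStandardWittRep δ).obj X).obj p hp x).trans
      (LinearMap.congr_fun ((HookModule.ofStandard X).homMap_hookHom p hp) x))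
  exact ObjectProperty.FullSubcategory.ext (ObjectProperty.FullSubcategory.ext h)

end Equivalence

end CurriedWitt

open CurriedWitt
theorem mainTheorem2 (k : Type u) [CommRing k] (δ : k) :
    ∃ (F : ResPartitionModule k δ ⥤ StandardWittRep δ)
      (G : StandardWittRep δ ⥤ ResPartitionModule k δ),
      F ⋙ G = 𝟭 (ResPartitionModule k δ) ∧ G ⋙ F = 𝟭 (StandardWittRep δ) ∧
        F ⋙ (IsStandard δ).ι ⋙ (IsWittRep k).ι = toWittData δ := by
  refine ⟨toStandardWittRep δ, ofStandardWittRep δ, ?_, ?_, rfl⟩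
  -- Both functors keep the components of a morphism, so after transport along the equalities of
  -- objects the components agree by reflexivity. The same holds for the other composite.
  · refine Functor.hext ofStandardWittRep_obj_toStandardWittRep fun F G φ => ?_
    refine fullSubcategory_hom_heq (ofStandardWittRep_obj_toStandardWittRep F)
      (ofStandardWittRep_obj_toStandardWittRep G) (natTrans_heq
        (congrArg ObjectProperty.FullSubcategory.obj (ofStandardWittRep_obj_toStandardWittRep F))
        (congrArg ObjectProperty.FullSubcategory.obj (ofStandardWittRep_obj_toStandardWittRep G))
        fun S => HEq.rfl)
  · refine Functor.hext toStandardWittRep_obj_ofStandardWittRep fun X Y φ => ?_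
    have hX := toStandardWittRep_obj_ofStandardWittRep X
    have hY := toStandardWittRep_obj_ofStandardWittRep Y
    refine fullSubcategory_hom_heq hX hY (fullSubcategory_hom_heq
      (congrArg (fun X => X.obj) hX) (congrArg (fun X => X.obj) hY)
      (wittData_hom_heq (congrArg (fun X => X.obj.obj) hX) (congrArg (fun X => X.obj.obj) hY)
        (natTrans_heq (congrArg (fun X => X.obj.obj.obj) hX) (congrArg (fun X => X.obj.obj.obj) hY)
          fun S => HEq.rfl)))
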